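/- Let $k$ be a field, let $P\subseteq\mathbb{R}^d$ be a full-dimensional lattice polytope (the convex hull of finitely many points of $\mathbb{Z}^d$, with affine span $\mathbb{R}^d$), and let $m\ge 0$ be an integer. Let $\Sigma_P$ be the inner normal fan of $P$: its cones are the sets of $v\in\mathbb{R}^d$ whose linear form $\langle v,\cdot\rangle$ is minimized over $P$ at every point of $F$, one cone for each non-empty face $F$ of $P$. Let $\Sigma_P^m=\{\tau_1\times\dots\times\tau_m \mid \tau_i\in\Sigma_P\}$ be the product fan in $(\mathbb{R}^d)^m$. Let $q\colon(\mathbb{R}^d)^m\to(\mathbb{R}^d)^m/\mathbb{R}^d$ be the quotient by the diagonally embedded $\mathbb{R}^d$, and take the lattices $(\mathbb{Z}^d)^m$ in the source and $q((\mathbb{Z}^d)^m)$ in the target. Let $\mathcal{Q}(P,m)$ be the common refinement of the images $q(\tau)$, $\tau\in\Sigma_P^m$, that is, the collection of the cones $\bigcap_{\tau\in\Sigma_P^m,\ x\in q(\tau)}q(\tau)$ for $x\in(\mathbb{R}^d)^m/\mathbb{R}^d$, and let $$\mathcal{R}(P,m)=\{q^{-1}(\xi)\cap\tau \mid \xi\in\mathcal{Q}(P,m),\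 \tau\in\Sigma_P^m\}.$$ Then $\mathcal{Q}(P,m)$ and $\mathcal{R}(P,m)$ are fans (finite collections of strongly convex rational polyhedral cones, closed under passing to faces, any two of which meet in a common face), and $q$ induces a toric morphism of toric varieties over $k$ $$f\colon X_{\mathcal{R}(P,m)}\longrightarrow X_{\mathcal{Q}(P,m)}.$$ For $\mathbf{v}=(v_1,\dots,v_m)\in(\mathbb{R}^d)^m$ let $\mathcal{S}(\mathbf{v})$ be the subdivision of $\mathbb{R}^d$ which is the common refinement of the translated fans $-v_1+\Sigma_P,\dots,-v_m+\Sigma_P$; its cells are the intersections $\bigcap_{i=1}^m(-v_i+\sigma_i)$ with $\sigma_i\in\Sigma_P$. Theorem. The morphism $f$ is flat with all scheme-theoretic fibers reduced if and only if, for every $\mathbf{v}\in(\mathbb{Z}^d)^m$, every non-empty cell $C\in\mathcal{S}(\mathbf{v})$ contains a point of $\mathbb{Z}^d$. -/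

import Mathlib

universe u

open CategoryTheory CategoryTheory.Limits AlgebraicGeometry

noncomputable section

namespace Toric

/-! ### Cones, lattices and fans

`V` is a real vector space and `N` is a lattice in it, given as an additive subgroup of `V`. -/

section General

variable {V V' : Type} [AddCommGroup V] [Module ℝ V] [AddCommGroup V'] [Module ℝ V']

/-- The semigroup `S_σ = σ^∨ ∩ M`: linear forms that are integral on the lattice `N`
and non-negative on the cone `σ`. -/
def dualMonoid (N : AddSubgroup V) (σ : PointedCone ℝ V) : AddSubmonoid (Module.Dual ℝ V) where
  carrier := {w | (∀ x ∈ N, ∃ n : ℤ, w x = n) ∧ ∀ x ∈ σ, 0 ≤ w x}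
  zero_mem' := ⟨fun _ _ => ⟨0, by simp⟩, fun _ _ => by simp⟩
  add_mem' := by
    rintro a b ⟨ha, ha'⟩ ⟨hb, hb'⟩
    refine ⟨fun x hx => ?_, fun x hx => ?_⟩
    · obtain ⟨p, hp⟩ := ha x hx
      obtain ⟨q, hq⟩ := hb x hx
      exact ⟨p + q, by simp [hp, hq]⟩
    · simpa using add_nonneg (ha' x hx) (hb' x hx)

/-- `τ` is a face of the rational polyhedral cone `σ`: `τ = σ ∩ w^⊥` for some `w ∈ σ^∨ ∩ M`.
(For a rational polyhedral cone every supporting hyperplane cuts out the same face as an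
integral one.) -/
def IsFace (N : AddSubgroup V) (τ σ : PointedCone ℝ V) : Prop :=
  ∃ w ∈ dualMonoid N σ, ∀ x, x ∈ τ ↔ x ∈ σ ∧ w x = 0

/-- `Sig` is a fan in `V` with respect to the lattice `N`: a finite collection of strongly convex
rational polyhedral cones, closed under passing to faces, any two of which meet in a common
face. -/
structure IsFan (N : AddSubgroup V) (Sig : Set (PointedCone ℝ V)) : Prop where
  finite : Sig.Finite
  rational : ∀ σ ∈ Sig, ∃ s : Finset V, (∀ x ∈ s, x ∈ N) ∧
    σ = Submodule.span {c : ℝ // 0 ≤ c} (s : Set V)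
  stronglyConvex : ∀ σ ∈ Sig, ∀ x ∈ σ, -x ∈ σ → x = 0
  face_mem : ∀ σ ∈ Sig, ∀ τ, IsFace N τ σ → τ ∈ Sig
  inter_face : ∀ σ ∈ Sig, ∀ τ ∈ Sig, IsFace N (σ ⊓ τ) σ ∧ IsFace N (σ ⊓ τ) τ

/-- `φ` is a map of fans: it respects the lattices and maps each cone of the source into some
cone of the target. -/
structure IsFanMap (N : AddSubgroup V) (Sig : Set (PointedCone ℝ V)) (N' : AddSubgroup V')
    (Sig' : Set (PointedCone ℝ V')) (φ : V →ₗ[ℝ] V') : Prop where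
  map_lattice : ∀ x ∈ N, φ x ∈ N'
  map_cone : ∀ σ ∈ Sig, ∃ σ' ∈ Sig', ∀ x ∈ σ, φ x ∈ σ'

/-! ### Affine toric varieties -/

/-- Composition with `φ`, as a map `S_σ' → S_σ`, if `φ` maps `N` to `N'` and `σ` to `σ'`. -/
def dualMap {N : AddSubgroup V} {σ : PointedCone ℝ V} {N' : AddSubgroup V'}
    {σ' : PointedCone ℝ V'} (φ : V →ₗ[ℝ] V') (hN : ∀ x ∈ N, φ x ∈ N')
    (hσ : ∀ x ∈ σ, φ x ∈ σ') : dualMonoid N' σ' →+ dualMonoid N σ where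
  toFun w := ⟨w.1.comp φ, fun x hx => w.2.1 _ (hN x hx), fun x hx => w.2.2 _ (hσ x hx)⟩
  map_zero' := rfl
  map_add' _ _ := rfl

/-- The affine toric variety `U_σ = Spec k[σ^∨ ∩ M]`. -/
abbrev affineToric (k : Type u) [Field k] (N : AddSubgroup V) (σ : PointedCone ℝ V) : Scheme.{u} :=
  Spec (.of (AddMonoidAlgebra k (dualMonoid N σ)))

/-- The toric morphism `U_σ ⟶ U_σ'` induced by a linear map with `φ N ⊆ N'` and `φ σ ⊆ σ'`. -/
def affineMap (k : Type u) [Field k] {N : AddSubgroup V} {σ : PointedCone ℝ V}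
    {N' : AddSubgroup V'} {σ' : PointedCone ℝ V'} (φ : V →ₗ[ℝ] V') (hN : ∀ x ∈ N, φ x ∈ N')
    (hσ : ∀ x ∈ σ, φ x ∈ σ') : affineToric k N σ ⟶ affineToric k N' σ' :=
  Spec.map (CommRingCat.ofHom (AddMonoidAlgebra.mapDomainRingHom k (dualMap φ hN hσ)))

lemma affineMap_comp (k : Type u) [Field k] {V'' : Type} [AddCommGroup V''] [Module ℝ V'']
    {N : AddSubgroup V} {σ : PointedCone ℝ V} {N' : AddSubgroup V'} {σ' : PointedCone ℝ V'}
    {N'' : AddSubgroup V''} {σ'' : PointedCone ℝ V''} (φ : V →ₗ[ℝ] V')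
    (hN : ∀ x ∈ N, φ x ∈ N') (hσ : ∀ x ∈ σ, φ x ∈ σ') (ψ : V' →ₗ[ℝ] V'')
    (hN' : ∀ x ∈ N', ψ x ∈ N'') (hσ' : ∀ x ∈ σ', ψ x ∈ σ'') :
    affineMap k φ hN hσ ≫ affineMap k ψ hN' hσ' =
      affineMap k (ψ.comp φ) (fun x hx => hN' _ (hN x hx)) (fun x hx => hσ' _ (hσ x hx)) := by
  rw [affineMap, affineMap, affineMap, ← Spec.map_comp, ← CommRingCat.ofHom_comp,
    ← AddMonoidAlgebra.mapDomainRingHom_comp]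
  rfl

lemma affineMap_id (k : Type u) [Field k] {N : AddSubgroup V} {σ : PointedCone ℝ V} :
    affineMap k (N := N) (N' := N) (σ := σ) (σ' := σ) LinearMap.id (fun _ hx => hx)
      (fun _ hx => hx) = 𝟙 _ := by
  have : dualMap (N := N) (N' := N) (σ := σ) (σ' := σ) LinearMap.id (fun _ hx => hx)
      (fun _ hx => hx) = AddMonoidHom.id _ := rfl
  rw [affineMap, this, AddMonoidAlgebra.mapDomainRingHom_id]
  exact Spec.map_id _

/-- The inclusion `U_σ ⟶ U_τ` for `σ ⊆ τ`. -/
abbrev affineIncl (k : Type u) [Field k] (N : AddSubgroup V) {σ τ : PointedCone ℝ V}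
    (h : σ ≤ τ) : affineToric k N σ ⟶ affineToric k N τ :=
  affineMap k LinearMap.id (fun _ hx => hx) (fun _ hx => h hx)

lemma affineIncl_comp (k : Type u) [Field k] {N : AddSubgroup V} {σ τ ρ : PointedCone ℝ V}
    (h : σ ≤ τ) (h' : τ ≤ ρ) :
    affineIncl k N h ≫ affineIncl k N h' = affineIncl k N (h.trans h') :=
  affineMap_comp k LinearMap.id (fun _ hx => hx) (fun _ hx => h hx) LinearMap.id
    (fun _ hx => hx) (fun _ hx => h' hx)

/-- If `τ = σ ∩ w^⊥` is a face, a linear form integral on `N` and non-negative on `τ` becomes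
non-negative on `σ` after adding a multiple of `w`. -/
lemma exists_add_nsmul_mem {N : AddSubgroup V} {σ τ : PointedCone ℝ V}
    (hσ : ∃ s : Finset V, (∀ x ∈ s, x ∈ N) ∧ σ = Submodule.span {c : ℝ // 0 ≤ c} (s : Set V))
    {w : Module.Dual ℝ V} (hw : w ∈ dualMonoid N σ) (hτ : ∀ x, x ∈ τ ↔ x ∈ σ ∧ w x = 0)
    {a : Module.Dual ℝ V} (ha : a ∈ dualMonoid N τ) :
    ∃ n : ℕ, a + n • w ∈ dualMonoid N σ := by
  obtain ⟨s, hs, rfl⟩ := hσ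
  have key : ∀ g ∈ s, ∃ n : ℕ, ∀ n' ≥ n, 0 ≤ a g + n' * w g := by
    intro g hg
    have hgσ : g ∈ Submodule.span {c : ℝ // 0 ≤ c} (s : Set V) := Submodule.subset_span hg
    rcases (hw.2 g hgσ).eq_or_lt with h0 | h0
    · refine ⟨0, fun n' _ => ?_⟩
      rw [← h0]
      simpa using ha.2 g ((hτ g).2 ⟨hgσ, h0.symm⟩)
    · obtain ⟨n, hn⟩ := exists_nat_ge (-a g / w g)
      refine ⟨n, fun n' hn' => ?_⟩
      have h1 : (n : ℝ) ≤ n' := by exact_mod_cast hn'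
      rw [div_le_iff₀ h0] at hn
      nlinarith
  choose! f hf using key
  refine ⟨s.sup f, fun x hx => ?_, fun x hx => ?_⟩
  · obtain ⟨p, hp⟩ := ha.1 x hx
    obtain ⟨q, hq⟩ := hw.1 x hx
    exact ⟨p + (s.sup f : ℕ) * q, by simp [hp, hq]⟩
  · induction hx using Submodule.span_induction with
    | mem g hg => simpa using hf g hg _ (Finset.le_sup hg)
    | zero => simp
    | add x y _ _ hx hy => simpa only [map_add] using add_nonneg hx hy
    | smul c x _ hx =>
      have : (a + s.sup f • w) (c • x) = c.1 * (a + s.sup f • w) x :=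
        map_smul (a + s.sup f • w) c.1 x
      rw [this]
      exact mul_nonneg c.2 hx

/-- The inclusion of a face is the localization at the corresponding character. -/
lemma isLocalization_face (k : Type u) [Field k] {N : AddSubgroup V} {σ τ : PointedCone ℝ V}
    (hσ : ∃ s : Finset V, (∀ x ∈ s, x ∈ N) ∧ σ = Submodule.span {c : ℝ // 0 ≤ c} (s : Set V))
    {w : Module.Dual ℝ V} (hw : w ∈ dualMonoid N σ) (hτ : ∀ x, x ∈ τ ↔ x ∈ σ ∧ w x = 0) :
    letI := (AddMonoidAlgebra.mapDomainRingHom k (dualMap (N := N) (N' := N) (σ := τ) (σ' := σ)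
      LinearMap.id (fun _ hx => hx) (fun x hx => ((hτ x).1 hx).1))).toAlgebra
    IsLocalization.Away (AddMonoidAlgebra.single (⟨w, hw⟩ : dualMonoid N σ) (1 : k))
      (AddMonoidAlgebra k (dualMonoid N τ)) := by
  set φ := dualMap (N := N) (N' := N) (σ := τ) (σ' := σ)
      LinearMap.id (fun _ hx => hx) (fun x hx => ((hτ x).1 hx).1) with hφ
  have hφv : ∀ a, (φ a).1 = a.1 := fun _ => rfl
  have hinj : Function.Injective φ := fun a b hab => by
    rw [Subtype.ext_iff, hφv, hφv] at hab
    exact Subtype.ext hab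
  let : Algebra _ _ := (AddMonoidAlgebra.mapDomainRingHom k φ).toAlgebra
  have halg : ∀ x, algebraMap (AddMonoidAlgebra k (dualMonoid N σ))
      (AddMonoidAlgebra k (dualMonoid N τ)) x = AddMonoidAlgebra.mapDomain φ x := fun _ => rfl
  have hpow : ∀ n : ℕ, algebraMap (AddMonoidAlgebra k (dualMonoid N σ))
      (AddMonoidAlgebra k (dualMonoid N τ))
        (AddMonoidAlgebra.single (⟨w, hw⟩ : dualMonoid N σ) (1 : k)) ^ n =
      AddMonoidAlgebra.single (φ (n • ⟨w, hw⟩)) 1 := by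
    intro n
    rw [← map_pow, AddMonoidAlgebra.single_pow, one_pow, halg, AddMonoidAlgebra.mapDomain_single]
  refine IsLocalization.Away.mk _ ?_ ?_ ?_
  · have hneg : -w ∈ dualMonoid N τ := by
      refine ⟨fun x hx => ?_, fun x hx => ?_⟩
      · obtain ⟨n, hn⟩ := hw.1 x hx
        exact ⟨-n, by simp [hn]⟩
      · simp [((hτ x).1 hx).2]
    refine IsUnit.of_mul_eq_one (AddMonoidAlgebra.single (⟨-w, hneg⟩ : dualMonoid N τ) 1) ?_
    rw [halg, AddMonoidAlgebra.mapDomain_single, AddMonoidAlgebra.single_mul_single,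
      AddMonoidAlgebra.one_def]
    congr 1
    · apply Subtype.ext
      simp [hφv]
    · simp
  · intro x
    induction x using AddMonoidAlgebra.induction_linear with
    | zero => exact ⟨0, 0, by simp⟩
    | add x y hx hy =>
      obtain ⟨n, a, ha⟩ := hx
      obtain ⟨m, b, hb⟩ := hy
      refine ⟨n + m, a * (AddMonoidAlgebra.single (⟨w, hw⟩ : dualMonoid N σ) (1 : k)) ^ m +
        b * (AddMonoidAlgebra.single (⟨w, hw⟩ : dualMonoid N σ) (1 : k)) ^ n, ?_⟩
      rw [map_add, map_mul, map_mul, ← ha, ← hb, map_pow, map_pow]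
      ring
    | single a r =>
      obtain ⟨n, hn⟩ := exists_add_nsmul_mem hσ hw hτ a.2
      refine ⟨n, AddMonoidAlgebra.single ⟨_, hn⟩ r, ?_⟩
      rw [hpow, halg, AddMonoidAlgebra.mapDomain_single, AddMonoidAlgebra.single_mul_single,
        mul_one]
      congr 1
  · intro a b hab
    refine ⟨0, ?_⟩
    rw [halg, halg] at hab
    rw [AddMonoidAlgebra.mapDomain_injective hinj hab]

lemma isOpenImmersion_affineIncl (k : Type u) [Field k] {N : AddSubgroup V}
    {σ τ : PointedCone ℝ V}
    (hσ : ∃ s : Finset V, (∀ x ∈ s, x ∈ N) ∧ σ = Submodule.span {c : ℝ // 0 ≤ c} (s : Set V))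
    (h : IsFace N τ σ) (hle : τ ≤ σ) : IsOpenImmersion (affineIncl k N hle) := by
  obtain ⟨w, hw, hτ⟩ := h
  let : Algebra _ _ := (AddMonoidAlgebra.mapDomainRingHom k (dualMap (N := N) (N' := N)
      (σ := τ) (σ' := σ) LinearMap.id (fun _ hx => hx)
      (fun x hx => ((hτ x).1 hx).1))).toAlgebra
  have := isLocalization_face k hσ hw hτ
  exact IsOpenImmersion.of_isLocalization
    (AddMonoidAlgebra.single (⟨w, hw⟩ : dualMonoid N σ) (1 : k))

lemma range_affineIncl (k : Type u) [Field k] {N : AddSubgroup V} {σ τ : PointedCone ℝ V}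
    (hσ : ∃ s : Finset V, (∀ x ∈ s, x ∈ N) ∧ σ = Submodule.span {c : ℝ // 0 ≤ c} (s : Set V))
    {w : Module.Dual ℝ V} (hw : w ∈ dualMonoid N σ) (hτ : ∀ x, x ∈ τ ↔ x ∈ σ ∧ w x = 0)
    (hle : τ ≤ σ) :
    Set.range (affineIncl k N hle) = (PrimeSpectrum.basicOpen
      (AddMonoidAlgebra.single (⟨w, hw⟩ : dualMonoid N σ) (1 : k)) : Set (PrimeSpectrum _)) := by
  let : Algebra _ _ := (AddMonoidAlgebra.mapDomainRingHom k (dualMap (N := N) (N' := N)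
      (σ := τ) (σ' := σ) LinearMap.id (fun _ hx => hx)
      (fun x hx => ((hτ x).1 hx).1))).toAlgebra
  have := isLocalization_face k hσ hw hτ
  exact PrimeSpectrum.localization_away_comap_range (AddMonoidAlgebra k (dualMonoid N τ))
    (AddMonoidAlgebra.single (⟨w, hw⟩ : dualMonoid N σ) (1 : k))

/-! ### The toric variety of a fan -/

/-- The diagram of affine toric varieties `U_σ`, `σ ∈ Sig`, with the inclusions `U_σ ⟶ U_τ` for
`σ ⊆ τ`. -/
def chartDiagram (k : Type u) [Field k] (N : AddSubgroup V) (Sig : Set (PointedCone ℝ V)) :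
    Sig ⥤ Scheme.{u} where
  obj σ := affineToric k N σ.1
  map f := affineIncl k N (leOfHom f)
  map_id _ := affineMap_id k
  map_comp f g := (affineIncl_comp k (leOfHom f) (leOfHom g)).symm

lemma IsFan.isFace_of_le {N : AddSubgroup V} {Sig : Set (PointedCone ℝ V)} (h : IsFan N Sig)
    {σ τ : PointedCone ℝ V} (hσ : σ ∈ Sig) (hτ : τ ∈ Sig) (hle : σ ≤ τ) : IsFace N σ τ := by
  have := (h.inter_face σ hσ τ hτ).2
  rwa [inf_eq_left.2 hle] at this

lemma IsFan.inf_mem {N : AddSubgroup V} {Sig : Set (PointedCone ℝ V)} (h : IsFan N Sig)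
    {σ τ : PointedCone ℝ V} (hσ : σ ∈ Sig) (hτ : τ ∈ Sig) : σ ⊓ τ ∈ Sig :=
  h.face_mem σ hσ _ (h.inter_face σ hσ τ hτ).1

lemma IsFan.isOpenImmersion (k : Type u) [Field k] {N : AddSubgroup V}
    {Sig : Set (PointedCone ℝ V)} (h : IsFan N Sig) {σ τ : Sig} (f : σ ⟶ τ) :
    IsOpenImmersion ((chartDiagram k N Sig).map f) :=
  isOpenImmersion_affineIncl k (h.rational _ τ.2) (h.isFace_of_le σ.2 τ.2 (leOfHom f))
    (leOfHom f)

lemma IsFan.isLocallyDirected (k : Type u) [Field k] {N : AddSubgroup V}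
    {Sig : Set (PointedCone ℝ V)} (h : IsFan N Sig) :
    (chartDiagram k N Sig ⋙ Scheme.forget).IsLocallyDirected := by
  refine ⟨fun {σ τ κ} fσ fτ x y hxy => ?_⟩
  have hσ := leOfHom fσ
  have hτ := leOfHom fτ
  let ρ : Sig := ⟨σ.1 ⊓ τ.1, h.inf_mem σ.2 τ.2⟩
  let gσ : ρ ⟶ σ := homOfLE (show σ.1 ⊓ τ.1 ≤ σ.1 from inf_le_left)
  let gτ : ρ ⟶ τ := homOfLE (show σ.1 ⊓ τ.1 ≤ τ.1 from inf_le_right)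
  obtain ⟨a, ha, haσ⟩ := h.isFace_of_le σ.2 κ.2 hσ
  obtain ⟨b, hb, hbτ⟩ := h.isFace_of_le τ.2 κ.2 hτ
  have hρ : ∀ z, z ∈ ρ.1 ↔ z ∈ κ.1 ∧ (a + b) z = 0 := by
    intro z
    change (z ∈ σ.1 ∧ z ∈ τ.1) ↔ _
    rw [haσ, hbτ, LinearMap.add_apply]
    constructor
    · rintro ⟨⟨h1, h2⟩, -, h3⟩
      exact ⟨h1, by rw [h2, h3, add_zero]⟩
    · rintro ⟨h1, h2⟩
      have h3 := ha.2 z h1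
      have h4 := hb.2 z h1
      exact ⟨⟨h1, by linarith⟩, h1, by linarith⟩
  have hx := range_affineIncl k (h.rational _ κ.2) ha haσ hσ
  have hy := range_affineIncl k (h.rational _ κ.2) hb hbτ hτ
  have hz := range_affineIncl k (h.rational _ κ.2) ((dualMonoid N κ.1).add_mem ha hb) hρ
    (leOfHom (gσ ≫ fσ))
  have hmem : (affineIncl k N hσ) x ∈ Set.range (affineIncl k N (leOfHom (gσ ≫ fσ))) := by
    have h1 : (affineIncl k N hσ) x ∈ Set.range (affineIncl k N hσ) := ⟨x, rfl⟩
    have h2 : (affineIncl k N hσ) x ∈ Set.range (affineIncl k N hτ) := ⟨y, hxy.symm⟩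
    rw [hx] at h1
    rw [hy] at h2
    rw [hz]
    have : (AddMonoidAlgebra.single (⟨a + b, (dualMonoid N κ.1).add_mem ha hb⟩ :
        dualMonoid N κ.1) (1 : k)) =
        AddMonoidAlgebra.single (⟨a, ha⟩ : dualMonoid N κ.1) (1 : k) *
        AddMonoidAlgebra.single (⟨b, hb⟩ : dualMonoid N κ.1) (1 : k) := by
      rw [AddMonoidAlgebra.single_mul_single, mul_one]
      rfl
    rw [this, PrimeSpectrum.basicOpen_mul]
    exact ⟨h1, h2⟩
  obtain ⟨z, hz'⟩ := hmem
  have e1 : (chartDiagram k N Sig).map (gσ ≫ fσ) z = (chartDiagram k N Sig).map fσ x := hz'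
  have e2 : (chartDiagram k N Sig).map (gτ ≫ fτ) z = (chartDiagram k N Sig).map fτ y :=
    hz'.trans hxy
  have := h.isOpenImmersion k fσ
  have := h.isOpenImmersion k fτ
  refine ⟨ρ, gσ, gτ, z, ?_, ?_⟩
  · apply ((chartDiagram k N Sig).map fσ).isOpenEmbedding.injective
    rw [Functor.map_comp] at e1
    exact e1
  · apply ((chartDiagram k N Sig).map fτ).isOpenEmbedding.injective
    rw [Functor.map_comp] at e2
    exact e2

lemma IsFan.hasColimit (k : Type u) [Field k] {N : AddSubgroup V}
    {Sig : Set (PointedCone ℝ V)} (h : IsFan N Sig) : HasColimit (chartDiagram k N Sig) := by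
  have := h.isLocallyDirected k
  have : ∀ {i j : Sig} (f : i ⟶ j), IsOpenImmersion ((chartDiagram k N Sig).map f) :=
    fun f => h.isOpenImmersion k f
  have : Small.{u} Sig := by
    have := h.finite.to_subtype
    infer_instance
  infer_instance

/-- The toric variety `X_Sig` over `k` of a fan: the affine toric varieties `U_σ`, `σ ∈ Sig`,
glued along the open subschemes `U_(σ ∩ τ)`. -/
def toricVariety (k : Type u) [Field k] {N : AddSubgroup V} {Sig : Set (PointedCone ℝ V)}
    (h : IsFan N Sig) : Scheme.{u} :=
  haveI := h.hasColimit k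
  colimit (chartDiagram k N Sig)

/-- The chart `U_σ ⟶ X_Sig`. -/
def chart (k : Type u) [Field k] {N : AddSubgroup V} {Sig : Set (PointedCone ℝ V)}
    (h : IsFan N Sig) {σ : PointedCone ℝ V} (hσ : σ ∈ Sig) :
    affineToric k N σ ⟶ toricVariety k h :=
  haveI := h.hasColimit k
  colimit.ι (chartDiagram k N Sig) ⟨σ, hσ⟩

lemma affineIncl_chart (k : Type u) [Field k] {N : AddSubgroup V}
    {Sig : Set (PointedCone ℝ V)} (h : IsFan N Sig) {σ τ : PointedCone ℝ V} (hσ : σ ∈ Sig)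
    (hτ : τ ∈ Sig) (hle : σ ≤ τ) : affineIncl k N hle ≫ chart k h hτ = chart k h hσ :=
  haveI := h.hasColimit k
  colimit.w (chartDiagram k N Sig) (homOfLE hle : (⟨σ, hσ⟩ : Sig) ⟶ ⟨τ, hτ⟩)

lemma affineMap_chart_eq (k : Type u) [Field k] {N : AddSubgroup V}
    {σ : PointedCone ℝ V} {N' : AddSubgroup V'} {Sig' : Set (PointedCone ℝ V')}
    (h' : IsFan N' Sig') {φ : V →ₗ[ℝ] V'} (hN : ∀ x ∈ N, φ x ∈ N') {σ' τ' : PointedCone ℝ V'}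
    (hσ' : σ' ∈ Sig') (hτ' : τ' ∈ Sig') (h1 : ∀ x ∈ σ, φ x ∈ σ') (h2 : ∀ x ∈ σ, φ x ∈ τ') :
    affineMap k φ hN h1 ≫ chart k h' hσ' = affineMap k φ hN h2 ≫ chart k h' hτ' := by
  have h3 : ∀ x ∈ σ, φ x ∈ σ' ⊓ τ' := fun x hx => ⟨h1 x hx, h2 x hx⟩
  have e1 := affineMap_comp k φ hN h3 LinearMap.id (fun _ hx => hx)
    (fun _ hx => (inf_le_left : σ' ⊓ τ' ≤ σ') hx)
  have e2 := affineMap_comp k φ hN h3 LinearMap.id (fun _ hx => hx)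
    (fun _ hx => (inf_le_right : σ' ⊓ τ' ≤ τ') hx)
  have e3 := affineIncl_chart k h' (h'.inf_mem hσ' hτ') hσ' inf_le_left
  have e4 := affineIncl_chart k h' (h'.inf_mem hσ' hτ') hτ' inf_le_right
  rw [show affineMap k φ hN h1 = _ from e1.symm, show affineMap k φ hN h2 = _ from e2.symm,
    Category.assoc, Category.assoc, e3, e4]

lemma affineIncl_affineMap_chart (k : Type u) [Field k] {N : AddSubgroup V}
    {σ τ : PointedCone ℝ V} (hle : σ ≤ τ) {N' : AddSubgroup V'} {Sig' : Set (PointedCone ℝ V')}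
    (h' : IsFan N' Sig') {φ : V →ₗ[ℝ] V'} (hN : ∀ x ∈ N, φ x ∈ N') {σ' τ' : PointedCone ℝ V'}
    (hσ' : σ' ∈ Sig') (hτ' : τ' ∈ Sig') (h1 : ∀ x ∈ σ, φ x ∈ σ') (h2 : ∀ x ∈ τ, φ x ∈ τ') :
    affineIncl k N hle ≫ affineMap k φ hN h2 ≫ chart k h' hτ' =
      affineMap k φ hN h1 ≫ chart k h' hσ' := by
  have e := affineMap_comp k LinearMap.id (fun _ hx => hx) (fun _ hx => hle hx) φ hN h2
  rw [← Category.assoc, e]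
  exact affineMap_chart_eq k h' hN _ _ _ _

/-- The toric morphism `X_Sig ⟶ X_Sig'` of a map of fans `φ`: it restricts to
`U_σ ⟶ U_σ'`, whenever `φ σ ⊆ σ'`. -/
def toricMorphism (k : Type u) [Field k] {N : AddSubgroup V} {Sig : Set (PointedCone ℝ V)}
    {N' : AddSubgroup V'} {Sig' : Set (PointedCone ℝ V')} {φ : V →ₗ[ℝ] V'} (h : IsFan N Sig)
    (h' : IsFan N' Sig') (hφ : IsFanMap N Sig N' Sig' φ) :
    toricVariety k h ⟶ toricVariety k h' :=
  haveI := h.hasColimit k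
  colimit.desc (chartDiagram k N Sig)
    { pt := toricVariety k h'
      ι :=
        { app σ := affineMap k φ hφ.map_lattice (hφ.map_cone σ.1 σ.2).choose_spec.2 ≫
            chart k h' (hφ.map_cone σ.1 σ.2).choose_spec.1
          naturality σ τ f := by
            refine Eq.trans ?_ (Category.comp_id _).symm
            exact affineIncl_affineMap_chart k (leOfHom f) h' hφ.map_lattice _ _ _ _ } }

lemma chart_toricMorphism (k : Type u) [Field k] {N : AddSubgroup V}
    {Sig : Set (PointedCone ℝ V)} {N' : AddSubgroup V'} {Sig' : Set (PointedCone ℝ V')}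
    {φ : V →ₗ[ℝ] V'} (h : IsFan N Sig) (h' : IsFan N' Sig')
    (hφ : IsFanMap N Sig N' Sig' φ) {σ : PointedCone ℝ V} (hσ : σ ∈ Sig)
    {σ' : PointedCone ℝ V'} (hσ' : σ' ∈ Sig') (hle : ∀ x ∈ σ, φ x ∈ σ') :
    chart k h hσ ≫ toricMorphism k h h' hφ =
      affineMap k φ hφ.map_lattice hle ≫ chart k h' hσ' := by
  have := h.hasColimit k
  refine (colimit.ι_desc _ _).trans ?_
  exact affineMap_chart_eq k h' hφ.map_lattice _ _ _ _

end General

/-! ### The fans of a lattice polytope -/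

/-- `P ⊆ ℝ^d` is a full dimensional lattice polytope. -/
def IsFullLatticePolytope {d : ℕ} (P : Set (Fin d → ℝ)) : Prop :=
  (∃ A : Finset (Fin d → ℤ),
    P = convexHull ℝ ((fun a : Fin d → ℤ => fun j => (a j : ℝ)) '' (A : Set (Fin d → ℤ)))) ∧
  affineSpan ℝ P = ⊤

/-- The (inner) normal cone of `P` along `F`: the vectors `v` for which the linear form
`⟨v, ·⟩` attains its minimum over `P` at every point of `F`. -/
def normalCone {d : ℕ} (P F : Set (Fin d → ℝ)) : PointedCone ℝ (Fin d → ℝ) where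
  carrier := {v | ∀ x ∈ F, ∀ y ∈ P, v ⬝ᵥ x ≤ v ⬝ᵥ y}
  zero_mem' := fun x _ y _ => by simp
  add_mem' := fun {a b} ha hb x hx y hy => by
    simpa only [add_dotProduct] using add_le_add (ha x hx y hy) (hb x hx y hy)
  smul_mem' := fun c v hv x hx y hy => by
    have h := mul_le_mul_of_nonneg_left (hv x hx y hy) c.2
    have e : ∀ z : Fin d → ℝ, (c • v) ⬝ᵥ z = c.1 * (v ⬝ᵥ z) := fun z => smul_dotProduct c.1 v z
    rw [e, e]
    exact h

/-- The (inner) normal fan `Σ_P`: the normal cones of the non-empty faces of `P`. -/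
def normalFan {d : ℕ} (P : Set (Fin d → ℝ)) : Set (PointedCone ℝ (Fin d → ℝ)) :=
  {σ | ∃ F : Set (Fin d → ℝ), F.Nonempty ∧ IsExposed ℝ P F ∧ σ = normalCone P F}

/-- The product fan `Σ_P^m` in `(ℝ^d)^m`. -/
def productFan {d : ℕ} (P : Set (Fin d → ℝ)) (m : ℕ) :
    Set (PointedCone ℝ (Fin m → Fin d → ℝ)) :=
  {τ | ∃ σ : Fin m → PointedCone ℝ (Fin d → ℝ),
    (∀ i, σ i ∈ normalFan P) ∧ τ = Submodule.pi Set.univ σ}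

/-- The diagonal `ℝ^d ⊆ (ℝ^d)^m`. -/
def diagonal (d m : ℕ) : Submodule ℝ (Fin m → Fin d → ℝ) :=
  LinearMap.range (LinearMap.pi (fun _ : Fin m => (LinearMap.id : (Fin d → ℝ) →ₗ[ℝ] Fin d → ℝ)))

/-- The quotient space `(ℝ^d)^m / ℝ^d`. -/
abbrev QuotientSpace (d m : ℕ) : Type := (Fin m → Fin d → ℝ) ⧸ diagonal d m

/-- The quotient map `q : (ℝ^d)^m → (ℝ^d)^m / ℝ^d`. -/
def quotientMap (d m : ℕ) : (Fin m → Fin d → ℝ) →ₗ[ℝ] QuotientSpace d m :=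
  (diagonal d m).mkQ

/-- The lattice `(ℤ^d)^m` in `(ℝ^d)^m`. -/
def lattice (d m : ℕ) : AddSubgroup (Fin m → Fin d → ℝ) where
  carrier := {v | ∃ z : Fin m → Fin d → ℤ, v = fun i j => (z i j : ℝ)}
  zero_mem' := ⟨0, by ext; simp⟩
  add_mem' := by
    rintro _ _ ⟨a, rfl⟩ ⟨b, rfl⟩
    exact ⟨a + b, by ext; simp⟩
  neg_mem' := by
    rintro _ ⟨a, rfl⟩
    exact ⟨-a, by ext; simp⟩

/-- The lattice `(ℤ^d)^m / ℤ^d` in `(ℝ^d)^m / ℝ^d`. -/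
def quotientLattice (d m : ℕ) : AddSubgroup (QuotientSpace d m) :=
  (lattice d m).map (quotientMap d m).toAddMonoidHom

/-- The quotient fan `𝒬(P, m)`: the common refinement of the images under `q` of the cones of
`Σ_P^m`. Its cones are, for the points `x` of `(ℝ^d)^m / ℝ^d`, the intersections of all those
images `q(τ)`, `τ ∈ Σ_P^m`, that contain `x`. -/
def fanQ {d : ℕ} (P : Set (Fin d → ℝ)) (m : ℕ) : Set (PointedCone ℝ (QuotientSpace d m)) :=
  {ξ | ∃ x : QuotientSpace d m,
    ξ = sInf {κ | x ∈ κ ∧ ∃ τ ∈ productFan P m, κ = PointedCone.map (quotientMap d m) τ}}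

/-- The fan `ℛ(P, m) = {q⁻¹(ξ) ∩ τ | ξ ∈ 𝒬(P, m), τ ∈ Σ_P^m}` in `(ℝ^d)^m`. -/
def fanR {d : ℕ} (P : Set (Fin d → ℝ)) (m : ℕ) : Set (PointedCone ℝ (Fin m → Fin d → ℝ)) :=
  {η | ∃ ξ ∈ fanQ P m, ∃ τ ∈ productFan P m, η = PointedCone.comap (quotientMap d m) ξ ⊓ τ}

/-- The quotient map `q` is a map of fans from `ℛ(P, m)` to `𝒬(P, m)`. -/
lemma isFanMap_quotientMap {d : ℕ} (P : Set (Fin d → ℝ)) (m : ℕ) :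
    IsFanMap (lattice d m) (fanR P m) (quotientLattice d m) (fanQ P m) (quotientMap d m) where
  map_lattice x hx := ⟨x, hx, rfl⟩
  map_cone := by
    rintro _ ⟨ξ, hξ, τ, -, rfl⟩
    exact ⟨ξ, hξ, fun x hx => hx.1⟩

/-- The toric morphism `f : X_ℛ(P,m) ⟶ X_𝒬(P,m)` induced by `q`. -/
def toricFamily (k : Type u) [Field k] {d : ℕ} (P : Set (Fin d → ℝ)) (m : ℕ)
    (hR : IsFan (lattice d m) (fanR P m)) (hQ : IsFan (quotientLattice d m) (fanQ P m)) :
    toricVariety k hR ⟶ toricVariety k hQ :=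
  toricMorphism k hR hQ (isFanMap_quotientMap P m)

/-- The cells of the subdivision `𝒮(v)` of `ℝ^d`, the common refinement of the translated fans
`-v_1 + Σ_P, …, -v_m + Σ_P`: the intersections `⋂ i, (-v_i + σ_i)` with `σ_i ∈ Σ_P`. -/
def subdivision {d m : ℕ} (P : Set (Fin d → ℝ)) (v : Fin m → Fin d → ℝ) :
    Set (Set (Fin d → ℝ)) :=
  {C | ∃ σ : Fin m → PointedCone ℝ (Fin d → ℝ), (∀ i, σ i ∈ normalFan P) ∧
    C = ⋂ i, (fun x => -v i + x) '' (σ i : Set (Fin d → ℝ))}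

end Toric

end

noncomputable section

namespace Toric

/-! ### Rational polyhedral cones -/

/-! A fan is handled through the function `c` that sends a vector to the smallest cone containing it
(`IsCellSystem`). For $\Sigma_P^m$ these cones are the normal cells of the linear forms given by the
$m$-tuples of points of `A` (`normalCell_productForm`); for $\mathcal Q$ and $\mathcal R$ they are
`refinedCell` and `pulledCell`. That $\mathcal Q$ is a fan rests on linear programming duality along
$\ker q$ (`mem_refinedCell_add`). By construction every cone $\sigma$ of $\mathcal R$ maps onto a
cone $\sigma'$ of $\mathcal Q$ (`map_pulledCell`).

For such a map the toric morphism is flat with reduced fibers if and only if all maps $\sigma\cap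
N\to\sigma'\cap N'$ are surjective (`IsCellMap.flat_and_isReduced_fiber_iff`).

Suppose they are. Call a form in $S_\sigma$ reduced if over each point of $\sigma'$ it vanishes
somewhere on $\sigma$. Subtracting a maximal rational form pulled back from the target reduces a
given form, and the lifting of lattice points makes the subtracted form integral
(`exists_reduced_form`). Choosing one reduced form for each restriction to $\ker q$ gives a basis of
$k[S_\sigma]$ over $k[S_{\sigma'}]$, hence flatness. In a fiber, the product of two basis elements
is a scalar multiple of a third, squares of basis elements do not vanish, and restriction to $\ker
q$ is a grading by a torsion-free group; so the fiber is reduced (`isReduced_of_graded_basis`).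

Conversely, let the fiber over the distinguished point of $U_{\sigma'}$ be reduced. If a multiple of
$p\in S_\sigma$ is divisible by a non-unit of $S_{\sigma'}$, then $p$ is itself divisible by a
non-unit (`exists_eq_add_of_isReduced_tensorProduct`). Given a lattice point of $\sigma'$, take a
lift $a$ with minimal cell. A descent on the value $p(a)$, splitting off such divisors, shows that
all forms non-negative on that cell are integral at $a$, so $a$ is a lattice point
(`exists_lattice_lift`).

Finally, a cell of $\mathcal S(\mathbf v)$ is the slice of a cone of $\Sigma_P^m$ by the fiber of
$q$ through $\mathbf v$, so for integral $\mathbf v$ the lifting property is exactly the condition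
on the cells (`lattice_lift_iff_subdivision`). -/

lemma exists_pos_forall_finset {α : Type*} (t : Finset α) {P : α → ℝ → Prop}
    (h : ∀ i ∈ t, ∃ ε : ℝ, 0 < ε ∧ ∀ δ, 0 ≤ δ → δ ≤ ε → P i δ) :
    ∃ ε : ℝ, 0 < ε ∧ ∀ i ∈ t, P i ε := by
  choose! ε hε hP using h
  rcases t.eq_empty_or_nonempty with rfl | hne
  · exact ⟨1, one_pos, by simp⟩
  have hpos : 0 < t.inf' hne ε := (Finset.lt_inf'_iff hne).2 hε
  exact ⟨t.inf' hne ε, hpos, fun i hi => hP i hi _ hpos.le (Finset.inf'_le _ hi)⟩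

section Polyhedral

variable {V W : Type*} [AddCommGroup V] [Module ℝ V] [AddCommGroup W] [Module ℝ W]

/-- Fourier–Motzkin elimination: a finitely generated cone is an intersection of finitely many
half-spaces, with integrality kept track of by the subgroups `N` and `M`. -/
theorem exists_halfspaces_of_span (B : V →ₗ[ℝ] W →ₗ[ℝ] ℝ) (N : AddSubgroup V) (M : AddSubgroup W)
    (hNM : ∀ g ∈ N, ∀ w ∈ M, ∀ w' ∈ M, B g w • w' ∈ M) (t₀ : Finset W) (ht₀ : ∀ w ∈ t₀, w ∈ M)
    (hsep : ∀ x, (∀ w ∈ t₀, B x w = 0) → x = 0) (s : Finset V) (hs : ∀ g ∈ s, g ∈ N) :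
    ∃ t : Finset W, (∀ w ∈ t, w ∈ M) ∧
      ∀ x, x ∈ Submodule.span {c : ℝ // 0 ≤ c} (s : Set V) ↔ ∀ w ∈ t, 0 ≤ B x w := by
  classical
  induction s using Finset.induction_on with
  | empty =>
    refine ⟨t₀ ∪ t₀.image (fun w => -w), fun w hw => ?_, fun x => ?_⟩
    · rcases Finset.mem_union.1 hw with h | h
      · exact ht₀ w h
      · obtain ⟨w', hw', rfl⟩ := Finset.mem_image.1 h
        exact M.neg_mem (ht₀ w' hw')
    · simp only [Finset.coe_empty, Submodule.span_empty, Submodule.mem_bot]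
      refine ⟨by rintro rfl; simp, fun h => hsep x fun w hw => ?_⟩
      have h1 := h w (Finset.mem_union_left _ hw)
      have h2 := h (-w) (Finset.mem_union_right _ (Finset.mem_image_of_mem _ hw))
      rw [map_neg] at h2
      linarith
  | insert g s _ ih =>
    obtain ⟨t, htM, ht⟩ := ih fun y hy => hs y (Finset.mem_insert_of_mem hy)
    have hg : g ∈ N := hs g (Finset.mem_insert_self _ _)
    have hmem : ∀ x, x ∈ Submodule.span {c : ℝ // 0 ≤ c} ((insert g s : Finset V) : Set V) ↔
        ∃ c : ℝ, 0 ≤ c ∧ ∀ w ∈ t, c * B g w ≤ B x w := by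
      intro x
      rw [Finset.coe_insert, Submodule.mem_span_insert]
      constructor
      · rintro ⟨c, z, hz, rfl⟩
        refine ⟨c.1, c.2, fun w hw => ?_⟩
        have := (ht z).1 hz w hw
        have e : B (c • g + z) w = c.1 * B g w + B z w := by
          rw [map_add, LinearMap.add_apply]
          congr 1
          change B (c.1 • g) w = _
          rw [map_smul, LinearMap.smul_apply, smul_eq_mul]
        rw [e]
        linarith
      · rintro ⟨c, hc, h⟩
        refine ⟨⟨c, hc⟩, x - c • g, (ht _).2 fun w hw => ?_, ?_⟩
        · have := h w hw
          simp only [map_sub, map_smul, LinearMap.sub_apply, LinearMap.smul_apply, smul_eq_mul]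
          linarith
        · change x = c • g + _
          abel
    -- Eliminating `c` from the inequalities `c * B g w ≤ B x w`: those with `0 ≤ B g w` are kept,
    -- and each pair of opposite signs is combined so that `g` cancels.
    refine ⟨t.filter (fun w => 0 ≤ B g w) ∪
      ((t ×ˢ t).filter (fun p => 0 < B g p.1 ∧ B g p.2 < 0)).image
        (fun p => B g p.1 • p.2 - B g p.2 • p.1), fun w hw => ?_, fun x => ?_⟩
    · rcases Finset.mem_union.1 hw with h | h
      · exact htM w (Finset.mem_filter.1 h).1
      · obtain ⟨p, hp, rfl⟩ := Finset.mem_image.1 h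
        have hp' := Finset.mem_product.1 (Finset.mem_filter.1 hp).1
        exact M.sub_mem (hNM g hg _ (htM _ hp'.1) _ (htM _ hp'.2))
          (hNM g hg _ (htM _ hp'.2) _ (htM _ hp'.1))
    · rw [hmem]
      constructor
      · rintro ⟨c, hc, h⟩ w hw
        rcases Finset.mem_union.1 hw with h' | h'
        · obtain ⟨h1, h2⟩ := Finset.mem_filter.1 h'
          exact (mul_nonneg hc h2).trans (h w h1)
        · obtain ⟨p, hp, rfl⟩ := Finset.mem_image.1 h'
          obtain ⟨hp1, hp2, hp3⟩ := Finset.mem_filter.1 hp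
          obtain ⟨hp4, hp5⟩ := Finset.mem_product.1 hp1
          have h1 := h _ hp4
          have h2 := h _ hp5
          simp only [map_sub, map_smul, smul_eq_mul]
          nlinarith
      · intro h
        -- The forms that are negative on `g` bound `c` from below, as does `0 ≤ c`. The largest of
        -- these bounds works: the combined inequalities say that it respects every upper bound.
        set S : Finset ℝ := insert 0 ((t.filter (fun w => B g w < 0)).image
          (fun w => B x w / B g w)) with hS
        have hne : S.Nonempty := Finset.insert_nonempty _ _
        have hmax := S.max'_mem hne
        have hle : ∀ y ∈ S, y ≤ S.max' hne := fun y hy => S.le_max' y hy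
        set c := S.max' hne
        have hc0 : 0 ≤ c := hle 0 (Finset.mem_insert_self _ _)
        refine ⟨c, hc0, fun w hw => ?_⟩
        rcases lt_or_ge (B g w) 0 with hneg | hpos
        · have := hle (B x w / B g w) (Finset.mem_insert_of_mem
            (Finset.mem_image_of_mem _ (Finset.mem_filter.2 ⟨hw, hneg⟩)))
          rwa [div_le_iff_of_neg hneg] at this
        · have hxw : 0 ≤ B x w :=
            h w (Finset.mem_union_left _ (Finset.mem_filter.2 ⟨hw, hpos⟩))
          rcases hpos.eq_or_lt with h0 | h0
          · rw [← h0, mul_zero]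
            exact hxw
          rcases Finset.mem_insert.1 hmax with hc | hc
          · rw [hc, zero_mul]
            exact hxw
          · obtain ⟨w', hw', hcw'⟩ := Finset.mem_image.1 hc
            obtain ⟨hw'1, hw'2⟩ := Finset.mem_filter.1 hw'
            have := h _ (Finset.mem_union_right _ (Finset.mem_image_of_mem _ (a := (w, w'))
              (Finset.mem_filter.2 ⟨Finset.mem_product.2 ⟨hw, hw'1⟩, h0, hw'2⟩)))
            simp only [map_sub, map_smul, smul_eq_mul] at this
            rw [← hcw', div_mul_eq_mul_div, div_le_iff_of_neg hw'2]
            linarith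

end Polyhedral

section Rational

variable {V V' : Type} [AddCommGroup V] [Module ℝ V] [AddCommGroup V'] [Module ℝ V']

/-- The linear forms that are integral on `N`. -/
def dualLattice (N : AddSubgroup V) : AddSubgroup (Module.Dual ℝ V) where
  carrier := {w | ∀ x ∈ N, ∃ n : ℤ, w x = n}
  zero_mem' := fun _ _ => ⟨0, by simp⟩
  add_mem' := by
    intro a b ha hb x hx
    obtain ⟨p, hp⟩ := ha x hx
    obtain ⟨q, hq⟩ := hb x hx
    exact ⟨p + q, by simp [hp, hq]⟩
  neg_mem' := by
    intro a ha x hx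
    obtain ⟨p, hp⟩ := ha x hx
    exact ⟨-p, by simp [hp]⟩

/-- `N` is a lattice in `V`: it is finitely generated, spans `V`, and every additive map `N → ℤ`
extends to a linear form on `V`. -/
structure IsFullLattice (N : AddSubgroup V) : Prop where
  fg : N.FG
  span_eq : Submodule.span ℝ (N : Set V) = ⊤
  extend : ∀ φ : N →+ ℤ, ∃ w : Module.Dual ℝ V, ∀ x : N, w x = φ x

/-- `σ` is generated by finitely many lattice vectors. -/
def IsRational (N : AddSubgroup V) (σ : PointedCone ℝ V) : Prop :=
  ∃ s : Finset V, (∀ x ∈ s, x ∈ N) ∧ σ = Submodule.span {c : ℝ // 0 ≤ c} (s : Set V)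

lemma IsFullLattice.exists_finset {N : AddSubgroup V} (hN : IsFullLattice N) :
    ∃ s : Finset V, (∀ x ∈ s, x ∈ N) ∧ ∀ w : Module.Dual ℝ V, (∀ x ∈ s, w x = 0) → w = 0 := by
  obtain ⟨s, hs⟩ := hN.fg
  refine ⟨s, fun x hx => hs ▸ AddSubgroup.subset_closure hx, fun w hw => ?_⟩
  have h1 : ∀ x ∈ N, w x = 0 := by
    intro x hx
    rw [← hs] at hx
    induction hx using AddSubgroup.closure_induction with
    | mem x hx => exact hw x hx
    | zero => simp
    | add x y _ _ h h' => rw [map_add, h, h', add_zero]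
    | neg x _ h => rw [map_neg, h, neg_zero]
  have h2 : Submodule.span ℝ (N : Set V) ≤ LinearMap.ker w := Submodule.span_le.2 h1
  rw [hN.span_eq, top_le_iff, LinearMap.ker_eq_top] at h2
  exact h2

/-- A finitely generated torsion-free group has a ℤ-basis, and the extension property turns its
coordinate functions into integral forms on `V`. -/
lemma IsFullLattice.exists_basis {N : AddSubgroup V} (hN : IsFullLattice N) :
    ∃ (n : ℕ) (b : Fin n → V) (w : Fin n → Module.Dual ℝ V), (∀ i, b i ∈ N) ∧
      (∀ i, w i ∈ dualLattice N) ∧ ∀ x, x = ∑ i, w i x • b i := by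
  have : Module.Finite ℤ N := by
    rw [Module.Finite.iff_addGroup_fg]
    exact (AddGroup.fg_iff_addSubgroup_fg N).2 hN.fg
  have : Module.IsTorsionFree ℤ V := Module.IsTorsionFree.trans_faithfulSMul ℤ ℝ V
  have : Module.IsTorsionFree ℤ N :=
    Function.Injective.moduleIsTorsionFree (Subtype.val : N → V) Subtype.val_injective
      fun _ _ => rfl
  let b := Module.finBasis ℤ N
  choose w hw using fun i => hN.extend (b.coord i).toAddMonoidHom
  refine ⟨_, fun i => (b i : V), w, fun i => (b i).2, fun i x hx => ⟨_, hw i ⟨x, hx⟩⟩, fun x => ?_⟩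
  have hx : x ∈ Submodule.span ℝ (N : Set V) := by rw [hN.span_eq]; trivial
  induction hx using Submodule.span_induction with
  | mem x hx =>
    have h1 := congrArg (Subtype.val : N → V) (b.sum_repr ⟨x, hx⟩)
    have h2 : ∀ i, w i x = (b.repr ⟨x, hx⟩ i : ℝ) := fun i => hw i ⟨x, hx⟩
    simp only [h2]
    rw [AddSubgroup.val_finsetSum] at h1
    change _ = x at h1
    rw [eq_comm]
    refine Eq.trans ?_ h1
    exact Finset.sum_congr rfl fun i _ => Int.cast_smul_eq_zsmul ..
  | zero => simp
  | add x y _ _ hx hy =>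
    simp only [map_add, add_smul, Finset.sum_add_distrib]
    rw [← hx, ← hy]
  | smul c x _ hx =>
    simp only [map_smul, smul_eq_mul, mul_smul]
    rw [← Finset.smul_sum, ← hx]

lemma IsFullLattice.exists_finset_dual {N : AddSubgroup V} (hN : IsFullLattice N) :
    ∃ t : Finset (Module.Dual ℝ V), (∀ w ∈ t, w ∈ dualLattice N) ∧
      ∀ x, (∀ w ∈ t, w x = 0) → x = 0 := by
  classical
  obtain ⟨n, b, w, -, hw, h⟩ := hN.exists_basis
  refine ⟨Finset.univ.image w, by simpa using hw, fun x hx => ?_⟩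
  rw [h x]
  exact Finset.sum_eq_zero fun i _ => by
    rw [hx _ (Finset.mem_image_of_mem _ (Finset.mem_univ i)), zero_smul]

lemma IsFullLattice.mem_of_forall {N : AddSubgroup V} (hN : IsFullLattice N) {x : V}
    (hx : ∀ w ∈ dualLattice N, ∃ n : ℤ, w x = n) : x ∈ N := by
  obtain ⟨n, b, w, hb, hw, h⟩ := hN.exists_basis
  rw [h x]
  refine N.sum_mem fun i _ => ?_
  obtain ⟨z, hz⟩ := hx _ (hw i)
  rw [hz, Int.cast_smul_eq_zsmul]
  exact N.zsmul_mem (hb i) z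

lemma IsRational.exists_halfspaces {N : AddSubgroup V} (hN : IsFullLattice N)
    {σ : PointedCone ℝ V} (hσ : IsRational N σ) :
    ∃ t : Finset (Module.Dual ℝ V), (∀ w ∈ t, w ∈ dualLattice N) ∧
      ∀ x, x ∈ σ ↔ ∀ w ∈ t, 0 ≤ w x := by
  obtain ⟨s, hs, rfl⟩ := hσ
  obtain ⟨t₀, ht₀, hsep⟩ := hN.exists_finset_dual
  refine exists_halfspaces_of_span (Module.Dual.eval ℝ V) N (dualLattice N) ?_ t₀ ht₀ hsep s hs
  intro g hg w hw w' hw'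
  obtain ⟨n, hn⟩ := hw g hg
  rw [Module.Dual.eval_apply, hn, Int.cast_smul_eq_zsmul]
  exact AddSubgroup.zsmul_mem _ hw' n

/-- Fourier–Motzkin elimination in the dual space, applied to the cone spanned by `t`, yields
vectors `s`, which are the wanted generators. Indeed a form that is non-negative on `s` lies in the
cone of `t`, hence is non-negative on `σ`; so each half-space containing the cone of `s` contains
`σ`. -/
lemma isRational_of_halfspaces {N : AddSubgroup V} (hN : IsFullLattice N)
    {σ : PointedCone ℝ V} (t : Finset (Module.Dual ℝ V)) (ht : ∀ w ∈ t, w ∈ dualLattice N)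
    (h : ∀ x, x ∈ σ ↔ ∀ w ∈ t, 0 ≤ w x) : IsRational N σ := by
  obtain ⟨s₀, hs₀, hsep⟩ := hN.exists_finset
  obtain ⟨s, hs, hst⟩ := exists_halfspaces_of_span (LinearMap.id : Module.Dual ℝ V →ₗ[ℝ] _)
    (dualLattice N) N (fun w hw g hg g' hg' => by
      obtain ⟨n, hn⟩ := hw g hg
      rw [LinearMap.id_apply, hn, Int.cast_smul_eq_zsmul]
      exact N.zsmul_mem hg' n) s₀ hs₀ hsep t ht
  simp only [LinearMap.id_apply] at hst
  refine ⟨s, hs, ?_⟩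
  obtain ⟨t', -, hst'⟩ := IsRational.exists_halfspaces hN
    (σ := Submodule.span {c : ℝ // 0 ≤ c} (s : Set V)) ⟨s, hs, rfl⟩
  apply le_antisymm
  · intro x hx
    rw [h] at hx
    rw [hst']
    intro w hw
    have h1 : w ∈ Submodule.span {c : ℝ // 0 ≤ c} (t : Set (Module.Dual ℝ V)) :=
      (hst w).2 fun g hg => (hst' g).1 (Submodule.subset_span hg) w hw
    clear hw
    induction h1 using Submodule.span_induction with
    | mem w hw => exact hx w hw
    | zero => simp
    | add a b _ _ ha hb => exact add_nonneg ha hb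
    | smul c a _ ha => exact mul_nonneg c.2 ha
  · refine Submodule.span_le.2 fun g hg => ?_
    rw [SetLike.mem_coe, h]
    exact fun w hw => (hst w).1 (Submodule.subset_span hw) g hg

lemma IsRational.inf {N : AddSubgroup V} (hN : IsFullLattice N) {σ τ : PointedCone ℝ V}
    (hσ : IsRational N σ) (hτ : IsRational N τ) : IsRational N (σ ⊓ τ) := by
  classical
  obtain ⟨t, ht, h⟩ := hσ.exists_halfspaces hN
  obtain ⟨t', ht', h'⟩ := hτ.exists_halfspaces hN
  refine isRational_of_halfspaces hN (t ∪ t') (fun w hw => ?_) fun x => ?_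
  · exact (Finset.mem_union.1 hw).elim (ht w) (ht' w)
  · rw [Submodule.mem_inf, h, h']
    simp only [Finset.mem_union, or_imp, forall_and]

lemma IsRational.sInf {N : AddSubgroup V} (hN : IsFullLattice N) {S : Set (PointedCone ℝ V)}
    (hS : S.Finite) (h : ∀ σ ∈ S, IsRational N σ) : IsRational N (sInf S) := by
  induction S, hS using Set.Finite.induction_on with
  | empty =>
    refine isRational_of_halfspaces hN ∅ (by simp) (by simp)
  | insert _ _ ih =>
    rw [sInf_insert]
    exact (h _ (Set.mem_insert _ _)).inf hN (ih fun σ hσ => h σ (Set.mem_insert_of_mem _ hσ))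

lemma IsRational.map {N : AddSubgroup V} {N' : AddSubgroup V'} {q : V →ₗ[ℝ] V'}
    (hq : ∀ x ∈ N, q x ∈ N') {σ : PointedCone ℝ V} (hσ : IsRational N σ) :
    IsRational N' (PointedCone.map q σ) := by
  classical
  obtain ⟨s, hs, rfl⟩ := hσ
  refine ⟨s.image q, fun x hx => ?_, ?_⟩
  · obtain ⟨y, hy, rfl⟩ := Finset.mem_image.1 hx
    exact hq y (hs y hy)
  · rw [PointedCone.map, Submodule.map_span, Finset.coe_image]
    rfl

lemma IsRational.comap {N : AddSubgroup V} (hN : IsFullLattice N) {N' : AddSubgroup V'}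
    (hN' : IsFullLattice N') {q : V →ₗ[ℝ] V'} (hq : ∀ x ∈ N, q x ∈ N') {σ : PointedCone ℝ V'}
    (hσ : IsRational N' σ) : IsRational N (PointedCone.comap q σ) := by
  classical
  obtain ⟨t, ht, h⟩ := hσ.exists_halfspaces hN'
  refine isRational_of_halfspaces hN (t.image fun w => w.comp q) (fun w hw => ?_) fun x => ?_
  · obtain ⟨w', hw', rfl⟩ := Finset.mem_image.1 hw
    exact fun x hx => ht w' hw' _ (hq x hx)
  · simp [h]

/-! ### Extremal subcones and fans -/

/-- An element of a finitely generated cone all of whose generators lie in an extremal subcone. -/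
lemma mem_span_induction_extremal {s : Set V} {ρ : PointedCone ℝ V}
    (hρ : ∀ x ∈ Submodule.span {c : ℝ // 0 ≤ c} s, ∀ y ∈ Submodule.span {c : ℝ // 0 ≤ c} s,
      x + y ∈ ρ → x ∈ ρ) {x : V} (hx : x ∈ Submodule.span {c : ℝ // 0 ≤ c} s) (hxρ : x ∈ ρ) :
    x ∈ Submodule.span {c : ℝ // 0 ≤ c} (s ∩ ρ) := by
  induction hx using Submodule.span_induction with
  | mem x hx => exact Submodule.subset_span ⟨hx, hxρ⟩
  | zero => exact zero_mem _
  | add x y hx hy ihx ihy =>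
    exact add_mem (ihx (hρ x hx y hy hxρ)) (ihy (hρ y hy x hx (add_comm x y ▸ hxρ)))
  | smul c x hx ih =>
    rcases c.2.eq_or_lt with h0 | h0
    · have : c • x = 0 := by
        change c.1 • x = 0
        rw [← h0, zero_smul]
      rw [this]
      exact zero_mem _
    · refine Submodule.smul_mem _ c (ih ?_)
      exact (PointedCone.smul_mem_iff ρ h0).1 hxρ

/-- The sum `z` of the generators lying in `ρ` plays the role of a relative interior point of `ρ`,
and the sum of the defining inequalities that are tight at `z` is the supporting form. Where this
form vanishes at `x ∈ σ`, all these inequalities are tight at `x`, so `z - ε • x` is still in `σ`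
for small `ε`, and extremality applied to `z = ε • x + (z - ε • x)` gives `x ∈ ρ`. -/
lemma IsRational.isFace_of_extremal {N : AddSubgroup V} (hN : IsFullLattice N)
    {σ ρ : PointedCone ℝ V} (hσ : IsRational N σ) (hle : ρ ≤ σ)
    (hρ : ∀ x ∈ σ, ∀ y ∈ σ, x + y ∈ ρ → x ∈ ρ) : IsFace N ρ σ := by
  classical
  obtain ⟨t, ht, h⟩ := hσ.exists_halfspaces hN
  obtain ⟨s, hs, rfl⟩ := hσ
  set z := ∑ g ∈ s with g ∈ ρ, g with hz
  have hzρ : z ∈ ρ := Submodule.sum_mem _ fun g hg => (Finset.mem_filter.1 hg).2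
  refine ⟨∑ w ∈ t with w z = 0, w, ⟨?_, fun x hx => ?_⟩, fun x => ?_⟩
  · exact (dualLattice N).sum_mem fun w hw => ht w (Finset.mem_filter.1 hw).1
  · rw [LinearMap.sum_apply]
    exact Finset.sum_nonneg fun w hw => (h x).1 hx w (Finset.mem_filter.1 hw).1
  rw [LinearMap.sum_apply]
  constructor
  · intro hx
    refine ⟨hle hx, Finset.sum_eq_zero fun w hw => ?_⟩
    obtain ⟨hwt, hwz⟩ := Finset.mem_filter.1 hw
    have hxs := mem_span_induction_extremal hρ (hle hx) hx
    have hg0 : ∀ g ∈ s, g ∈ ρ → w g = 0 := by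
      intro g hg hgρ
      rw [hz, map_sum] at hwz
      exact (Finset.sum_eq_zero_iff_of_nonneg fun g hg =>
        (h g).1 (hle (Finset.mem_filter.1 hg).2) w hwt).1 hwz g (Finset.mem_filter.2 ⟨hg, hgρ⟩)
    clear hx
    induction hxs using Submodule.span_induction with
    | mem g hg => exact hg0 g hg.1 hg.2
    | zero => simp
    | add a b _ _ ha hb => rw [map_add, ha, hb, add_zero]
    | smul c a _ ha =>
      change w (c.1 • a) = 0
      rw [map_smul, ha, smul_zero]
  · rintro ⟨hx, hx0⟩
    have hx0' := (Finset.sum_eq_zero_iff_of_nonneg fun w hw =>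
      (h x).1 hx w (Finset.mem_filter.1 hw).1).1 hx0
    obtain ⟨ε, hε, hεt⟩ : ∃ ε : ℝ, 0 < ε ∧ ∀ w ∈ t, 0 ≤ w z - ε * w x := by
      refine exists_pos_forall_finset t fun w hw => ?_
      have hwz := (h z).1 (hle hzρ) w hw
      have hwx := (h x).1 hx w hw
      rcases hwz.eq_or_lt with h0 | h0
      · refine ⟨1, one_pos, fun δ _ _ => ?_⟩
        rw [hx0' w (Finset.mem_filter.2 ⟨hw, h0.symm⟩), ← h0]
        simp
      · refine ⟨w z / (w x + 1), by positivity, fun δ hδ hle => ?_⟩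
        rw [le_div_iff₀ (by positivity)] at hle
        nlinarith
    have h1 : z - ε • x ∈ Submodule.span {c : ℝ // 0 ≤ c} (s : Set V) :=
      (h _).2 fun w hw => by simpa using hεt w hw
    have h2 : ε • x ∈ Submodule.span {c : ℝ // 0 ≤ c} (s : Set V) := PointedCone.smul_mem _ hε.le hx
    have h3 := hρ _ h2 _ h1 (by rw [add_sub_cancel]; exact hzρ)
    exact (PointedCone.smul_mem_iff ρ hε).1 h3

/-- A system of cones `c v`, each the smallest one containing `v` in its relative interior. -/
structure IsCellSystem (c : V → PointedCone ℝ V) : Prop where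
  self_mem : ∀ v, v ∈ c v
  le_of_mem : ∀ {v w}, w ∈ c v → c w ≤ c v
  interior : ∀ {v w}, w ∈ c v → ∃ ε : ℝ, 0 < ε ∧ v - ε • w ∈ c v
  mem_cell_add : ∀ {v x y}, x ∈ c v → y ∈ c v → x ∈ c (x + y)

lemma IsCellSystem.extremal {c : V → PointedCone ℝ V} (hc : IsCellSystem c) {v w x y : V}
    (hx : x ∈ c v) (hy : y ∈ c v) (h : x + y ∈ c w) : x ∈ c w :=
  hc.le_of_mem h (hc.mem_cell_add hx hy)

lemma IsCellSystem.isFace_of_mem {c : V → PointedCone ℝ V} (hc : IsCellSystem c)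
    {N : AddSubgroup V} (hN : IsFullLattice N) {v w : V} (hv : IsRational N (c v))
    (hw : w ∈ c v) : IsFace N (c w) (c v) :=
  hv.isFace_of_extremal hN (hc.le_of_mem hw) fun _ hx _ hy h => hc.extremal hx hy h

/-- A rational cone in which the cells behave like those of its faces is itself a cell. -/
lemma IsRational.exists_cell_eq {c : V → PointedCone ℝ V} {σ : PointedCone ℝ V}
    {N : AddSubgroup V} (hσ : IsRational N σ) (hadd : ∀ x ∈ σ, ∀ y ∈ σ, x ∈ c (x + y))
    (hext : ∀ z ∈ σ, c z ≤ σ) : ∃ z ∈ σ, c z = σ := by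
  classical
  obtain ⟨s, hs, rfl⟩ := hσ
  have hsum : ∑ g ∈ s, g ∈ Submodule.span {c : ℝ // 0 ≤ c} (s : Set V) :=
    Submodule.sum_mem _ fun g hg => Submodule.subset_span hg
  refine ⟨∑ g ∈ s, g, hsum, le_antisymm (hext _ hsum) (Submodule.span_le.2 fun g hg => ?_)⟩
  rw [← Finset.add_sum_erase s _ hg]
  exact hadd _ (Submodule.subset_span hg) _ (Submodule.sum_mem _ fun g' hg' =>
    Submodule.subset_span (Finset.mem_of_mem_erase hg'))

/-- As `z` is interior to its own cell, `z - ε • x` also lies in `c v`, so both `w x` and `-ε * w x`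
are non-negative. -/
lemma IsCellSystem.le_of_face {c : V → PointedCone ℝ V} (hc : IsCellSystem c)
    {v z : V} {w : Module.Dual ℝ V} (hw : ∀ x ∈ c v, 0 ≤ w x) (hz : z ∈ c v) (hz0 : w z = 0)
    {x : V} (hx : x ∈ c z) : w x = 0 := by
  obtain ⟨ε, hε, h⟩ := hc.interior hx
  have h1 := hw _ (hc.le_of_mem hz h)
  have h2 := hw _ (hc.le_of_mem hz hx)
  rw [map_sub, map_smul, hz0, smul_eq_mul] at h1
  nlinarith

lemma IsRational.of_isFace {N : AddSubgroup V} (hN : IsFullLattice N) {σ τ : PointedCone ℝ V}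
    (hσ : IsRational N σ) (h : IsFace N τ σ) : IsRational N τ := by
  classical
  obtain ⟨w, hw, hτ⟩ := h
  obtain ⟨t, ht, h⟩ := hσ.exists_halfspaces hN
  refine isRational_of_halfspaces hN (insert (-w) t) (fun w' hw' => ?_) fun x => ?_
  · rcases Finset.mem_insert.1 hw' with rfl | h'
    · exact (dualLattice N).neg_mem hw.1
    · exact ht w' h'
  · rw [hτ, Finset.forall_mem_insert, ← h]
    constructor
    · rintro ⟨h1, h2⟩
      exact ⟨by simp [h2], h1⟩
    · rintro ⟨h1, h2⟩
      have := hw.2 x h2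
      rw [LinearMap.neg_apply] at h1
      exact ⟨h2, by linarith⟩

lemma IsCellSystem.exists_of_isFace {c : V → PointedCone ℝ V} (hc : IsCellSystem c)
    {N : AddSubgroup V} (hN : IsFullLattice N) {v : V} (hv : IsRational N (c v))
    {τ : PointedCone ℝ V} (h : IsFace N τ (c v)) : ∃ z ∈ τ, c z = τ := by
  have hτ := hv.of_isFace hN h
  obtain ⟨w, hw, hτw⟩ := h
  refine hτ.exists_cell_eq (fun x hx y hy => hc.mem_cell_add ((hτw x).1 hx).1 ((hτw y).1 hy).1)
    fun z hz x hx => ?_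
  obtain ⟨hz1, hz2⟩ := (hτw z).1 hz
  exact (hτw x).2 ⟨hc.le_of_mem hz1 hx, hc.le_of_face hw.2 hz1 hz2 hx⟩

/-- The additivity axiom makes each cell extremal inside any other, so intersections of cells are
faces; and a face of a cell is the cell of the sum of its generators. -/
theorem IsCellSystem.isFan {c : V → PointedCone ℝ V} (hc : IsCellSystem c)
    {N : AddSubgroup V} (hN : IsFullLattice N) (hfin : (Set.range c).Finite)
    (hrat : ∀ v, IsRational N (c v)) (hsc : ∀ v, ∀ x ∈ c v, -x ∈ c v → x = 0) :
    IsFan N (Set.range c) where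
  finite := hfin
  rational := by
    rintro _ ⟨v, rfl⟩
    exact hrat v
  stronglyConvex := by
    rintro _ ⟨v, rfl⟩
    exact hsc v
  face_mem := by
    rintro _ ⟨v, rfl⟩ τ hτ
    obtain ⟨z, -, hz⟩ := hc.exists_of_isFace hN (hrat v) hτ
    exact ⟨z, hz⟩
  inter_face := by
    have key : ∀ v w, IsFace N (c v ⊓ c w) (c v) := fun v w =>
      (hrat v).isFace_of_extremal hN inf_le_left fun x hx y hy h =>
        ⟨hx, hc.extremal hx hy h.2⟩
    rintro _ ⟨v, rfl⟩ _ ⟨w, rfl⟩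
    refine ⟨key v w, ?_⟩
    rw [inf_comm]
    exact key w v

end Rational

section Cells

variable {V V' : Type} [AddCommGroup V] [Module ℝ V] [AddCommGroup V'] [Module ℝ V']

lemma IsCellSystem.interior_le {c : V → PointedCone ℝ V} (hc : IsCellSystem c) {v w : V}
    (hw : w ∈ c v) : ∃ ε : ℝ, 0 < ε ∧ ∀ δ, 0 ≤ δ → δ ≤ ε → v - δ • w ∈ c v := by
  obtain ⟨ε, hε, h⟩ := hc.interior hw
  refine ⟨ε, hε, fun δ hδ hle => ?_⟩
  have e : v - δ • w = (1 - δ / ε) • v + (δ / ε) • (v - ε • w) := by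
    have : δ / ε * ε = δ := by field_simp
    rw [smul_sub, smul_smul, this, sub_smul, one_smul]
    abel
  rw [e]
  exact add_mem (PointedCone.smul_mem _ (sub_nonneg.2 ((div_le_one hε).2 hle)) (hc.self_mem v))
    (PointedCone.smul_mem _ (by positivity) h)

/-! ### Quotients of cell systems -/

/-- The intersection of all the images under `q` of the cones in `Sig` that contain `x`. -/
def refinedCell (q : V →ₗ[ℝ] V') (Sig : Set (PointedCone ℝ V)) (x : V') : PointedCone ℝ V' :=
  sInf {κ | x ∈ κ ∧ ∃ τ ∈ Sig, κ = PointedCone.map q τ}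

lemma mem_refinedCell {q : V →ₗ[ℝ] V'} {c : V → PointedCone ℝ V} {x y : V'} :
    y ∈ refinedCell q (Set.range c) x ↔
      ∀ v, (∃ a ∈ c v, q a = x) → ∃ b ∈ c v, q b = y := by
  rw [refinedCell, Submodule.mem_sInf]
  constructor
  · intro h v hv
    exact h _ ⟨hv, c v, ⟨v, rfl⟩, rfl⟩
  · rintro h _ ⟨hx, _, ⟨v, rfl⟩, rfl⟩
    exact h v hx

lemma finite_range_refinedCell (q : V →ₗ[ℝ] V') {Sig : Set (PointedCone ℝ V)}
    (h : Sig.Finite) : (Set.range (refinedCell q Sig)).Finite := by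
  have h1 : (PointedCone.map q '' Sig).Finite := h.image _
  refine (h1.finite_subsets.image sInf).subset ?_
  rintro _ ⟨x, rfl⟩
  refine ⟨_, ?_, rfl⟩
  rintro _ ⟨-, τ, hτ, rfl⟩
  exact ⟨τ, hτ, rfl⟩

lemma isRational_refinedCell {q : V →ₗ[ℝ] V'} {N : AddSubgroup V} {N' : AddSubgroup V'}
    (hN' : IsFullLattice N') (hq : ∀ x ∈ N, q x ∈ N') {Sig : Set (PointedCone ℝ V)}
    (h : Sig.Finite) (hrat : ∀ σ ∈ Sig, IsRational N σ) (x : V') :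
    IsRational N' (refinedCell q Sig x) := by
  refine IsRational.sInf hN' ((h.image (PointedCone.map q)).subset ?_) ?_
  · rintro _ ⟨-, τ, hτ, rfl⟩
    exact ⟨τ, hτ, rfl⟩
  · rintro _ ⟨-, τ, hτ, rfl⟩
    exact (hrat τ hτ).map hq

/-- For a cell system, the refinement of the images is again a cell system as soon as it satisfies
the additivity axiom. -/
lemma IsCellSystem.refinedCell {c : V → PointedCone ℝ V} (hc : IsCellSystem c)
    (hfin : (Set.range c).Finite) {q : V →ₗ[ℝ] V'}
    (hadd : ∀ x y z, y ∈ refinedCell q (Set.range c) x → z ∈ refinedCell q (Set.range c) x →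
      y ∈ Toric.refinedCell q (Set.range c) (y + z)) :
    IsCellSystem (Toric.refinedCell q (Set.range c)) where
  self_mem x := mem_refinedCell.2 fun _ h => h
  le_of_mem {x y} hy z hz := by
    rw [mem_refinedCell] at hy hz ⊢
    exact fun v hv => hz v (hy v hv)
  interior {x y} hy := by
    obtain ⟨ε, hε, h⟩ := exists_pos_forall_finset hfin.toFinset
      (P := fun τ δ => (∃ a ∈ τ, q a = x) → ∃ b ∈ τ, q b = x - δ • y) (by
        intro τ hτ
        obtain ⟨v, rfl⟩ := hfin.mem_toFinset.1 hτ
        by_cases hx : ∃ a ∈ c v, q a = x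
        · obtain ⟨a, ha, rfl⟩ := hx
          obtain ⟨b, hb, rfl⟩ := mem_refinedCell.1 hy a ⟨a, hc.self_mem a, rfl⟩
          obtain ⟨ε, hε, h⟩ := hc.interior_le hb
          exact ⟨ε, hε, fun δ h0 h1 _ => ⟨a - δ • b, hc.le_of_mem ha (h δ h0 h1), by simp⟩⟩
        · exact ⟨1, one_pos, fun δ _ _ h => absurd h hx⟩)
    refine ⟨ε, hε, mem_refinedCell.2 fun v hv => ?_⟩
    exact h (c v) (hfin.mem_toFinset.2 ⟨v, rfl⟩) hv
  mem_cell_add {x y z} := hadd x y z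

/-- Among the lifts of `x` in a set there is one whose cell is minimal. -/
lemma exists_minimal_lift {c : V → PointedCone ℝ V} (hfin : (Set.range c).Finite) {S : Set V}
    (hS : S.Nonempty) : ∃ a ∈ S, ∀ b ∈ S, c b ≤ c a → c a ≤ c b := by
  obtain ⟨τ, hτ⟩ := (hfin.subset (Set.image_subset_range c S)).exists_minimal (hS.image c)
  obtain ⟨a, ha, rfl⟩ := hτ.prop
  exact ⟨a, ha, fun b hb hle => hτ.le_of_le ⟨b, hb, rfl⟩ hle⟩

/-- Lift `x` to a point `a` whose cell is minimal. Then `y` and `-y` lift to `b, b' ∈ c a`, whose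
sum `k` is in the kernel of `q`. If `k ≠ 0`, moving `a` along `-k` stays in the fiber of `x` and
eventually reaches a proper face of `c a`, against minimality. If `k = 0`, strong convexity of `c a`
gives `b = 0`. -/
lemma IsCellSystem.stronglyConvex_refinedCell {c : V → PointedCone ℝ V} (hc : IsCellSystem c)
    (hfin : (Set.range c).Finite) {N : AddSubgroup V} (hN : IsFullLattice N)
    (hrat : ∀ v, IsRational N (c v)) (hsc : ∀ v, ∀ x ∈ c v, -x ∈ c v → x = 0)
    {q : V →ₗ[ℝ] V'} (hq : Function.Surjective q) (x y : V')
    (hy : y ∈ Toric.refinedCell q (Set.range c) x)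
    (hy' : -y ∈ Toric.refinedCell q (Set.range c) x) : y = 0 := by
  classical
  obtain ⟨a, ha : q a = x, hmin⟩ := exists_minimal_lift hfin (S := {a | q a = x}) (hq x)
  obtain ⟨b, hb, rfl⟩ := mem_refinedCell.1 hy a ⟨a, hc.self_mem a, ha⟩
  obtain ⟨b', hb', hbb⟩ := mem_refinedCell.1 hy' a ⟨a, hc.self_mem a, ha⟩
  have hk : b + b' ∈ c a := add_mem hb hb'
  have hqk : q (b + b') = 0 := by rw [map_add, hbb, add_neg_cancel]
  suffices h : b + b' = 0 by
    rw [hsc a b hb (by rwa [← eq_neg_of_add_eq_zero_right h]), map_zero]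
  by_contra hne
  obtain ⟨t, -, ht⟩ := (hrat a).exists_halfspaces hN
  set k := b + b'
  have hpos : (t.filter fun w => 0 < w k).Nonempty := by
    by_contra hemp
    rw [Finset.not_nonempty_iff_eq_empty, Finset.filter_eq_empty_iff] at hemp
    refine hne (hsc a k hk ((ht _).2 fun w hw => ?_))
    have := hemp hw
    rw [map_neg]
    linarith
  -- `w` is the first inequality to become tight along `-k`, and `w a / w k` is the time at which
  -- this happens.
  obtain ⟨w, hw, hmin'⟩ := Finset.exists_min_image _ (fun w => w a / w k) hpos
  obtain ⟨hwt, hwk⟩ := Finset.mem_filter.1 hw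
  have ha' : a - (w a / w k) • k ∈ c a := by
    refine (ht _).2 fun w' hw' => ?_
    rw [map_sub, map_smul, smul_eq_mul, sub_nonneg]
    have h0 := (ht a).1 (hc.self_mem a) w hwt
    have h1 := (ht a).1 (hc.self_mem a) w' hw'
    have h2 := (ht k).1 hk w' hw'
    rcases h2.eq_or_lt with h3 | h3
    · rw [← h3, mul_zero]
      exact h1
    · have := hmin' w' (Finset.mem_filter.2 ⟨hw', h3⟩)
      rwa [le_div_iff₀ h3] at this
  have h1 := hmin (a - (w a / w k) • k) (by simp [hqk, ha]) (hc.le_of_mem ha')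
  have h2 := hc.le_of_face (fun x hx => (ht x).1 hx w hwt) ha' (by
    rw [map_sub, map_smul, smul_eq_mul, div_mul_cancel₀ _ hwk.ne', sub_self]) (h1 hk)
  exact hwk.ne' h2

/-- The cells of the common refinement of `c` and the preimages of the cells `c'`. -/
def pulledCell (q : V →ₗ[ℝ] V') (c : V → PointedCone ℝ V) (c' : V' → PointedCone ℝ V') (v : V) :
    PointedCone ℝ V :=
  PointedCone.comap q (c' (q v)) ⊓ c v

lemma IsCellSystem.pulledCell {c : V → PointedCone ℝ V} (hc : IsCellSystem c)
    {c' : V' → PointedCone ℝ V'} (hc' : IsCellSystem c') (q : V →ₗ[ℝ] V') :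
    IsCellSystem (pulledCell q c c') where
  self_mem v := ⟨hc'.self_mem _, hc.self_mem v⟩
  le_of_mem {v w} hw x hx := ⟨hc'.le_of_mem (v := q v) (w := q w) hw.1 hx.1, hc.le_of_mem hw.2 hx.2⟩
  interior {v w} hw := by
    obtain ⟨ε, hε, h⟩ := hc.interior_le hw.2
    obtain ⟨ε', hε', h'⟩ := hc'.interior_le (v := q v) (w := q w) hw.1
    refine ⟨min ε ε', lt_min hε hε', ?_, h _ (lt_min hε hε').le (min_le_left _ _)⟩
    change q (v - _) ∈ c' (q v)
    rw [map_sub, map_smul]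
    exact h' _ (lt_min hε hε').le (min_le_right _ _)
  mem_cell_add {v x y} hx hy := by
    refine ⟨?_, hc.mem_cell_add hx.2 hy.2⟩
    change q _ ∈ c' (q _)
    rw [map_add]
    exact hc'.mem_cell_add (v := q v) hx.1 hy.1

lemma finite_range_pulledCell (q : V →ₗ[ℝ] V') {c : V → PointedCone ℝ V}
    {c' : V' → PointedCone ℝ V'} (h : (Set.range c).Finite) (h' : (Set.range c').Finite) :
    (Set.range (pulledCell q c c')).Finite := by
  refine (Set.Finite.image2 (fun ξ τ => PointedCone.comap q ξ ⊓ τ) h' h).subset ?_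
  rintro _ ⟨v, rfl⟩
  exact ⟨_, ⟨q v, rfl⟩, _, ⟨v, rfl⟩, rfl⟩

/-- Every intersection of a cell with the preimage of a cell is a cell of the refinement. -/
lemma range_pulledCell {c : V → PointedCone ℝ V} (hc : IsCellSystem c)
    {c' : V' → PointedCone ℝ V'} (hc' : IsCellSystem c') {q : V →ₗ[ℝ] V'} {N : AddSubgroup V}
    (hN : IsFullLattice N) {N' : AddSubgroup V'} (hN' : IsFullLattice N')
    (hq : ∀ x ∈ N, q x ∈ N') (hrat : ∀ v, IsRational N (c v)) (hrat' : ∀ v, IsRational N' (c' v)) :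
    Set.range (pulledCell q c c') =
      {η | ∃ ξ ∈ Set.range c', ∃ τ ∈ Set.range c, η = PointedCone.comap q ξ ⊓ τ} := by
  have hp := hc.pulledCell hc' q
  ext η
  constructor
  · rintro ⟨v, rfl⟩
    exact ⟨_, ⟨q v, rfl⟩, _, ⟨v, rfl⟩, rfl⟩
  · rintro ⟨_, ⟨x, rfl⟩, _, ⟨v, rfl⟩, rfl⟩
    have h1 : IsRational N (PointedCone.comap q (c' x) ⊓ c v) :=
      ((hrat' x).comap hN hN' hq).inf hN (hrat v)
    suffices h : ∃ z ∈ PointedCone.comap q (c' x) ⊓ c v,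
        pulledCell q c c' z = PointedCone.comap q (c' x) ⊓ c v from ⟨_, h.choose_spec.2⟩
    refine h1.exists_cell_eq (fun a ha b hb => ?_) fun z hz y hy => ?_
    · refine ⟨?_, hc.mem_cell_add ha.2 hb.2⟩
      change q a ∈ c' (q (a + b))
      rw [map_add]
      exact hc'.mem_cell_add (v := x) ha.1 hb.1
    · exact ⟨hc'.le_of_mem (v := x) (w := q z) hz.1 hy.1, hc.le_of_mem hz.2 hy.2⟩

/-- After the refinement, cones map onto cones and not merely into them. A point of the refined cell
of `q v` lies in the image of every cone whose image contains `q v`, in particular of `c v`. -/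
lemma map_pulledCell {c : V → PointedCone ℝ V} (hc : IsCellSystem c) (q : V →ₗ[ℝ] V') (v : V) :
    PointedCone.map q (pulledCell q c (refinedCell q (Set.range c)) v) =
      refinedCell q (Set.range c) (q v) := by
  ext y
  constructor
  · rintro ⟨x, hx, rfl⟩
    exact hx.1
  · intro hy
    obtain ⟨b, hb, rfl⟩ := mem_refinedCell.1 hy v ⟨v, hc.self_mem v, rfl⟩
    exact ⟨b, ⟨hy, hb⟩, rfl⟩

/-! ### Normal cells of a finite family of linear forms -/

/-- The vectors `x` such that all the forms `a i` that are minimal at `v` are minimal at `x`. -/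
def normalCell {ι : Type*} (a : ι → Module.Dual ℝ V) (v : V) : PointedCone ℝ V where
  carrier := {x | ∀ i, (∀ j, a i v ≤ a j v) → ∀ j, a i x ≤ a j x}
  zero_mem' := fun i _ j => by simp
  add_mem' := fun {x y} hx hy i hi j => by
    simpa only [map_add] using add_le_add (hx i hi j) (hy i hi j)
  smul_mem' := fun c x hx i hi j => by
    have e : ∀ i, a i (c • x) = c.1 * a i x := fun i => map_smul (a i) c.1 x
    rw [e, e]
    exact mul_le_mul_of_nonneg_left (hx i hi j) c.2

lemma mem_normalCell {ι : Type*} (a : ι → Module.Dual ℝ V) {v x : V} :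
    x ∈ normalCell a v ↔ ∀ i, (∀ j, a i v ≤ a j v) → ∀ j, a i x ≤ a j x := Iff.rfl

variable {ι : Type} [Fintype ι] (a : ι → Module.Dual ℝ V)

lemma isCellSystem_normalCell [Nonempty ι] : IsCellSystem (normalCell a) where
  self_mem v := fun i hi => hi
  le_of_mem {v w} hw x hx := fun i hi => hx i (hw i hi)
  interior {v w} hw := by
    obtain ⟨i₀, hi₀⟩ := Finite.exists_min fun i => a i v
    obtain ⟨ε, hε, h⟩ := exists_pos_forall_finset (Finset.univ : Finset ι)
      (P := fun j δ => a i₀ v - δ * a i₀ w ≤ a j v - δ * a j w) (by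
        intro j _
        rcases (hi₀ j).eq_or_lt with h0 | h0
        · refine ⟨1, one_pos, fun δ _ _ => ?_⟩
          have h1 := hw j (fun j' => h0 ▸ hi₀ j') i₀
          have h2 := hw i₀ hi₀ j
          rw [h0, le_antisymm h1 h2]
        · have h2 := hw i₀ hi₀ j
          -- A form that is not minimal at `v` stays above the minimum for small steps. The `+ 1`
          -- keeps the denominator positive when `a j w = a i₀ w`.
          refine ⟨(a j v - a i₀ v) / (a j w - a i₀ w + 1), ?_, fun δ hδ hle => ?_⟩
          · apply div_pos <;> linarith
          · rw [le_div_iff₀ (by linarith)] at hle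
            nlinarith)
    refine ⟨ε, hε, fun i hi j => ?_⟩
    have h1 := h j (Finset.mem_univ j)
    have h2 : a i v = a i₀ v := le_antisymm (hi i₀) (hi₀ i)
    have h3 : a i w = a i₀ w := le_antisymm (hw i hi i₀) (hw i₀ hi₀ i)
    simp only [map_sub, map_smul, smul_eq_mul]
    rw [h2, h3]
    exact h1
  mem_cell_add {v x y} hx hy := by
    obtain ⟨i₀, hi₀⟩ := Finite.exists_min fun i => a i v
    intro i hi j
    have h1 := hx i₀ hi₀ j
    have h2 := hy i₀ hi₀ i
    have h3 := hi i₀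
    rw [map_add, map_add] at h3
    linarith

/-- A cell is determined by the set of forms that are minimal at its point. The infimum over all
cells with minimizing set `S` expresses it as a function of `S`, without choosing a representative.
-/
lemma finite_range_normalCell : (Set.range (normalCell a)).Finite := by
  classical
  refine (Set.finite_range fun S : Finset ι =>
    sInf {σ | ∃ v, (Finset.univ.filter fun i => ∀ j, a i v ≤ a j v) = S ∧
      σ = normalCell a v}).subset ?_
  rintro _ ⟨v, rfl⟩
  refine ⟨Finset.univ.filter fun i => ∀ j, a i v ≤ a j v, le_antisymm ?_ ?_⟩
  · exact sInf_le ⟨v, rfl, rfl⟩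
  · refine le_sInf ?_
    rintro _ ⟨w, hw, rfl⟩ x hx i hi
    refine hx i ?_
    have : i ∈ Finset.univ.filter fun i => ∀ j, a i w ≤ a j w := by simpa using hi
    rw [hw] at this
    simpa using this

lemma isRational_normalCell {N : AddSubgroup V} (hN : IsFullLattice N)
    (ha : ∀ i, a i ∈ dualLattice N) (v : V) : IsRational N (normalCell a v) := by
  classical
  refine isRational_of_halfspaces hN
    ((Finset.univ.filter fun p : ι × ι => ∀ j, a p.1 v ≤ a j v).image fun p => a p.2 - a p.1)
    (fun w hw => ?_) fun x => ?_
  · obtain ⟨p, -, rfl⟩ := Finset.mem_image.1 hw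
    exact (dualLattice N).sub_mem (ha _) (ha _)
  · simp only [mem_normalCell, Finset.forall_mem_image, Finset.mem_filter, Finset.mem_univ,
      true_and, LinearMap.sub_apply, sub_nonneg]
    exact ⟨fun h p hp => h _ hp _, fun h i hi j => h (x := (i, j)) hi⟩

lemma stronglyConvex_normalCell [Nonempty ι] (ha : ∀ x, (∀ i j, a i x = a j x) → x = 0) (v x : V)
    (hx : x ∈ normalCell a v) (hx' : -x ∈ normalCell a v) : x = 0 := by
  obtain ⟨i₀, hi₀⟩ := Finite.exists_min fun i => a i v
  have h : ∀ j, a j x = a i₀ x := by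
    intro j
    have h1 := hx i₀ hi₀ j
    have h2 := hx' i₀ hi₀ j
    rw [map_neg, map_neg] at h2
    linarith
  exact ha x fun i j => (h i).trans (h j).symm

/-- Linear programming duality along a subspace: the restriction to `K` of a convex combination of
the `a i` is also a convex combination of those `a i` that are minimal at some point of
`x + K`. -/
lemma exists_minimal_translate [Nonempty ι] (K : Submodule ℝ V) [FiniteDimensional ℝ K]
    (x : V) (l : ι → ℝ)
    (hl : ∀ i, 0 ≤ l i) (hl1 : ∑ i, l i = 1) :
    ∃ k ∈ K, ∃ μ : ι → ℝ, (∀ i, 0 ≤ μ i) ∧ ∑ i, μ i = 1 ∧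
      (∀ y ∈ K, ∑ i, μ i * a i y = ∑ i, l i * a i y) ∧
      ∀ i, μ i ≠ 0 → ∀ j, a i (x + k) ≤ a j (x + k) := by
  classical
  let B : (Module.Dual ℝ K × ℝ × ℝ) →ₗ[ℝ] (K × ℝ × ℝ) →ₗ[ℝ] ℝ := LinearMap.mk₂ ℝ
    (fun u w => u.1 w.1 + u.2.1 * w.2.1 + u.2.2 * w.2.2)
    (fun _ _ _ => by simp; ring) (fun _ _ _ => by simp; ring)
    (fun _ _ _ => by simp; ring) (fun _ _ _ => by simp; ring)
  have hB : ∀ u w, B u w = u.1 w.1 + u.2.1 * w.2.1 + u.2.2 * w.2.2 := fun _ _ => rfl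
  -- A point `(p, 1, r)` of the cone spanned by the `u i` records a convex combination of the forms:
  -- its restriction `p` to `K`, its total weight, and its value `r` at `x`. Minimizing `r` for
  -- fixed `p` is the linear program.
  let u : ι → (Module.Dual ℝ K × ℝ × ℝ) := fun i => ((a i).comp K.subtype, 1, a i x)
  let b := Module.finBasis ℝ K
  obtain ⟨t, -, ht⟩ := exists_halfspaces_of_span B ⊤ ⊤ (fun _ _ _ _ _ _ => trivial)
    (insert (0, 1, 0) (insert (0, 0, 1) (Finset.univ.image fun i => (b i, 0, 0))))
    (fun _ _ => trivial) (by
      rintro ⟨φ, s, r⟩ h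
      have h1 := h (0, 1, 0) (by simp)
      have h2 := h (0, 0, 1) (by simp)
      have h3 : ∀ i, φ (b i) = 0 := fun i => by
        have := h (b i, 0, 0) (by simp)
        simpa [hB] using this
      rw [hB] at h1 h2
      simp only [map_zero, mul_one, mul_zero, zero_add, add_zero] at h1 h2
      rw [b.ext (f₁ := φ) (f₂ := 0) h3, h1, h2]
      rfl) (Finset.univ.image u) (fun _ _ => trivial)
  have hspan : ∀ y, y ∈ Submodule.span {c : ℝ // 0 ≤ c}
      ((Finset.univ.image u : Finset (Module.Dual ℝ K × ℝ × ℝ)) :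
        Set (Module.Dual ℝ K × ℝ × ℝ)) ↔
      ∃ μ : ι → ℝ, (∀ i, 0 ≤ μ i) ∧ ∑ i, μ i • u i = y := by
    intro y
    rw [Finset.coe_image, Finset.coe_univ, Set.image_univ, Submodule.mem_span_range_iff_exists_fun]
    constructor
    · rintro ⟨μ, rfl⟩
      exact ⟨fun i => (μ i).1, fun i => (μ i).2, rfl⟩
    · rintro ⟨μ, hμ, rfl⟩
      exact ⟨fun i => ⟨μ i, hμ i⟩, rfl⟩
  set p : Module.Dual ℝ K := ∑ i, l i • (a i).comp K.subtype with hp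
  have hcoord : ∀ (μ : ι → ℝ) (φ : Module.Dual ℝ K) (s r : ℝ), ∑ i, μ i • u i = (φ, s, r) ↔
      (∑ i, μ i • (a i).comp K.subtype = φ ∧ ∑ i, μ i = s ∧ ∑ i, μ i * a i x = r) := by
    intro μ φ s r
    have : ∑ i, μ i • u i =
        (∑ i, μ i • (a i).comp K.subtype, ∑ i, μ i, ∑ i, μ i * a i x) := by
      refine Prod.ext ?_ (Prod.ext ?_ ?_)
      · simp [u, Prod.fst_sum]
      · simp [u, Prod.fst_sum, Prod.snd_sum]
      · simp [u, Prod.snd_sum]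
    rw [this, Prod.mk.injEq, Prod.mk.injEq]
  -- the values of `r` with `(p, 1, r)` in the cone
  have hR : ∀ r : ℝ, (∀ w ∈ t, 0 ≤ p w.1 + w.2.1 + r * w.2.2) ↔ ∃ μ : ι → ℝ, (∀ i, 0 ≤ μ i) ∧
      (∑ i, μ i • (a i).comp K.subtype = p ∧ ∑ i, μ i = 1 ∧ ∑ i, μ i * a i x = r) := by
    intro r
    have h1 := ht (p, 1, r)
    rw [hspan] at h1
    simp only [hcoord, hB, one_mul] at h1
    exact h1.symm
  set r₀ := ∑ i, l i * a i x
  have hr₀ : ∀ w ∈ t, 0 ≤ p w.1 + w.2.1 + r₀ * w.2.2 := (hR r₀).2 ⟨l, hl, rfl, hl1, rfl⟩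
  obtain ⟨i₀, hi₀⟩ := Finite.exists_min fun i => a i x
  have hbdd : ∀ r : ℝ, (∀ w ∈ t, 0 ≤ p w.1 + w.2.1 + r * w.2.2) → a i₀ x ≤ r := by
    intro r hr
    obtain ⟨μ, hμ, -, hμ1, rfl⟩ := (hR r).1 hr
    calc a i₀ x = ∑ i, μ i * a i₀ x := by rw [← Finset.sum_mul, hμ1, one_mul]
      _ ≤ _ := Finset.sum_le_sum fun i _ => mul_le_mul_of_nonneg_left (hi₀ i) (hμ i)
  -- The value is bounded below by the smallest `a i x`, so some inequality must bound `r` from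
  -- below. Otherwise every value below the feasible `r₀` would be feasible.
  have hpos : (t.filter fun w => 0 < w.2.2).Nonempty := by
    by_contra hemp
    rw [Finset.not_nonempty_iff_eq_empty, Finset.filter_eq_empty_iff] at hemp
    have h1 := hbdd (min r₀ (a i₀ x) - 1) fun w hw => by
      have h1 := hr₀ w hw
      have h2 := not_lt.1 (hemp hw)
      have h3 := min_le_left r₀ (a i₀ x)
      nlinarith
    have := min_le_right r₀ (a i₀ x)
    linarith
  obtain ⟨w, hw, hmax⟩ := Finset.exists_max_image _ (fun w => -(p w.1 + w.2.1) / w.2.2) hpos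
  obtain ⟨hwt, hw0⟩ := Finset.mem_filter.1 hw
  -- The optimal value. The inequality `w` is tight there, and rescaled it is the dual solution: its
  -- `K`-component divided by `w.2.2` is the required translation.
  set r := -(p w.1 + w.2.1) / w.2.2 with hr
  have hrw : p w.1 + w.2.1 + r * w.2.2 = 0 := by
    rw [hr, div_mul_cancel₀ _ hw0.ne']
    ring
  have hrr₀ : r ≤ r₀ := by
    have := hr₀ w hwt
    rw [hr, div_le_iff₀ hw0]
    linarith
  obtain ⟨μ, hμ, hμp, hμ1, hμr⟩ := (hR r).1 fun w' hw' => by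
    rcases lt_or_ge 0 w'.2.2 with h0 | h0
    · have := hmax w' (Finset.mem_filter.2 ⟨hw', h0⟩)
      rw [div_le_iff₀ h0] at this
      linarith
    · have := hr₀ w' hw'
      nlinarith
  have hu : ∀ i, 0 ≤ a i w.1 + w.2.1 + a i x * w.2.2 := by
    intro i
    have := (ht (u i)).1 (Submodule.subset_span (by simp)) w hwt
    rw [hB] at this
    simpa [u] using this
  have hsum : ∑ i, μ i * (a i w.1 + w.2.1 + a i x * w.2.2) = 0 := by
    rw [← hrw, ← hμp, ← hμr, LinearMap.sum_apply, Finset.sum_mul]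
    simp only [mul_add, Finset.sum_add_distrib, ← Finset.sum_mul, hμ1, one_mul, mul_assoc,
      LinearMap.smul_apply, LinearMap.comp_apply, Submodule.subtype_apply, smul_eq_mul]
  -- Complementary slackness: each `u i` with positive weight in the optimal combination lies on the
  -- tight hyperplane.
  have hzero := (Finset.sum_eq_zero_iff_of_nonneg fun i _ => mul_nonneg (hμ i) (hu i)).1 hsum
  refine ⟨w.2.2⁻¹ • (w.1 : V), K.smul_mem _ w.1.2, μ, hμ, hμ1, fun y hy => ?_, fun i hi j => ?_⟩
  · have := congrArg (fun φ : Module.Dual ℝ K => φ ⟨y, hy⟩) (hμp.trans hp)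
    simpa [LinearMap.sum_apply] using this
  · have h1 := (mul_eq_zero.1 (hzero i (Finset.mem_univ i))).resolve_left hi
    have h2 := hu j
    have e : ∀ i, a i (x + w.2.2⁻¹ • (w.1 : V)) =
        w.2.2⁻¹ * (a i w.1 + w.2.1 + a i x * w.2.2) - w.2.2⁻¹ * w.2.1 := by
      intro i
      rw [map_add, map_smul, smul_eq_mul]
      field_simp
      ring
    rw [e, e, h1]
    have := mul_nonneg (inv_nonneg.2 hw0.le) h2
    linarith

/-- The additivity axiom for the quotient of the normal cells. -/
lemma mem_refinedCell_add [Nonempty ι] {q : V →ₗ[ℝ] V'} (hq : Function.Surjective q)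
    [FiniteDimensional ℝ (LinearMap.ker q)] (x y z : V')
    (hy : y ∈ refinedCell q (Set.range (normalCell a)) x)
    (hz : z ∈ refinedCell q (Set.range (normalCell a)) x) :
    y ∈ refinedCell q (Set.range (normalCell a)) (y + z) := by
  classical
  have hc := isCellSystem_normalCell a
  refine mem_refinedCell.2 ?_
  rintro v ⟨c, hcv, hcyz⟩
  obtain ⟨x', rfl⟩ := hq x
  set S := Finset.univ.filter fun i => ∀ j, a i c ≤ a j c with hS
  obtain ⟨i₀, hi₀⟩ := Finite.exists_min fun i => a i c
  have hScard : (0 : ℝ) < S.card := by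
    exact_mod_cast Finset.card_pos.2 ⟨i₀, by simpa [hS] using hi₀⟩
  -- The uniform weights on the forms minimal at `c`. That they are positive on all of `S` is used
  -- at the end, to pass from a vanishing sum to each of its terms.
  set l : ι → ℝ := fun i => if i ∈ S then (S.card : ℝ)⁻¹ else 0 with hl
  have hl0 : ∀ i, 0 ≤ l i := fun i => by
    simp only [hl]
    split_ifs
    · positivity
    · exact le_rfl
  have hl1 : ∑ i, l i = 1 := by
    simp only [hl, Finset.sum_ite_mem, Finset.univ_inter, Finset.sum_const, nsmul_eq_mul]
    exact mul_inv_cancel₀ hScard.ne'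
  -- The lift `x' + k` of `x` is chosen so that forms minimal there have a convex combination
  -- agreeing with `l` on the kernel of `q`. It remains to see that every form minimal at `c` is
  -- also minimal at the lift `b₁ + b₂` of `y + z` constructed in the cell of `x' + k`.
  obtain ⟨k, hk, μ, hμ, hμ1, hμl, hmin⟩ :=
    exists_minimal_translate a (LinearMap.ker q) x' l hl0 hl1
  have hxk : q (x' + k) = q x' := by rw [map_add, LinearMap.mem_ker.1 hk, add_zero]
  obtain ⟨b₁, hb₁, rfl⟩ := mem_refinedCell.1 hy (x' + k) ⟨_, hc.self_mem _, hxk⟩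
  obtain ⟨b₂, hb₂, rfl⟩ := mem_refinedCell.1 hz (x' + k) ⟨_, hc.self_mem _, hxk⟩
  refine ⟨b₁, hc.le_of_mem hcv fun i hi => hc.mem_cell_add hb₁ hb₂ i ?_, rfl⟩
  have hb := add_mem hb₁ hb₂
  obtain ⟨i₁, hi₁⟩ := Finite.exists_min fun i => a i (x' + k)
  have hh := hb i₁ hi₁
  set c' := b₁ + b₂
  have hker : c' - c ∈ LinearMap.ker q := by
    rw [LinearMap.mem_ker, map_sub, hcyz, map_add, sub_self]
  have hμc' : ∑ i, μ i * a i c' = a i₁ c' := by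
    have : ∀ i, μ i * a i c' = μ i * a i₁ c' := by
      intro i
      by_cases h0 : μ i = 0
      · rw [h0, zero_mul, zero_mul]
      · rw [le_antisymm (hb i (hmin i h0) i₁) (hh i)]
    rw [Finset.sum_congr rfl fun i _ => this i, ← Finset.sum_mul, hμ1, one_mul]
  have hlc : ∑ i, l i * a i c = a i₀ c := by
    have : ∀ i, l i * a i c = l i * a i₀ c := by
      intro i
      by_cases h0 : i ∈ S
      · rw [le_antisymm ((Finset.mem_filter.1 h0).2 i₀) (hi₀ i)]
      · simp [hl, h0]
    rw [Finset.sum_congr rfl fun i _ => this i, ← Finset.sum_mul, hl1, one_mul]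
  have hμc : a i₀ c ≤ ∑ i, μ i * a i c := by
    calc a i₀ c = ∑ i, μ i * a i₀ c := by rw [← Finset.sum_mul, hμ1, one_mul]
      _ ≤ _ := Finset.sum_le_sum fun i _ => mul_le_mul_of_nonneg_left (hi₀ i) (hμ i)
  have hdiff := hμl _ hker
  simp only [map_sub, mul_sub, Finset.sum_sub_distrib] at hdiff
  -- On `c' - c`, which lies in the kernel, the weights `μ` and `l` agree. Moreover `μ` attains the
  -- minimum at `c'`, `l` attains it at `c`, and the `μ`-average at `c` is at least the minimum.
  -- Hence the `l`-average at `c'` does not exceed the minimum at `c'`.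
  have hle : ∑ i, l i * (a i c' - a i₁ c') ≤ 0 := by
    simp only [mul_sub, Finset.sum_sub_distrib, ← Finset.sum_mul, hl1, one_mul]
    linarith
  have hzero := (Finset.sum_eq_zero_iff_of_nonneg fun i _ =>
    mul_nonneg (hl0 i) (sub_nonneg.2 (hh i))).1
      (le_antisymm hle (Finset.sum_nonneg fun i _ => mul_nonneg (hl0 i) (sub_nonneg.2 (hh i))))
  have hiS : i ∈ S := by simpa [hS] using hi
  have h1 := (mul_eq_zero.1 (hzero i (Finset.mem_univ i))).resolve_left (by
    simp only [hl, if_pos hiS]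
    positivity)
  intro j
  have := hh j
  linarith

end Cells

/-! ### Integral forms on cones and their reduction modulo pulled back forms -/

section Combinatorics

variable {V V' : Type} [AddCommGroup V] [Module ℝ V] [AddCommGroup V'] [Module ℝ V']

lemma nonneg_of_mem_span {s : Set V} {w : Module.Dual ℝ V} (h : ∀ g ∈ s, 0 ≤ w g) {x : V}
    (hx : x ∈ Submodule.span {c : ℝ // 0 ≤ c} s) : 0 ≤ w x := by
  induction hx using Submodule.span_induction with
  | mem g hg => exact h g hg
  | zero => simp
  | add x y _ _ hx hy => simpa only [map_add] using add_nonneg hx hy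
  | smul c x _ hx =>
    have : w (c • x) = c.1 * w x := map_smul w c.1 x
    rw [this]
    exact mul_nonneg c.2 hx

lemma eq_of_mem_span {s : Set V} {w w' : Module.Dual ℝ V} (h : ∀ g ∈ s, w g = w' g) {x : V}
    (hx : x ∈ Submodule.span {c : ℝ // 0 ≤ c} s) : w x = w' x := by
  have h1 : 0 ≤ (w - w') x := nonneg_of_mem_span (fun g hg => by simp [h g hg]) hx
  have h2 : 0 ≤ (w' - w) x := nonneg_of_mem_span (fun g hg => by simp [h g hg]) hx
  rw [LinearMap.sub_apply] at h1 h2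
  linarith

/-- Every vector of the linear span of a finite set becomes an element of the cone after adding a
multiple of the sum of the generators. -/
lemma exists_add_nsmul_sum_mem {s : Finset V} {y : V} (hy : y ∈ Submodule.span ℝ (s : Set V)) :
    ∃ n : ℕ, y + n • ∑ g ∈ s, g ∈ Submodule.span {c : ℝ // 0 ≤ c} (s : Set V) ∧
      -y + n • ∑ g ∈ s, g ∈ Submodule.span {c : ℝ // 0 ≤ c} (s : Set V) := by
  classical
  set C := Submodule.span {c : ℝ // 0 ≤ c} (s : Set V)
  set z := ∑ g ∈ s, g with hz
  have hmem : ∀ g ∈ s, g ∈ C := fun g hg => Submodule.subset_span hg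
  have hzC : z ∈ C := Submodule.sum_mem _ hmem
  have hsmul : ∀ (r : ℝ) (x : V), 0 ≤ r → x ∈ C → r • x ∈ C := fun r x hr hx =>
    PointedCone.smul_mem C hr hx
  induction hy using Submodule.span_induction with
  | mem g hg =>
    refine ⟨1, ?_, ?_⟩
    · rw [one_smul]
      exact C.add_mem (hmem g hg) hzC
    · rw [one_smul, hz, ← Finset.add_sum_erase s _ hg, neg_add_cancel_left]
      exact C.sum_mem fun g' hg' => hmem g' (Finset.mem_of_mem_erase hg')
  | zero => exact ⟨0, by simp, by simp⟩
  | add x y _ _ hx hy =>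
    obtain ⟨n, hn, hn'⟩ := hx
    obtain ⟨m, hm, hm'⟩ := hy
    refine ⟨n + m, ?_, ?_⟩
    · convert! C.add_mem hn hm using 1
      rw [add_smul]
      abel
    · convert! C.add_mem hn' hm' using 1
      rw [add_smul]
      abel
  | smul r x _ hx =>
    obtain ⟨n, hn, hn'⟩ := hx
    obtain ⟨m, hm⟩ := exists_nat_ge (|r| * n)
    have key : ∀ y, y + n • z ∈ C → |r| • y + m • z ∈ C := by
      intro y hy
      convert! C.add_mem (hsmul |r| _ (abs_nonneg r) hy)
        (hsmul (m - |r| * n) _ (sub_nonneg.2 hm) hzC)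
        using 1
      rw [smul_add, ← Nat.cast_smul_eq_nsmul ℝ, ← Nat.cast_smul_eq_nsmul ℝ]
      module
    refine ⟨m, ?_⟩
    have h1 := key x hn
    have h2 := key (-x) hn'
    rcases abs_cases r with ⟨h, -⟩ | ⟨h, -⟩
    · rw [h] at h1 h2
      exact ⟨h1, by rwa [smul_neg] at h2⟩
    · rw [h] at h1 h2
      exact ⟨by rwa [neg_smul, smul_neg, neg_neg] at h2, by rwa [neg_smul] at h1⟩

/-- An integral form that is divisible by `n` on the lattice points of a rational cone coincides
with `n` times an integral form on that cone. -/
lemma exists_div_mem_dualLattice {N : AddSubgroup V} (hN : IsFullLattice N) {ξ : PointedCone ℝ V}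
    (hξ : IsRational N ξ) {w : Module.Dual ℝ V} {n : ℝ} (hn : 0 < n)
    (hdiv : ∀ y ∈ ξ, y ∈ N → ∃ k : ℤ, w y = n * k) :
    ∃ u ∈ dualLattice N, ∀ y ∈ ξ, w y = n * u y := by
  obtain ⟨s, hs, rfl⟩ := hξ
  have hsum : ∑ g ∈ s, g ∈ N := N.sum_mem hs
  have hsum' : ∑ g ∈ s, g ∈ Submodule.span {c : ℝ // 0 ≤ c} (s : Set V) :=
    Submodule.sum_mem _ fun g hg => Submodule.subset_span hg
  -- Adding a multiple of the sum of the generators moves a lattice point of the span into the cone,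
  -- so divisibility extends from the cone to its span.
  have hdiv' : ∀ y ∈ Submodule.span ℝ (s : Set V), y ∈ N → ∃ k : ℤ, w y = n * k := by
    intro y hy hyN
    obtain ⟨m, hm, -⟩ := exists_add_nsmul_sum_mem hy
    obtain ⟨k₁, hk₁⟩ := hdiv _ hm (N.add_mem hyN (N.nsmul_mem hsum m))
    obtain ⟨k₂, hk₂⟩ := hdiv _ hsum' hsum
    refine ⟨k₁ - m * k₂, ?_⟩
    rw [map_add, map_nsmul, hk₂, nsmul_eq_mul] at hk₁
    push_cast
    linarith
  -- The lattice points in the span of `ξ` form a saturated sublattice. Its quotient is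
  -- torsion-free, hence free, so `L` is a direct summand and `w / n` on `L` extends by zero on a
  -- complement.
  let L : Submodule ℤ N :=
    { carrier := {y | (y : V) ∈ Submodule.span ℝ (s : Set V)}
      zero_mem' := by simp
      add_mem' := fun {a b} ha hb => by simpa using add_mem ha hb
      smul_mem' := fun c x hx => by
        have := (Submodule.span ℝ (s : Set V)).smul_mem (c : ℝ) hx
        rw [Int.cast_smul_eq_zsmul] at this
        simpa using this }
  have hmemL : ∀ y : N, y ∈ L ↔ (y : V) ∈ Submodule.span ℝ (s : Set V) := fun _ => Iff.rfl
  have : Module.Finite ℤ N := by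
    rw [Module.Finite.iff_addGroup_fg]
    exact (AddGroup.fg_iff_addSubgroup_fg N).2 hN.fg
  have : Module.IsTorsionFree ℤ (N ⧸ L) := by
    rw [Module.isTorsionFree_int_iff_isAddTorsionFree]
    refine ⟨fun m hm a₁ a₂ ha => sub_eq_zero.1 ?_⟩
    replace ha : m • (a₁ - a₂) = 0 := by rw [nsmul_sub, sub_eq_zero]; exact ha
    generalize a₁ - a₂ = a at ha ⊢
    obtain ⟨y, rfl⟩ := L.mkQ_surjective a
    rw [← map_nsmul, Submodule.mkQ_apply, Submodule.Quotient.mk_eq_zero, hmemL] at ha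
    rw [Submodule.mkQ_apply, Submodule.Quotient.mk_eq_zero, hmemL]
    have h1 := (Submodule.span ℝ (s : Set V)).smul_mem (m : ℝ)⁻¹ ha
    rwa [AddSubgroup.coe_nsmul, ← Nat.cast_smul_eq_nsmul ℝ, smul_smul,
      inv_mul_cancel₀ (by exact_mod_cast hm), one_smul] at h1
  obtain ⟨σ, hσ⟩ := Module.projective_lifting_property L.mkQ LinearMap.id L.mkQ_surjective
  have hσL : ∀ y : N, y - σ (L.mkQ y) ∈ L := by
    intro y
    rw [← Submodule.Quotient.mk_eq_zero, ← Submodule.mkQ_apply, map_sub, sub_eq_zero]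
    exact (LinearMap.congr_fun hσ (L.mkQ y)).symm
  choose k hk using fun y : N => hdiv' _ (hσL y) (y - σ (L.mkQ y)).2
  obtain ⟨u, hu⟩ := hN.extend (AddMonoidHom.mk' k fun a b => by
    have h1 := hk (a + b)
    have e : ((a + b - σ (L.mkQ (a + b)) : N) : V) =
        ((a - σ (L.mkQ a) : N) : V) + ((b - σ (L.mkQ b) : N) : V) := by
      rw [← AddSubgroup.coe_add, map_add, map_add]
      congr 1
      abel
    rw [e, map_add, hk a, hk b, ← mul_add] at h1
    have := mul_left_cancel₀ hn.ne' h1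
    exact_mod_cast this.symm)
  refine ⟨u, fun x hx => ⟨_, hu ⟨x, hx⟩⟩, fun y hy => ?_⟩
  refine eq_of_mem_span (w' := n • u) (fun g hg => ?_) hy
  have h1 := hk ⟨g, hs g hg⟩
  have h2 := hu ⟨g, hs g hg⟩
  have h3 : L.mkQ ⟨g, hs g hg⟩ = 0 := by
    rw [Submodule.mkQ_apply, Submodule.Quotient.mk_eq_zero, hmemL]
    exact Submodule.subset_span hg
  rw [h3, map_zero, sub_zero] at h1
  rw [LinearMap.smul_apply, smul_eq_mul, h1]
  exact congrArg (n * ·) h2.symm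

/-- A surjective linear map of lattices together with compatible systems of rational cells, such
that every cell maps onto a cell. -/
structure IsCellMap (N : AddSubgroup V) (N' : AddSubgroup V') (q : V →ₗ[ℝ] V')
    (c : V → PointedCone ℝ V) (c' : V' → PointedCone ℝ V') : Prop where
  isFullLattice : IsFullLattice N
  isFullLattice' : IsFullLattice N'
  surjective : Function.Surjective q
  map_lattice : ∀ x ∈ N, q x ∈ N'
  exists_lift : ∀ y ∈ N', ∃ x ∈ N, q x = y
  cells : IsCellSystem c
  cells' : IsCellSystem c'
  rational : ∀ v, IsRational N (c v)
  rational' : ∀ v, IsRational N' (c' v)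
  map_cell : ∀ v, PointedCone.map q (c v) = c' (q v)

namespace IsCellMap

variable {N : AddSubgroup V} {N' : AddSubgroup V'} {q : V →ₗ[ℝ] V'} {c : V → PointedCone ℝ V}
  {c' : V' → PointedCone ℝ V'} (H : IsCellMap N N' q c c')

include H

lemma map_mem {v x : V} (hx : x ∈ c v) : q x ∈ c' (q v) := by
  rw [← H.map_cell]
  exact ⟨x, hx, rfl⟩

lemma exists_mem {v : V} {y : V'} (hy : y ∈ c' (q v)) : ∃ x ∈ c v, q x = y := by
  rw [← H.map_cell] at hy
  exact hy

/-- The face of a cell on which a form vanishes is a cell. -/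
lemma exists_cell_of_form {v : V} {r : Module.Dual ℝ V} (hr : r ∈ dualMonoid N (c v)) :
    ∃ z ∈ c v, ∀ x, x ∈ c z ↔ x ∈ c v ∧ r x = 0 := by
  have hτ : ∀ x, x ∈ c v ⊓ PointedCone.ofSubmodule (LinearMap.ker r) ↔ x ∈ c v ∧ r x = 0 :=
    fun x => Iff.rfl
  obtain ⟨z, hz, hcz⟩ := H.cells.exists_of_isFace H.isFullLattice (H.rational v) ⟨r, hr, hτ⟩
  exact ⟨z, hz.1, fun x => by rw [hcz, hτ]⟩

/-- If the zero set of `r` in a cell does not map onto the image of the cell, then this is detected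
by a form on the target. -/
lemma exists_form_of_ne {v z : V} (hz : z ∈ c v) (hne : c' (q z) ≠ c' (q v)) :
    ∃ w ∈ dualMonoid N' (c' (q v)), (∀ y, y ∈ c' (q z) ↔ y ∈ c' (q v) ∧ w y = 0) ∧
      ∃ y ∈ c' (q v), w y ≠ 0 := by
  have hqz := H.map_mem hz
  obtain ⟨w, hw, hwz⟩ := H.cells'.isFace_of_mem H.isFullLattice' (H.rational' (q v)) hqz
  refine ⟨w, hw, hwz, ?_⟩
  by_contra! h
  exact hne (le_antisymm (H.cells'.le_of_mem hqz) fun y hy => (hwz y).2 ⟨hy, h y hy⟩)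

/-- After subtracting a rational form pulled back from the target, a form on a cell vanishes on a
subcell that maps onto the image of the cell. -/
lemma exists_smul_sub_vanishing {v : V} {p : Module.Dual ℝ V} (hp : p ∈ dualMonoid N (c v)) :
    ∃ n : ℤ, 0 < n ∧ ∃ w ∈ dualLattice N', (∀ x ∈ c v, w (q x) ≤ n * p x) ∧
      ∃ z ∈ c v, c' (q z) = c' (q v) ∧ ∀ x ∈ c z, n * p x = w (q x) := by
  classical
  obtain ⟨s, hs, hspan⟩ := H.rational v
  have hsmem : ∀ g ∈ s, g ∈ c v := fun g hg => hspan ▸ Submodule.subset_span hg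
  -- Induction on the number of generators at which the remainder `n * p - w ∘ q` does not vanish.
  suffices h : ∀ (K : ℕ) (n : ℤ) (w : Module.Dual ℝ V'), 0 < n → w ∈ dualLattice N' →
      (∀ x ∈ c v, w (q x) ≤ n * p x) → (s.filter fun g => n * p g ≠ w (q g)).card = K →
      ∃ n : ℤ, 0 < n ∧ ∃ w ∈ dualLattice N', (∀ x ∈ c v, w (q x) ≤ n * p x) ∧
      ∃ z ∈ c v, c' (q z) = c' (q v) ∧ ∀ x ∈ c z, n * p x = w (q x) from
    h _ 1 0 one_pos (zero_mem _) (fun x hx => by simpa using hp.2 x hx) rfl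
  intro K
  induction K using Nat.strong_induction_on with
  | _ K ih =>
    intro n w hn hw hle hK
    set r : Module.Dual ℝ V := (n : ℝ) • p - w.comp q with hr
    have hrx : ∀ x, r x = n * p x - w (q x) := fun x => rfl
    have hrS : r ∈ dualMonoid N (c v) := by
      refine ⟨fun x hx => ?_, fun x hx => sub_nonneg.2 (hle x hx)⟩
      obtain ⟨a, ha⟩ := hp.1 x hx
      obtain ⟨b, hb⟩ := hw _ (H.map_lattice x hx)
      exact ⟨n * a - b, by rw [hrx, ha, hb]; push_cast; ring⟩
    obtain ⟨z, hz, hcz⟩ := H.exists_cell_of_form hrS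
    by_cases hne : c' (q z) = c' (q v)
    · exact ⟨n, hn, w, hw, hle, z, hz, hne, fun x hx => sub_eq_zero.1 ((hcz x).1 hx).2⟩
    obtain ⟨w', hw', hw'z, y, hy, hy0⟩ := H.exists_form_of_ne hz hne
    have hqz0 : ∀ g ∈ s, r g = 0 → w' (q g) = 0 := fun g hg h =>
      ((hw'z _).1 (H.map_mem ((hcz g).2 ⟨hsmem g hg, h⟩))).2
    have hpos : (s.filter fun g => 0 < w' (q g)).Nonempty := by
      by_contra hemp
      rw [Finset.not_nonempty_iff_eq_empty, Finset.filter_eq_empty_iff] at hemp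
      obtain ⟨x, hx, rfl⟩ := H.exists_mem hy
      refine hy0 ?_
      rw [hspan] at hx
      refine eq_of_mem_span (w := w'.comp q) (w' := 0) (fun g hg => ?_) hx
      exact le_antisymm (not_lt.1 (hemp hg)) (hw'.2 _ (H.map_mem (hsmem g hg)))
    -- The largest multiple of `w'` that can be subtracted from `r` is the minimal ratio, attained
    -- at `g`; with `A` and `B` the two integral values there, denominators are cleared to `B * r -
    -- A * w'`. This vanishes at `g`, and still at the old zeros, because `w'` vanishes on the image
    -- of the zero face of `r`.
    obtain ⟨g, hg, hmin⟩ := Finset.exists_min_image _ (fun g => r g / w' (q g)) hpos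
    obtain ⟨hgs, hg0⟩ := Finset.mem_filter.1 hg
    obtain ⟨A, hA⟩ := hrS.1 g (hs g hgs)
    obtain ⟨B, hB⟩ := hw'.1 _ (H.map_lattice g (hs g hgs))
    have hB0 : 0 < B := by
      rw [hB] at hg0
      exact_mod_cast hg0
    have hB0' : (0 : ℝ) < B := by exact_mod_cast hB0
    have hval : ∀ x, ((B * n : ℤ) : ℝ) * p x - ((B : ℝ) • w + (A : ℝ) • w') (q x) =
        B * r x - A * w' (q x) := by
      intro x
      rw [hrx]
      simp only [LinearMap.add_apply, LinearMap.smul_apply, smul_eq_mul]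
      push_cast
      ring
    refine ih _ ?_ (B * n) ((B : ℝ) • w + (A : ℝ) • w') (mul_pos hB0 hn) ?_ (fun x hx => ?_) rfl
    · rw [← hK]
      refine Finset.card_lt_card ⟨fun g' hg' => ?_, fun hsub => ?_⟩
      · obtain ⟨h1, h2⟩ := Finset.mem_filter.1 hg'
        refine Finset.mem_filter.2 ⟨h1, fun h3 => h2 ?_⟩
        have h4 : r g' = 0 := sub_eq_zero.2 h3
        rw [← sub_eq_zero, hval, h4, hqz0 g' h1 h4]
        simp
      · have h1 : g ∈ s.filter fun g => n * p g ≠ w (q g) := by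
          refine Finset.mem_filter.2 ⟨hgs, fun h3 => hg0.ne' (hqz0 g hgs (sub_eq_zero.2 h3))⟩
        refine (Finset.mem_filter.1 (hsub h1)).2 ?_
        rw [← sub_eq_zero, hval, hA, hB]
        ring
    · intro x hx
      obtain ⟨a, ha⟩ := hw x hx
      obtain ⟨b, hb⟩ := hw'.1 x hx
      exact ⟨B * a + A * b, by simp [ha, hb]⟩
    · rw [← sub_nonneg, hval]
      rw [hspan] at hx
      refine nonneg_of_mem_span (w := (B : ℝ) • r - (A : ℝ) • w'.comp q) (fun g' hg' => ?_) hx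
      simp only [LinearMap.sub_apply, LinearMap.smul_apply, LinearMap.comp_apply, smul_eq_mul]
      rcases (hw'.2 _ (H.map_mem (hsmem g' hg'))).eq_or_lt with h0 | h0
      · rw [← h0]
        have := mul_nonneg hB0'.le (hrS.2 _ (hsmem g' hg'))
        simpa using this
      · have := hmin g' (Finset.mem_filter.2 ⟨hg', h0⟩)
        rw [hA, hB, div_le_div_iff₀ hB0' h0] at this
        linarith

/-- If all lattice points of the cells lift, then every form on a cell differs by a form from the
target from one that vanishes somewhere over each point of the target. -/
lemma exists_reduced_form (hlift : ∀ v, ∀ y ∈ c' (q v), y ∈ N' → ∃ x ∈ c v, x ∈ N ∧ q x = y)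
    {v : V} {p : Module.Dual ℝ V} (hp : p ∈ dualMonoid N (c v)) :
    ∃ p₀ ∈ dualMonoid N (c v), ∃ u : Module.Dual ℝ V', p = p₀ + u.comp q ∧
      ∀ y ∈ c' (q v), ∃ x ∈ c v, q x = y ∧ p₀ x = 0 := by
  obtain ⟨n, hn, w, hw, hle, z, hz, hzv, hzero⟩ := H.exists_smul_sub_vanishing hp
  have hn' : (0 : ℝ) < n := by exact_mod_cast hn
  -- A lattice point `y` lifts to a lattice point `x` in the subcell where `n * p = w ∘ q`, so `w y
  -- = n * p x` is divisible by `n`.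
  obtain ⟨u, hu, huw⟩ := exists_div_mem_dualLattice H.isFullLattice' (H.rational' (q v)) (w := w)
    hn' fun y hy hyN => by
      rw [← hzv] at hy
      obtain ⟨x, hx, hxN, rfl⟩ := hlift z y hy hyN
      obtain ⟨k, hk⟩ := hp.1 x hxN
      exact ⟨k, by rw [← hzero x hx, hk]⟩
  have hval : ∀ x ∈ c v, n * (p - u.comp q) x = n * p x - w (q x) := by
    intro x hx
    rw [huw _ (H.map_mem hx), LinearMap.sub_apply, LinearMap.comp_apply]
    ring
  refine ⟨p - u.comp q, ⟨fun x hx => ?_, fun x hx => ?_⟩, u, by rw [sub_add_cancel],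
    fun y hy => ?_⟩
  · obtain ⟨a, ha⟩ := hp.1 x hx
    obtain ⟨b, hb⟩ := hu _ (H.map_lattice x hx)
    exact ⟨a - b, by simp [ha, hb]⟩
  · have h1 := hval x hx
    have h2 := hle x hx
    exact nonneg_of_mul_nonneg_right (by linarith) hn'
  · rw [← hzv] at hy
    obtain ⟨x, hx, rfl⟩ := H.exists_mem hy
    refine ⟨x, H.cells.le_of_mem hz hx, rfl, ?_⟩
    have h1 := hval x (H.cells.le_of_mem hz hx)
    rw [hzero x hx, sub_self] at h1
    exact (mul_eq_zero.1 h1).resolve_left hn'.ne'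

/-- A form that differs from a reduced one by a form vanishing on `ker q` is the sum of the reduced
form and a form from the target cone. -/
lemma exists_eq_add_comp {v : V} {p p₀ : Module.Dual ℝ V} (hp : p ∈ dualMonoid N (c v))
    (hp₀ : p₀ ∈ dualMonoid N (c v)) (hred : ∀ y ∈ c' (q v), ∃ x ∈ c v, q x = y ∧ p₀ x = 0)
    (hker : ∀ x, q x = 0 → p x = p₀ x) :
    ∃ u ∈ dualMonoid N' (c' (q v)), p = p₀ + u.comp q := by
  have h1 : p - p₀ ∈ (LinearMap.ker q).dualAnnihilator := by
    rw [Submodule.mem_dualAnnihilator]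
    intro x hx
    rw [LinearMap.sub_apply, hker x hx, sub_self]
  rw [← LinearMap.range_dualMap_eq_dualAnnihilator_ker_of_surjective q H.surjective] at h1
  obtain ⟨u, hu⟩ := h1
  have hux : ∀ x, u (q x) = p x - p₀ x := fun x => LinearMap.congr_fun hu x
  refine ⟨u, ⟨fun y hy => ?_, fun y hy => ?_⟩, ?_⟩
  · obtain ⟨x, hx, rfl⟩ := H.exists_lift y hy
    obtain ⟨a, ha⟩ := hp.1 x hx
    obtain ⟨b, hb⟩ := hp₀.1 x hx
    exact ⟨a - b, by rw [hux, ha, hb]; push_cast; rfl⟩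
  · obtain ⟨x, hx, rfl, hx0⟩ := hred y hy
    rw [hux, hx0, sub_zero]
    exact hp.2 x hx
  · ext x
    rw [LinearMap.add_apply, LinearMap.comp_apply, hux]
    ring

end IsCellMap

end Combinatorics

/-! ### Monoid algebras: free extensions and reducedness of their fibers -/

section MonoidAlgebra

open scoped TensorProduct

variable {k : Type u} [Field k] {S S' : Type} [AddCommMonoid S] [AddCommMonoid S'] {φ : S' →+ S}
  [Algebra (AddMonoidAlgebra k S') (AddMonoidAlgebra k S)]

/-- If every element of `S` is uniquely the sum of an element of `E` and an element of the image
of `S'`, then `k[S]` is free over `k[S']`, with basis `E`. -/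
lemma exists_basis_of_existsUnique_add
    (halg : algebraMap (AddMonoidAlgebra k S') (AddMonoidAlgebra k S) =
      AddMonoidAlgebra.mapDomainRingHom k φ) {E : Set S}
    (hE : ∀ p, ∃ e ∈ E, ∃ w, p = e + φ w)
    (huniq : ∀ e ∈ E, ∀ e' ∈ E, ∀ w w', e + φ w = e' + φ w' → e = e' ∧ w = w') :
    ∃ b : Module.Basis E (AddMonoidAlgebra k S') (AddMonoidAlgebra k S),
      ∀ e, b e = AddMonoidAlgebra.single (e : S) 1 := by
  classical
  choose e heE w hew using hE
  have hsmul : ∀ (w : S') (r r' : k) (p : S),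
      AddMonoidAlgebra.single w r • AddMonoidAlgebra.single p r' =
        (AddMonoidAlgebra.single (p + φ w) (r * r') : AddMonoidAlgebra k S) := by
    intro w r r' p
    rw [Algebra.smul_def, halg]
    change AddMonoidAlgebra.mapDomain φ _ * _ = _
    rw [AddMonoidAlgebra.mapDomain_single, AddMonoidAlgebra.single_mul_single, add_comm]
  let L := Finsupp.linearCombination (AddMonoidAlgebra k S')
    (fun e : E => (AddMonoidAlgebra.single (e : S) 1 : AddMonoidAlgebra k S))
  -- The inverse of `L`, splitting each monomial into its generator and its coefficient monomial.
  let T : AddMonoidAlgebra k S → (E →₀ AddMonoidAlgebra k S') := fun x =>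
    x.coeff.sum fun p r => Finsupp.single ⟨e p, heE p⟩ (AddMonoidAlgebra.single (w p) r)
  have hTadd : ∀ x y, T (x + y) = T x + T y := by
    intro x y
    refine Finsupp.sum_add_index' (fun p => ?_) fun p r r' => ?_
    · rw [AddMonoidAlgebra.single_zero, Finsupp.single_zero]
    · rw [AddMonoidAlgebra.single_add, Finsupp.single_add]
  have hTzero : T 0 = 0 := Finsupp.sum_zero_index
  have hTsingle : ∀ p r, T (AddMonoidAlgebra.single p r) =
      Finsupp.single ⟨e p, heE p⟩ (AddMonoidAlgebra.single (w p) r) := by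
    intro p r
    refine Finsupp.sum_single_index ?_
    rw [AddMonoidAlgebra.single_zero, Finsupp.single_zero]
  have hTL : ∀ f, T (L f) = f := by
    intro f
    induction f using Finsupp.induction_linear with
    | zero => rw [map_zero, hTzero]
    | add f g hf hg => rw [map_add, hTadd, hf, hg]
    | single a x =>
      rw [Finsupp.linearCombination_single]
      induction x using AddMonoidAlgebra.induction_linear with
      | zero => rw [zero_smul, hTzero, Finsupp.single_zero]
      | add x y hx hy => rw [add_smul, hTadd, hx, hy, Finsupp.single_add]
      | single w' r =>
        rw [hsmul, hTsingle, mul_one]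
        obtain ⟨h1, h2⟩ := huniq _ a.2 _ (heE _) _ _ (hew (a + φ w'))
        have h3 : (⟨e (a + φ w'), heE _⟩ : E) = a := Subtype.ext h1.symm
        rw [h3, ← h2]
  have hLT : ∀ x, ∃ f, L f = x := by
    intro x
    induction x using AddMonoidAlgebra.induction_linear with
    | zero => exact ⟨0, map_zero _⟩
    | add x y hx hy =>
      obtain ⟨f, rfl⟩ := hx
      obtain ⟨g, rfl⟩ := hy
      exact ⟨f + g, map_add _ _ _⟩
    | single p r =>
      refine ⟨Finsupp.single ⟨e p, heE p⟩ (AddMonoidAlgebra.single (w p) r), ?_⟩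
      rw [Finsupp.linearCombination_single, hsmul, mul_one, ← hew]
  have hbij : Function.Bijective L := ⟨Function.LeftInverse.injective hTL, hLT⟩
  refine ⟨Module.Basis.ofRepr (LinearEquiv.ofBijective L hbij).symm, fun a => ?_⟩
  change L (Finsupp.single a 1) = _
  rw [Finsupp.linearCombination_single, one_smul]

/-- An algebra over a field with a basis that is multiplicative up to scalars and graded by a
torsion-free group, in which squares of basis elements do not vanish, is reduced. -/
lemma isReduced_of_graded_basis {K R G E : Type*} [Field K] [CommRing R] [Algebra K R]
    [AddCommGroup G] [UniqueSums G] (b : Module.Basis E K R) (deg : E → G)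
    (hdeg : Function.Injective deg)
    (hmul : ∀ e e', ∃ e'', ∃ a : K, deg e'' = deg e + deg e' ∧ b e * b e' = a • b e'')
    (hsq : ∀ e, ∃ e'', ∃ a : K, a ≠ 0 ∧ deg e'' = deg e + deg e ∧ b e * b e = a • b e'') :
    IsReduced R := by
  classical
  rw [isReduced_iff_pow_one_lt 2 one_lt_two]
  intro x hx
  by_contra hne
  have hsupp : (b.repr x).support.Nonempty := by
    rw [Finsupp.support_nonempty_iff]
    exact fun h => hne (b.repr.map_eq_zero_iff.1 h)
  -- A degree sum attained by only one pair has equal entries, since swapping the pair gives the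
  -- same sum. So only `b e₀ * b e₀` contributes to the coefficient of `x ^ 2` in that degree, and
  -- it does not vanish.
  obtain ⟨g, hg, h, hh, huniq⟩ := UniqueSums.uniqueAdd_of_nonempty (hsupp.image deg)
    (hsupp.image deg)
  obtain rfl : h = g := (huniq hh hg (add_comm _ _)).1
  obtain ⟨e₀, he₀, rfl⟩ := Finset.mem_image.1 hg
  obtain ⟨e₁, a, ha, hdeg₁, hsq₁⟩ := hsq e₀
  have hxsum : x = ∑ e ∈ (b.repr x).support, b.repr x e • b e :=
    (b.linearCombination_repr x).symm
  have hcoef : ∀ e ∈ (b.repr x).support, ∀ e' ∈ (b.repr x).support,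
      b.repr (b e * b e') e₁ ≠ 0 → e = e₀ ∧ e' = e₀ := by
    intro e he e' he' h0
    obtain ⟨e₂, a₂, hdeg₂, hmul₂⟩ := hmul e e'
    rw [hmul₂, map_smul, b.repr_self, Finsupp.smul_single, smul_eq_mul, mul_one] at h0
    have h1 : e₂ = e₁ := by
      by_contra h2
      exact h0 (Finsupp.single_eq_of_ne' h2)
    rw [h1, hdeg₁] at hdeg₂
    have := huniq (Finset.mem_image_of_mem _ he) (Finset.mem_image_of_mem _ he') hdeg₂.symm
    exact ⟨hdeg this.1, hdeg this.2⟩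
  have h1 : b.repr (x ^ 2) e₁ = b.repr x e₀ * (b.repr x e₀ * a) := by
    conv_lhs => rw [sq, hxsum, Finset.sum_mul_sum]
    simp only [smul_mul_smul_comm, map_sum, map_smul, Finsupp.coe_finsetSum, Finset.sum_apply,
      Finsupp.smul_apply, smul_eq_mul]
    rw [Finset.sum_eq_single e₀, Finset.sum_eq_single e₀]
    · rw [hsq₁, map_smul, b.repr_self, Finsupp.smul_single, smul_eq_mul, mul_one,
        Finsupp.single_eq_same, mul_assoc]
    · intro e' he' hne'
      by_contra h0
      exact hne' (hcoef _ he₀ _ he' (right_ne_zero_of_mul h0)).2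
    · exact fun h => absurd he₀ h
    · intro e he hne'
      refine Finset.sum_eq_zero fun e' he' => ?_
      by_contra h0
      exact hne' (hcoef _ he _ he' (right_ne_zero_of_mul h0)).1
    · exact fun h => absurd he₀ h
  rw [hx, map_zero, Finsupp.zero_apply] at h1
  have h2 := Finsupp.mem_support_iff.1 he₀
  exact mul_ne_zero h2 (mul_ne_zero h2 ha) h1.symm

/-- If moreover `E` injects into a torsion-free group and `2 e` differs from an element of `E` by
a unit of `S'` only, then all fibres of `k[S'] → k[S]` are reduced. -/
lemma isReduced_tensorProduct_of_existsUnique_add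
    (halg : algebraMap (AddMonoidAlgebra k S') (AddMonoidAlgebra k S) =
      AddMonoidAlgebra.mapDomainRingHom k φ) {E : Set S}
    (hE : ∀ p, ∃ e ∈ E, ∃ w, p = e + φ w)
    (huniq : ∀ e ∈ E, ∀ e' ∈ E, ∀ w w', e + φ w = e' + φ w' → e = e' ∧ w = w')
    {G : Type*} [AddCommGroup G] [UniqueSums G] (deg : S →+ G) (hφ : ∀ w, deg (φ w) = 0)
    (hdeg : Set.InjOn deg E) (hsq : ∀ e ∈ E, ∀ e' ∈ E, ∀ w, e + e = e' + φ w → IsAddUnit w)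
    (K : Type*) [Field K] [Algebra (AddMonoidAlgebra k S') K] :
    IsReduced (K ⊗[AddMonoidAlgebra k S'] AddMonoidAlgebra k S) := by
  obtain ⟨b, hb⟩ := exists_basis_of_existsUnique_add halg hE huniq
  have hmul : ∀ (e e' e'' : E) (w : S'), (e + e' : S) = e'' + φ w →
      b.baseChange K e * b.baseChange K e' =
        algebraMap (AddMonoidAlgebra k S') K (AddMonoidAlgebra.single w 1) •
          b.baseChange K e'' := by
    intro e e' e'' w h
    have h1 : (AddMonoidAlgebra.single (e + e' : S) (1 * 1) : AddMonoidAlgebra k S) =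
        (AddMonoidAlgebra.single w (1 : k) : AddMonoidAlgebra k S') •
          AddMonoidAlgebra.single (e'' : S) (1 : k) := by
      rw [Algebra.smul_def, halg]
      change _ = AddMonoidAlgebra.mapDomain φ _ * _
      rw [AddMonoidAlgebra.mapDomain_single, AddMonoidAlgebra.single_mul_single, add_comm (φ w), h]
    rw [Module.Basis.baseChange_apply, Module.Basis.baseChange_apply, Module.Basis.baseChange_apply,
      Algebra.TensorProduct.tmul_mul_tmul, hb, hb, hb, AddMonoidAlgebra.single_mul_single, h1,
      TensorProduct.tmul_smul, mul_one, algebraMap_smul]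
  refine isReduced_of_graded_basis (b.baseChange K) (fun e : E => deg e)
    (fun e e' h => Subtype.ext (hdeg e.2 e'.2 h)) (fun e e' => ?_) fun e => ?_
  · obtain ⟨e'', he'', w, hw⟩ := hE (e + e')
    refine ⟨⟨e'', he''⟩, _, ?_, hmul e e' ⟨e'', he''⟩ w hw⟩
    have := congrArg deg hw
    rw [map_add, map_add, hφ, add_zero] at this
    exact this.symm
  · obtain ⟨e'', he'', w, hw⟩ := hE (e + e)
    refine ⟨⟨e'', he''⟩, _, ?_, ?_, hmul e e ⟨e'', he''⟩ w hw⟩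
    -- A unit of the monoid becomes a unit of `K`, so the scalar in the square is non-zero.
    · obtain ⟨w', hw'⟩ := (hsq e e.2 e'' he'' w hw).exists_neg
      have h1 : (AddMonoidAlgebra.single w (1 : k) : AddMonoidAlgebra k S') *
          AddMonoidAlgebra.single w' 1 = 1 := by
        rw [AddMonoidAlgebra.single_mul_single, hw', mul_one, AddMonoidAlgebra.one_def]
      have h2 := congrArg (algebraMap (AddMonoidAlgebra k S') K) h1
      rw [map_mul, map_one] at h2
      exact left_ne_zero_of_mul_eq_one h2
    · have := congrArg deg hw
      rw [map_add, map_add, hφ, add_zero] at this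
      exact this.symm

open scoped Classical in
/-- The ring homomorphism `k[S'] → k` that sends the elements of the face `Z` to `1` and all the
others to `0`. -/
def faceEval (k : Type u) [Field k] (Z : AddSubmonoid S')
    (hZ : ∀ w w', w + w' ∈ Z → w ∈ Z) : AddMonoidAlgebra k S' →ₐ[k] k :=
  AddMonoidAlgebra.lift k k S'
    { toFun w := if w.toAdd ∈ Z then 1 else 0
      map_one' := if_pos Z.zero_mem
      map_mul' a b := by
        have h : a.toAdd + b.toAdd ∈ Z ↔ a.toAdd ∈ Z ∧ b.toAdd ∈ Z :=
          ⟨fun h => ⟨hZ _ _ h, hZ _ _ (add_comm a.toAdd b.toAdd ▸ h)⟩, fun h => Z.add_mem h.1 h.2⟩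
        rw [ite_zero_mul_ite_zero, mul_one]
        exact if_congr h rfl rfl }

open scoped Classical in
lemma faceEval_single (Z : AddSubmonoid S') (hZ : ∀ w w', w + w' ∈ Z → w ∈ Z) (w : S') (r : k) :
    faceEval k Z hZ (AddMonoidAlgebra.single w r) = if w ∈ Z then r else 0 := by
  rw [faceEval, AddMonoidAlgebra.lift_single]
  change r • (if w ∈ Z then (1 : k) else 0) = _
  rw [smul_ite, smul_eq_mul, mul_one, smul_zero]

/-- If the fibre over the distinguished point of the face `Z` is reduced, then an element of `S`
is divisible by an element of `S'` outside `Z` as soon as one of its multiples is. -/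
lemma exists_eq_add_of_isReduced_tensorProduct
    (halg : algebraMap (AddMonoidAlgebra k S') (AddMonoidAlgebra k S) =
      AddMonoidAlgebra.mapDomainRingHom k φ) (Z : AddSubmonoid S')
    (hZ : ∀ w w', w + w' ∈ Z → w ∈ Z) (hZneg : ∀ w ∈ Z, ∃ w' ∈ Z, w + w' = 0)
    (K : Type*) [Field K] [Algebra (AddMonoidAlgebra k S') K] (θ : K →+* k)
    (hθ : ∀ a, θ (algebraMap (AddMonoidAlgebra k S') K a) = faceEval k Z hZ a)
    (hred : IsReduced (K ⊗[AddMonoidAlgebra k S'] AddMonoidAlgebra k S))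
    {p p' : S} {w : S'} {n : ℕ} (hw : w ∉ Z) (hp : n • p = p' + φ w) :
    ∃ w' ∉ Z, ∃ p'', p = p'' + φ w' := by
  classical
  by_contra! hno
  have hsmul : ∀ (w : S') (r r' : k) (p : S),
      AddMonoidAlgebra.single w r • AddMonoidAlgebra.single p r' =
        (AddMonoidAlgebra.single (p + φ w) (r * r') : AddMonoidAlgebra k S) := by
    intro w r r' p
    rw [Algebra.smul_def, halg]
    change AddMonoidAlgebra.mapDomain φ _ * _ = _
    rw [AddMonoidAlgebra.mapDomain_single, AddMonoidAlgebra.single_mul_single, add_comm]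
  -- The monomial of `w` is zero at the distinguished point because `w ∉ Z`, so the class of the
  -- monomial of `p` is nilpotent in the fiber.
  have hnil : ((1 : K) ⊗ₜ[AddMonoidAlgebra k S'] (AddMonoidAlgebra.single p (1 : k))) ^ n = 0 := by
    rw [Algebra.TensorProduct.tmul_pow, one_pow, AddMonoidAlgebra.single_pow, one_pow, hp,
      ← one_mul (1 : k), ← hsmul, TensorProduct.tmul_smul, TensorProduct.smul_tmul',
      Algebra.smul_def]
    have : algebraMap (AddMonoidAlgebra k S') K (AddMonoidAlgebra.single w 1) = 0 := by
      apply θ.injective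
      rw [hθ, faceEval_single, if_neg hw, map_zero]
    rw [this, zero_mul, TensorProduct.zero_tmul]
  have hzero : (1 : K) ⊗ₜ[AddMonoidAlgebra k S'] (AddMonoidAlgebra.single p (1 : k)) = 0 :=
    hred.eq_zero _ ⟨n, hnil⟩
  -- the functional reading off the coefficients in `p + φ Z`
  let l : AddMonoidAlgebra k S →+ k :=
    (Finsupp.liftAddHom fun p₁ : S =>
      if ∃ z ∈ Z, p₁ = p + φ z then AddMonoidHom.id k else 0).comp
      AddMonoidAlgebra.coeffAddEquiv.toAddMonoidHom
  have hl : ∀ p₁ r, l (AddMonoidAlgebra.single p₁ r) = if ∃ z ∈ Z, p₁ = p + φ z then r else 0 := by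
    intro p₁ r
    change Finsupp.liftAddHom _ (Finsupp.single p₁ r) = _
    rw [Finsupp.liftAddHom_apply_single]
    split_ifs <;> rfl
  -- Multiplication by a monomial in `Z` permutes the coset `p + φ Z`. A monomial outside `Z` cannot
  -- move anything into it, since `p` would then be divisible by an element outside `Z`, against
  -- `hno`.
  have hlsmul : ∀ (a : AddMonoidAlgebra k S') (x : AddMonoidAlgebra k S),
      l (a • x) = faceEval k Z hZ a * l x := by
    intro a x
    induction a using AddMonoidAlgebra.induction_linear with
    | zero => rw [zero_smul, map_zero, map_zero, zero_mul]
    | add a b ha hb => rw [add_smul, map_add, ha, hb, map_add, add_mul]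
    | single w₁ r =>
      induction x using AddMonoidAlgebra.induction_linear with
      | zero => rw [smul_zero, map_zero, mul_zero]
      | add x y hx hy => rw [smul_add, map_add, hx, hy, map_add, mul_add]
      | single p₁ r' =>
        rw [hsmul, hl, hl, faceEval_single]
        by_cases hw₁ : w₁ ∈ Z
        · obtain ⟨w₂, hw₂, hw₁₂⟩ := hZneg w₁ hw₁
          have : (∃ z ∈ Z, p₁ + φ w₁ = p + φ z) ↔ ∃ z ∈ Z, p₁ = p + φ z := by
            constructor
            · rintro ⟨z, hz, h⟩
              refine ⟨z + w₂, Z.add_mem hz hw₂, ?_⟩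
              rw [map_add, ← add_assoc, ← h, add_assoc, ← map_add, hw₁₂, map_zero, add_zero]
            · rintro ⟨z, hz, rfl⟩
              exact ⟨z + w₁, Z.add_mem hz hw₁, by rw [map_add, add_assoc]⟩
          rw [if_pos hw₁, if_congr this rfl rfl, mul_ite, mul_zero]
        · rw [if_neg hw₁, zero_mul, if_neg]
          rintro ⟨z, hz, h⟩
          obtain ⟨z', hz', hzz'⟩ := hZneg z hz
          refine hno (w₁ + z') (fun h' => hw₁ (hZ _ _ h')) p₁ ?_
          rw [map_add, ← add_assoc, h, add_assoc, ← map_add, hzz', map_zero, add_zero]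
  -- By semilinearity `l` descends to the fiber, where it takes the value `1` on the class of `p`;
  -- so this class is not zero.
  have h1 := congrArg (TensorProduct.liftAddHom
    ((AddMonoidHom.mul (R := k)).compl₂ l |>.comp θ.toAddMonoidHom) (fun a s x => by
      change θ (a • s) * l x = θ s * l (a • x)
      rw [hlsmul, Algebra.smul_def, map_mul, hθ]
      ring)) hzero
  rw [map_zero, TensorProduct.liftAddHom_tmul] at h1
  change θ 1 * l _ = 0 at h1
  rw [map_one, one_mul, hl, if_pos ⟨0, Z.zero_mem, by rw [map_zero, add_zero]⟩] at h1
  exact one_ne_zero h1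

end MonoidAlgebra

/-! ### Lifting of lattice points versus freeness and reducedness -/

section CellMapAlgebra

open scoped TensorProduct

variable {V V' : Type} [AddCommGroup V] [Module ℝ V] [AddCommGroup V'] [Module ℝ V']

/-- The units `σ^⊥ ∩ M` of the semigroup `S_σ`. -/
def perpMonoid (N : AddSubgroup V) (σ : PointedCone ℝ V) : AddSubmonoid (dualMonoid N σ) where
  carrier := {w | ∀ x ∈ σ, w.1 x = 0}
  zero_mem' := fun _ _ => rfl
  add_mem' := fun {a b} ha hb x hx => by
    change a.1 x + b.1 x = 0
    rw [ha x hx, hb x hx, add_zero]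

lemma mem_perpMonoid_of_add_mem {N : AddSubgroup V} {σ : PointedCone ℝ V}
    (w w' : dualMonoid N σ) (h : w + w' ∈ perpMonoid N σ) : w ∈ perpMonoid N σ := by
  intro x hx
  have h1 : w.1 x + w'.1 x = 0 := h x hx
  have h2 := w.2.2 x hx
  have h3 := w'.2.2 x hx
  linarith

lemma exists_add_eq_zero_of_mem_perpMonoid {N : AddSubgroup V} {σ : PointedCone ℝ V}
    (w : dualMonoid N σ) (h : w ∈ perpMonoid N σ) : ∃ w' ∈ perpMonoid N σ, w + w' = 0 := by
  refine ⟨⟨-w.1, (dualLattice N).neg_mem w.2.1, fun x hx => ?_⟩, fun x hx => ?_, ?_⟩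
  · rw [LinearMap.neg_apply, h x hx, neg_zero]
  · change -w.1 x = 0
    rw [h x hx, neg_zero]
  · exact Subtype.ext (add_neg_cancel w.1)

/-- Restriction of the forms in `S_σ` to the kernel of `q`. -/
def restrictKer (N : AddSubgroup V) (σ : PointedCone ℝ V) (q : V →ₗ[ℝ] V') :
    dualMonoid N σ →+ Module.Dual ℝ (LinearMap.ker q) where
  toFun p := p.1.comp (LinearMap.ker q).subtype
  map_zero' := rfl
  map_add' _ _ := rfl

namespace IsCellMap

variable {N : AddSubgroup V} {N' : AddSubgroup V'} {q : V →ₗ[ℝ] V'} {c : V → PointedCone ℝ V}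
  {c' : V' → PointedCone ℝ V'} (H : IsCellMap N N' q c c')

include H

/-- If all lattice points of the cells lift, then `S_(c v)` is a free module over `S_(c' (q v))`,
in the sense that every element is uniquely the sum of a reduced form and an element of
`S_(c' (q v))`. -/
lemma exists_free_generators
    (hlift : ∀ v, ∀ y ∈ c' (q v), y ∈ N' → ∃ x ∈ c v, x ∈ N ∧ q x = y) (v : V)
    (hle : ∀ x ∈ c v, q x ∈ c' (q v)) :
    ∃ E : Set (dualMonoid N (c v)),
      (∀ p, ∃ e ∈ E, ∃ w, p = e + dualMap q H.map_lattice hle w) ∧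
      (∀ e ∈ E, ∀ e' ∈ E, ∀ w w', e + dualMap q H.map_lattice hle w =
        e' + dualMap q H.map_lattice hle w' → e = e' ∧ w = w') ∧
      Set.InjOn (restrictKer N (c v) q) E ∧
      ∀ e ∈ E, ∀ e' ∈ E, ∀ w, e + e = e' + dualMap q H.map_lattice hle w → IsAddUnit w := by
  set φ := dualMap q H.map_lattice hle
  have hφ : ∀ w x, (φ w).1 x = w.1 (q x) := fun _ _ => rfl
  have hdegφ : ∀ w, restrictKer N (c v) q (φ w) = 0 := by
    intro w
    ext x
    change w.1 (q x) = 0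
    rw [LinearMap.mem_ker.1 x.2, map_zero]
  -- One reduced form is fixed for each restriction to the kernel. A choice is necessary: reduced
  -- forms with the same restriction may differ by units of the target monoid.
  have hex : ∀ g : Set.range (restrictKer N (c v) q), ∃ e : dualMonoid N (c v),
      restrictKer N (c v) q e = g ∧ ∀ y ∈ c' (q v), ∃ x ∈ c v, q x = y ∧ e.1 x = 0 := by
    rintro ⟨_, p, rfl⟩
    obtain ⟨p₀, hp₀, u, hu, hred⟩ := H.exists_reduced_form hlift p.2
    refine ⟨⟨p₀, hp₀⟩, ?_, hred⟩
    ext x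
    change p₀ x = p.1 x
    rw [hu, LinearMap.add_apply, LinearMap.comp_apply, LinearMap.mem_ker.1 x.2, map_zero, add_zero]
  choose e he hred using hex
  have hinj : Set.InjOn (restrictKer N (c v) q) (Set.range e) := by
    rintro _ ⟨g, rfl⟩ _ ⟨g', rfl⟩ h
    rw [he, he] at h
    rw [Subtype.ext h]
  refine ⟨Set.range e, fun p => ?_, ?_, hinj, ?_⟩
  · have h1 := he ⟨_, p, rfl⟩
    obtain ⟨u, hu, hpu⟩ := H.exists_eq_add_comp p.2 (e ⟨_, p, rfl⟩).2 (hred _) fun x hx =>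
      (LinearMap.congr_fun h1 ⟨x, hx⟩).symm
    exact ⟨_, ⟨_, rfl⟩, ⟨u, hu⟩, Subtype.ext hpu⟩
  · intro e₁ he₁ e₂ he₂ w w' h
    have h1 : e₁ = e₂ := by
      refine hinj he₁ he₂ ?_
      have := congrArg (restrictKer N (c v) q) h
      rwa [map_add, map_add, hdegφ, hdegφ, add_zero, add_zero] at this
    refine ⟨h1, Subtype.ext (LinearMap.ext fun y => ?_)⟩
    obtain ⟨x, rfl⟩ := H.surjective y
    rw [h1] at h
    exact add_left_cancel (LinearMap.congr_fun (congrArg Subtype.val h) x)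
  · rintro _ ⟨g, rfl⟩ _ ⟨g', rfl⟩ w h
    -- Over `y` the reduced form `e g` vanishes at some `x`, so the non-negative numbers `e' x` and
    -- `w y` have sum zero.
    have hw : w ∈ perpMonoid N' (c' (q v)) := by
      intro y hy
      obtain ⟨x, hx, rfl, hx0⟩ := hred g y hy
      have h1 : (e g).1 x + (e g).1 x = (e g').1 x + w.1 (q x) :=
        LinearMap.congr_fun (congrArg Subtype.val h) x
      have h2 := (e g').2.2 x hx
      have h3 := w.2.2 _ hy
      rw [hx0, add_zero] at h1
      linarith
    obtain ⟨w', -, hw'⟩ := exists_add_eq_zero_of_mem_perpMonoid w hw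
    exact IsAddUnit.of_add_eq_zero _ hw'

theorem flat_mapDomainRingHom
    (hlift : ∀ v, ∀ y ∈ c' (q v), y ∈ N' → ∃ x ∈ c v, x ∈ N ∧ q x = y)
    (k : Type u) [Field k] (v : V) (hle : ∀ x ∈ c v, q x ∈ c' (q v)) :
    (AddMonoidAlgebra.mapDomainRingHom k (dualMap q H.map_lattice hle)).Flat := by
  algebraize [AddMonoidAlgebra.mapDomainRingHom k (dualMap q H.map_lattice hle)]
  obtain ⟨E, hE, huniq, -⟩ := H.exists_free_generators hlift v hle
  obtain ⟨b, -⟩ := exists_basis_of_existsUnique_add (k := k) rfl hE huniq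
  have := Module.Free.of_basis b
  exact RingHom.flat_algebraMap_iff.2 inferInstance

theorem isReduced_tensorProduct
    (hlift : ∀ v, ∀ y ∈ c' (q v), y ∈ N' → ∃ x ∈ c v, x ∈ N ∧ q x = y)
    (k : Type u) [Field k] (v : V) (hle : ∀ x ∈ c v, q x ∈ c' (q v))
    [Algebra (AddMonoidAlgebra k (dualMonoid N' (c' (q v))))
      (AddMonoidAlgebra k (dualMonoid N (c v)))]
    (halg : algebraMap (AddMonoidAlgebra k (dualMonoid N' (c' (q v))))
      (AddMonoidAlgebra k (dualMonoid N (c v))) =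
        AddMonoidAlgebra.mapDomainRingHom k (dualMap q H.map_lattice hle))
    (K : Type*) [Field K] [Algebra (AddMonoidAlgebra k (dualMonoid N' (c' (q v)))) K] :
    _root_.IsReduced (K ⊗[AddMonoidAlgebra k (dualMonoid N' (c' (q v)))]
      AddMonoidAlgebra k (dualMonoid N (c v))) := by
  obtain ⟨E, hE, huniq, hinj, hsq⟩ := H.exists_free_generators hlift v hle
  -- The rational vector space structure supplies `UniqueSums` on the group of degrees.
  let : Module ℚ (Module.Dual ℝ (LinearMap.ker q)) := Module.compHom _ (algebraMap ℚ ℝ)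
  refine isReduced_tensorProduct_of_existsUnique_add halg hE huniq (restrictKer N (c v) q)
    (fun w => ?_) hinj hsq K
  ext x
  change w.1 (q x) = 0
  rw [LinearMap.mem_ker.1 x.2, map_zero]

/-- Minimal lifts of lattice points are lattice points if all forms are divisible by forms from the
target as soon as one of their multiples is. -/
theorem exists_lattice_lift (hfin : (Set.range c).Finite)
    (hsc : ∀ v, ∀ x ∈ c v, -x ∈ c v → x = 0)
    (hdiv : ∀ v (hle : ∀ x ∈ c v, q x ∈ c' (q v)) (p p' : dualMonoid N (c v))
      (w : dualMonoid N' (c' (q v))) (n : ℕ), w ∉ perpMonoid N' (c' (q v)) →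
      n • p = p' + dualMap q H.map_lattice hle w → ∃ w' ∉ perpMonoid N' (c' (q v)), ∃ p'',
        p = p'' + dualMap q H.map_lattice hle w')
    (v : V) (y : V') (hy : y ∈ c' (q v)) (hyN : y ∈ N') : ∃ x ∈ c v, x ∈ N ∧ q x = y := by
  obtain ⟨a, ⟨hav, hay⟩, hmin⟩ := exists_minimal_lift hfin (S := {a | a ∈ c v ∧ q a = y})
    (H.exists_mem hy)
  refine ⟨a, hav, ?_, hay⟩
  have hle : ∀ x ∈ c a, q x ∈ c' (q a) := fun x hx => H.map_mem hx
  -- Descent on the value `p a`: splitting off a pulled back form lowers it by a positive integer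
  -- while keeping it non-negative.
  have key : ∀ (K : ℕ) (p : dualMonoid N (c a)), p.1 a < K → ∃ m : ℤ, p.1 a = m := by
    intro K
    induction K with
    | zero =>
      intro p hp
      have := p.2.2 a (H.cells.self_mem a)
      rw [Nat.cast_zero] at hp
      linarith
    | succ K ih =>
      intro p hp
      by_cases hpa : p.1 a = 0
      · exact ⟨0, by rw [hpa, Int.cast_zero]⟩
      obtain ⟨z, hz, hcz⟩ := H.exists_cell_of_form p.2
      -- If the zero face of `p` mapped onto `c' (q a)`, it would contain a lift of `y`. By
      -- minimality that lift would have the same cell as `a`, forcing `p a = 0`.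
      have hne : c' (q z) ≠ c' (q a) := by
        intro h
        obtain ⟨x, hx, hxa⟩ := H.exists_mem (v := z) (y := q a) (h ▸ H.cells'.self_mem _)
        have hxa' : x ∈ c a := H.cells.le_of_mem hz hx
        have h1 := hmin x ⟨H.cells.le_of_mem hav hxa', hxa.trans hay⟩ (H.cells.le_of_mem hxa')
        exact hpa ((hcz a).1 (H.cells.le_of_mem hx (h1 (H.cells.self_mem a)))).2
      obtain ⟨w, hw, hwz, y', hy', hwy'⟩ := H.exists_form_of_ne hz hne
      have hneg : -w.comp q ∈ dualMonoid N (c z) := by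
        refine ⟨(dualLattice N).neg_mem fun x hx => hw.1 _ (H.map_lattice x hx), fun x hx => ?_⟩
        rw [LinearMap.neg_apply, LinearMap.comp_apply, ((hwz _).1 (H.map_mem hx)).2, neg_zero]
      -- The form `w` vanishes on the image of the zero face of `p`, so `n • p - w ∘ q` is
      -- non-negative for some `n`: a multiple of `p` is divisible by `w`.
      obtain ⟨n, hn⟩ := exists_add_nsmul_mem (H.rational a) p.2 hcz hneg
      obtain ⟨w', hw', p'', hp''⟩ := hdiv a hle p ⟨_, hn⟩ ⟨w, hw⟩ n (fun h => hwy' (h _ hy'))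
        (Subtype.ext (LinearMap.ext fun x => by
          change n • p.1 x = -w (q x) + n • p.1 x + w (q x)
          ring))
      have hval : p.1 a = p''.1 a + w'.1 (q a) := LinearMap.congr_fun (congrArg Subtype.val hp'') a
      obtain ⟨m, hm⟩ := w'.2.1 (q a) (hay ▸ hyN)
      -- `q a` is interior to its cell, so a form of the dual monoid vanishing there vanishes on the
      -- whole cell.
      have hm0 : w'.1 (q a) ≠ 0 := fun h => hw' fun x hx =>
        H.cells'.le_of_face w'.2.2 (H.cells'.self_mem _) h hx
      have hm1 : (1 : ℝ) ≤ m := by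
        have h1 := w'.2.2 _ (H.cells'.self_mem (q a))
        rw [hm] at h1 hm0
        have h2 : 0 ≤ m := by exact_mod_cast h1
        have h3 : m ≠ 0 := by exact_mod_cast hm0
        exact_mod_cast (show 1 ≤ m by omega)
      push_cast at hp
      obtain ⟨m', hm'⟩ := ih p'' (by linarith)
      exact ⟨m' + m, by rw [hval, hm', hm, Int.cast_add]⟩
  have key' : ∀ p ∈ dualMonoid N (c a), ∃ m : ℤ, p a = m := fun p hp => by
    obtain ⟨K, hK⟩ := exists_nat_gt (p a)
    exact key K ⟨p, hp⟩ hK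
  refine H.isFullLattice.mem_of_forall fun w hw => ?_
  -- By strong convexity the origin is a face, cut out by some `p`. Every integral form becomes
  -- non-negative on `c a` after adding a multiple of `p`, so it too is integral at `a`.
  obtain ⟨p, hp, hp0⟩ := (H.rational a).isFace_of_extremal H.isFullLattice (ρ := ⊥) bot_le
    fun x hx y hy h => (Submodule.mem_bot _).2 (hsc a x hx (by
      rwa [← eq_neg_of_add_eq_zero_right ((Submodule.mem_bot _).1 h)]))
  obtain ⟨n, hn⟩ := exists_add_nsmul_mem (H.rational a) hp hp0 (a := w) ⟨hw, fun x hx => by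
    rw [(Submodule.mem_bot _).1 hx, map_zero]⟩
  obtain ⟨m, hm⟩ := key' _ hn
  obtain ⟨m', hm'⟩ := key' _ hp
  refine ⟨m - n * m', ?_⟩
  rw [LinearMap.add_apply, LinearMap.smul_apply, hm', nsmul_eq_mul] at hm
  push_cast
  linarith

end IsCellMap

end CellMapAlgebra

/-! ### Flatness and fibers of toric morphisms in charts -/

section Fibers

open scoped TensorProduct

lemma isReduced_iff_of_iso {X Y : Scheme.{u}} (e : X ≅ Y) : IsReduced X ↔ IsReduced Y :=
  ⟨fun _ => isReduced_of_isOpenImmersion e.inv, fun _ => isReduced_of_isOpenImmersion e.hom⟩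

lemma isReduced_pullback_Spec_iff {A B K : Type u} [CommRing A] [CommRing B] [Field K]
    [Algebra A B] [Algebra A K] {Y : Scheme.{u}} (ι : Spec (.of A) ⟶ Y) [Mono ι] :
    IsReduced (pullback (Spec.map (CommRingCat.ofHom (algebraMap A B)) ≫ ι)
      (Spec.map (CommRingCat.ofHom (algebraMap A K)) ≫ ι)) ↔ _root_.IsReduced (K ⊗[A] B) := by
  have e₁ := (limit.isLimit _).conePointUniqueUpToIso (pullbackIsPullbackOfCompMono
    (Spec.map (CommRingCat.ofHom (algebraMap A B)))
    (Spec.map (CommRingCat.ofHom (algebraMap A K))) ι)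
  have e₂ := pullbackSymmetry (Spec.map (CommRingCat.ofHom (algebraMap A B)))
    (Spec.map (CommRingCat.ofHom (algebraMap A K))) ≪≫ pullbackSpecIso A K B
  exact (isReduced_iff_of_iso e₁).trans ((isReduced_iff_of_iso e₂).trans (affine_isReduced_iff _))

lemma isReduced_of_isEmpty (X : Scheme.{u}) [IsEmpty X] : IsReduced X :=
  have : ∀ x : X, _root_.IsReduced (X.presheaf.stalk x) := fun x => isEmptyElim x
  isReduced_of_isReduced_stalk X

variable {V V' : Type} [AddCommGroup V] [Module ℝ V] [AddCommGroup V'] [Module ℝ V']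
  {N : AddSubgroup V} {Sig : Set (PointedCone ℝ V)} {N' : AddSubgroup V'}
  {Sig' : Set (PointedCone ℝ V')} {φ : V →ₗ[ℝ] V'} (k : Type u) [Field k]

/-- The charts `U_σ` form an open cover of the toric variety. -/
def chartCover (h : IsFan N Sig) : (toricVariety k h).OpenCover :=
  haveI := h.isLocallyDirected k
  haveI : ∀ {i j : Sig} (f : i ⟶ j), IsOpenImmersion ((chartDiagram k N Sig).map f) :=
    fun f => h.isOpenImmersion k f
  haveI : Small.{u} Sig := by
    have := h.finite.to_subtype
    infer_instance
  Scheme.IsLocallyDirected.openCover (chartDiagram k N Sig)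

lemma isOpenImmersion_chart (h : IsFan N Sig) {σ : PointedCone ℝ V} (hσ : σ ∈ Sig) :
    IsOpenImmersion (chart k h hσ) :=
  (chartCover k h).map_prop ⟨σ, hσ⟩

theorem flat_toricMorphism (h : IsFan N Sig) (h' : IsFan N' Sig')
    (hφ : IsFanMap N Sig N' Sig' φ)
    (H : ∀ σ ∈ Sig, ∃ σ' ∈ Sig', ∃ hle : ∀ x ∈ σ, φ x ∈ σ',
      (AddMonoidAlgebra.mapDomainRingHom k (dualMap φ hφ.map_lattice hle)).Flat) :
    Flat (toricMorphism k h h' hφ) := by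
  have : IsZariskiLocalAtSource (@Flat.{u}) := HasRingHomProperty.instIsZariskiLocalAtSource
  refine IsZariskiLocalAtSource.of_openCover (P := @Flat) (chartCover k h) ?_
  rintro ⟨σ, hσ⟩
  obtain ⟨σ', hσ', hle, hflat⟩ := H σ hσ
  change Flat (chart k h hσ ≫ toricMorphism k h h' hφ)
  rw [chart_toricMorphism k h h' hφ hσ hσ' hle]
  have h1 : Flat (affineMap k φ hφ.map_lattice hle) := Flat.SpecMap_iff.2 hflat
  have h2 := isOpenImmersion_chart k h' hσ'
  infer_instance

/-- Base change to `Spec κ(y)` of the chart cover of the source is an open cover of the fiber, and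
reducedness is local. -/
lemma isReduced_fiber_toricMorphism_iff (h : IsFan N Sig) (h' : IsFan N' Sig')
    (hφ : IsFanMap N Sig N' Sig' φ) (y : toricVariety k h') :
    IsReduced (Scheme.Hom.fiber (toricMorphism k h h' hφ) y) ↔ ∀ σ (hσ : σ ∈ Sig),
      IsReduced (pullback (chart k h hσ ≫ toricMorphism k h h' hφ)
        ((toricVariety k h').fromSpecResidueField y)) := by
  have := IsReduced.iff_of_openCover _ (Scheme.Pullback.openCoverOfLeft (chartCover k h)
    (toricMorphism k h h' hφ) ((toricVariety k h').fromSpecResidueField y))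
  exact this.trans ⟨fun H σ hσ => H ⟨σ, hσ⟩, fun H σ => H σ.1 σ.2⟩

/-- A chart of the target containing the point `y` contains `Spec κ(y)`. -/
lemma exists_algebraMap_comp_chart (h' : IsFan N' Sig') {σ' : PointedCone ℝ V'} (hσ' : σ' ∈ Sig')
    (y : toricVariety k h') (hy : y ∈ Set.range (chart k h' hσ')) :
    ∃ ψ : AddMonoidAlgebra k (dualMonoid N' σ') →+* (toricVariety k h').residueField y,
      Spec.map (CommRingCat.ofHom ψ) ≫ chart k h' hσ' =
        (toricVariety k h').fromSpecResidueField y := by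
  have := isOpenImmersion_chart k h' hσ'
  have hrange : Set.range ((toricVariety k h').fromSpecResidueField y) ⊆
      Set.range (chart k h' hσ') := by
    rw [Scheme.range_fromSpecResidueField]
    exact Set.singleton_subset_iff.2 hy
  refine ⟨(Spec.preimage (IsOpenImmersion.lift (chart k h' hσ')
    ((toricVariety k h').fromSpecResidueField y) hrange)).hom, ?_⟩
  rw [CommRingCat.ofHom_hom, Spec.map_preimage, IsOpenImmersion.lift_fac]

theorem isReduced_fiber_toricMorphism (h : IsFan N Sig) (h' : IsFan N' Sig')
    (hφ : IsFanMap N Sig N' Sig' φ)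
    (H : ∀ σ ∈ Sig, ∃ σ' ∈ Sig', ∃ hle : ∀ x ∈ σ, φ x ∈ σ',
      ∀ [Algebra (AddMonoidAlgebra k (dualMonoid N' σ')) (AddMonoidAlgebra k (dualMonoid N σ))],
        algebraMap (AddMonoidAlgebra k (dualMonoid N' σ')) (AddMonoidAlgebra k (dualMonoid N σ)) =
          AddMonoidAlgebra.mapDomainRingHom k (dualMap φ hφ.map_lattice hle) →
        ∀ (K : Type u) [Field K] [Algebra (AddMonoidAlgebra k (dualMonoid N' σ')) K],
          _root_.IsReduced (K ⊗[AddMonoidAlgebra k (dualMonoid N' σ')]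
            AddMonoidAlgebra k (dualMonoid N σ))) (y : toricVariety k h') :
    IsReduced (Scheme.Hom.fiber (toricMorphism k h h' hφ) y) := by
  rw [isReduced_fiber_toricMorphism_iff]
  intro σ hσ
  obtain ⟨σ', hσ', hle, hred⟩ := H σ hσ
  rw [chart_toricMorphism k h h' hφ hσ hσ' hle]
  by_cases hy : y ∈ Set.range (chart k h' hσ')
  · obtain ⟨ψ, hψ⟩ := exists_algebraMap_comp_chart k h' hσ' y hy
    let := (AddMonoidAlgebra.mapDomainRingHom k (dualMap φ hφ.map_lattice hle)).toAlgebra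
    let := ψ.toAlgebra
    have := isOpenImmersion_chart k h' hσ'
    rw [← hψ]
    exact (isReduced_pullback_Spec_iff (chart k h' hσ')).2
      (hred rfl ((toricVariety k h').residueField y))
  -- If `y` is not in the target chart, this piece of the fiber is empty.
  · have : IsEmpty ↥(pullback (affineMap k φ hφ.map_lattice hle ≫ chart k h' hσ')
        ((toricVariety k h').fromSpecResidueField y)) := by
      refine ⟨fun x => hy ?_⟩
      have h1 := congrArg (fun f : _ ⟶ toricVariety k h' => f x)
        (pullback.condition (f := affineMap k φ hφ.map_lattice hle ≫ chart k h' hσ')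
          (g := (toricVariety k h').fromSpecResidueField y))
      simp only [Scheme.Hom.comp_apply, Scheme.fromSpecResidueField_apply] at h1
      exact ⟨_, h1⟩
    exact isReduced_of_isEmpty _

/-- The homomorphism `ε` is a point of the chart with values in `k`. It factors through the residue
field `K` of its image, which gives `θ`; so the fiber hypothesis can be used without identifying `K`
with `k`. -/
theorem exists_isReduced_tensorProduct_of_fiber (h : IsFan N Sig) (h' : IsFan N' Sig')
    (hφ : IsFanMap N Sig N' Sig' φ)
    (H : ∀ y, IsReduced (Scheme.Hom.fiber (toricMorphism k h h' hφ) y))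
    {σ : PointedCone ℝ V} (hσ : σ ∈ Sig) {σ' : PointedCone ℝ V'} (hσ' : σ' ∈ Sig')
    (hle : ∀ x ∈ σ, φ x ∈ σ')
    [Algebra (AddMonoidAlgebra k (dualMonoid N' σ')) (AddMonoidAlgebra k (dualMonoid N σ))]
    (halg : algebraMap (AddMonoidAlgebra k (dualMonoid N' σ'))
      (AddMonoidAlgebra k (dualMonoid N σ)) =
        AddMonoidAlgebra.mapDomainRingHom k (dualMap φ hφ.map_lattice hle))
    (ε : AddMonoidAlgebra k (dualMonoid N' σ') →+* k) :
    ∃ (K : Type u) (_ : Field K) (_ : Algebra (AddMonoidAlgebra k (dualMonoid N' σ')) K)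
      (θ : K →+* k), (∀ a, θ (algebraMap (AddMonoidAlgebra k (dualMonoid N' σ')) K a) = ε a) ∧
        _root_.IsReduced (K ⊗[AddMonoidAlgebra k (dualMonoid N' σ')]
          AddMonoidAlgebra k (dualMonoid N σ)) := by
  have := isOpenImmersion_chart k h' hσ'
  obtain ⟨⟨y, δ⟩, hy⟩ := (Scheme.SpecToEquivOfField k (toricVariety k h')).symm.surjective
    (Spec.map (CommRingCat.ofHom ε) ≫ chart k h' hσ')
  replace hy : Spec.map δ ≫ (toricVariety k h').fromSpecResidueField y =
    Spec.map (CommRingCat.ofHom ε) ≫ chart k h' hσ' := hy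
  have hyr : y ∈ Set.range (chart k h' hσ') := by
    let x : Spec (.of k) := Nonempty.some inferInstance
    have h1 := congrArg (fun f : _ ⟶ toricVariety k h' => f x) hy
    simp only [Scheme.Hom.comp_apply, Scheme.fromSpecResidueField_apply] at h1
    exact ⟨_, h1.symm⟩
  obtain ⟨ψ, hψ⟩ := exists_algebraMap_comp_chart k h' hσ' y hyr
  let := ψ.toAlgebra
  refine ⟨(toricVariety k h').residueField y, inferInstance, ψ.toAlgebra, δ.hom, fun a => ?_, ?_⟩
  · have h1 : Spec.map (CommRingCat.ofHom ψ ≫ δ) = Spec.map (CommRingCat.ofHom ε) := by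
      refine (cancel_mono (chart k h' hσ')).1 (Eq.trans ?_ hy)
      exact (congrArg (· ≫ chart k h' hσ') (Spec.map_comp _ _)).trans
        ((Category.assoc _ _ _).trans (congrArg (Spec.map δ ≫ ·) hψ))
    exact RingHom.congr_fun (congrArg CommRingCat.Hom.hom (Spec.map_injective h1)) a
  · have h1 := (isReduced_fiber_toricMorphism_iff k h h' hφ y).1 (H y) σ hσ
    rw [chart_toricMorphism k h h' hφ hσ hσ' hle, ← hψ, affineMap, ← halg] at h1
    exact (isReduced_pullback_Spec_iff (chart k h' hσ')).1 h1

end Fibers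

/-! ### The lattices -/

/-- The inclusion of `(ℤ^d)^m` in `(ℝ^d)^m`. -/
def castHom (d m : ℕ) : (Fin m → Fin d → ℤ) →+ (Fin m → Fin d → ℝ) where
  toFun z i j := (z i j : ℝ)
  map_zero' := by ext; simp
  map_add' _ _ := by ext; simp

lemma castHom_mem (d m : ℕ) (z : Fin m → Fin d → ℤ) : castHom d m z ∈ lattice d m := ⟨z, rfl⟩

lemma range_castHom (d m : ℕ) : (castHom d m).range = lattice d m := by
  ext v
  constructor
  · rintro ⟨z, rfl⟩
    exact castHom_mem d m z
  · rintro ⟨z, rfl⟩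
    exact ⟨z, rfl⟩

lemma sum_smul_single (d m : ℕ) (v : Fin m → Fin d → ℝ) :
    ∑ i, ∑ j, v i j • castHom d m (Pi.single i (Pi.single j 1)) = v := by
  ext i j
  simp only [Finset.sum_apply, Pi.smul_apply, smul_eq_mul]
  rw [Finset.sum_eq_single i, Finset.sum_eq_single j]
  · simp [castHom]
  · intro b _ hb
    simp [castHom, hb.symm]
  · simp
  · intro b _ hb
    refine Finset.sum_eq_zero fun c _ => ?_
    simp [castHom, hb.symm]
  · simp

lemma isFullLattice_lattice (d m : ℕ) : IsFullLattice (lattice d m) where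
  fg := by
    rw [← range_castHom, ← AddGroup.fg_iff_addSubgroup_fg]
    have : AddGroup.FG (Fin m → Fin d → ℤ) := Module.Finite.iff_addGroup_fg.1 inferInstance
    exact AddGroup.fg_range _
  span_eq := by
    refine Submodule.eq_top_iff'.2 fun v => ?_
    rw [← sum_smul_single d m v]
    exact Submodule.sum_mem _ fun i _ => Submodule.sum_mem _ fun j _ =>
      Submodule.smul_mem _ _ (Submodule.subset_span (castHom_mem d m _))
  extend φ := by
    let ψ : (Fin m → Fin d → ℤ) →+ ℤ :=
      φ.comp ((castHom d m).codRestrict (lattice d m) (castHom_mem d m))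
    refine ⟨∑ i, ∑ j, (ψ (Pi.single i (Pi.single j 1)) : ℝ) •
      ((LinearMap.proj j : (Fin d → ℝ) →ₗ[ℝ] ℝ).comp (LinearMap.proj i)), ?_⟩
    rintro ⟨_, z, rfl⟩
    have h : ψ z = ∑ i, ∑ j, z i j * ψ (Pi.single i (Pi.single j 1)) := by
      have hz : z = ∑ i, ∑ j, z i j • (Pi.single i (Pi.single j 1) : Fin m → Fin d → ℤ) := by
        ext i j
        simp only [Finset.sum_apply, Pi.smul_apply, smul_eq_mul]
        rw [Finset.sum_eq_single i, Finset.sum_eq_single j]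
        · simp
        · intro b _ hb
          simp [hb.symm]
        · simp
        · intro b _ hb
          refine Finset.sum_eq_zero fun c _ => ?_
          simp [hb.symm]
        · simp
      conv_lhs => rw [hz]
      simp only [map_sum, map_zsmul, smul_eq_mul]
    have h' : φ ⟨fun i j => (z i j : ℝ), ⟨z, rfl⟩⟩ = ψ z := rfl
    rw [h', h]
    simp only [LinearMap.sum_apply, LinearMap.smul_apply, LinearMap.comp_apply,
      LinearMap.proj_apply, smul_eq_mul]
    push_cast
    exact Finset.sum_congr rfl fun i _ => Finset.sum_congr rfl fun j _ => mul_comm _ _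

/-- The image of a lattice under a surjection whose kernel is spanned by lattice vectors. -/
lemma IsFullLattice.map {V V' : Type} [AddCommGroup V] [Module ℝ V] [AddCommGroup V']
    [Module ℝ V'] {N : AddSubgroup V} (hN : IsFullLattice N) {q : V →ₗ[ℝ] V'}
    (hq : Function.Surjective q)
    (hker : LinearMap.ker q ≤ Submodule.span ℝ {x | x ∈ N ∧ q x = 0}) :
    IsFullLattice (N.map q.toAddMonoidHom) where
  fg := by
    rw [← AddGroup.fg_iff_addSubgroup_fg]
    have := (AddGroup.fg_iff_addSubgroup_fg N).2 hN.fg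
    exact AddGroup.fg_of_surjective (f := q.toAddMonoidHom.addSubgroupMap N)
      (q.toAddMonoidHom.addSubgroupMap_surjective N)
  span_eq := by
    have : ((N.map q.toAddMonoidHom : AddSubgroup V') : Set V') = q '' N := rfl
    rw [this, Submodule.span_image, hN.span_eq, Submodule.map_top, LinearMap.range_eq_top.2 hq]
  extend φ := by
    obtain ⟨w, hw⟩ := hN.extend (φ.comp (q.toAddMonoidHom.addSubgroupMap N))
    obtain ⟨s, hs⟩ := q.exists_rightInverse_of_surjective (LinearMap.range_eq_top.2 hq)
    -- The extended form kills the lattice points of the kernel, which span it, so it descends along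
    -- any linear section of `q`.
    have hw0 : LinearMap.ker q ≤ LinearMap.ker w := by
      refine hker.trans (Submodule.span_le.2 ?_)
      rintro x ⟨hx, hx0⟩
      have h1 := hw ⟨x, hx⟩
      have h2 : q.toAddMonoidHom.addSubgroupMap N ⟨x, hx⟩ = 0 := Subtype.ext hx0
      rw [AddMonoidHom.comp_apply, h2, map_zero, Int.cast_zero] at h1
      exact h1
    refine ⟨w.comp s, ?_⟩
    rintro ⟨_, x, hx, rfl⟩
    have h1 : s (q x) - x ∈ LinearMap.ker q := by
      rw [LinearMap.mem_ker, map_sub, sub_eq_zero]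
      exact LinearMap.congr_fun hs (q x)
    have h2 := hw0 h1
    rw [LinearMap.mem_ker, map_sub, sub_eq_zero] at h2
    exact h2.trans (hw ⟨x, hx⟩)

lemma quotientMap_surjective (d m : ℕ) : Function.Surjective (quotientMap d m) :=
  Submodule.mkQ_surjective _

lemma mem_ker_quotientMap {d m : ℕ} {v : Fin m → Fin d → ℝ} :
    v ∈ LinearMap.ker (quotientMap d m) ↔ ∃ u, v = fun _ => u := by
  rw [quotientMap, Submodule.ker_mkQ, diagonal, LinearMap.mem_range]
  exact exists_congr fun u => eq_comm

lemma isFullLattice_quotientLattice (d m : ℕ) : IsFullLattice (quotientLattice d m) := by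
  refine (isFullLattice_lattice d m).map (quotientMap_surjective d m) fun v hv => ?_
  obtain ⟨u, rfl⟩ := mem_ker_quotientMap.1 hv
  have h : (fun _ => u : Fin m → Fin d → ℝ) =
      ∑ j, u j • castHom d m (fun _ => Pi.single j 1) := by
    ext i j
    simp only [Finset.sum_apply, Pi.smul_apply, smul_eq_mul]
    rw [Finset.sum_eq_single j]
    · simp [castHom]
    · intro b _ hb
      simp [castHom, hb.symm]
    · simp
  rw [h]
  refine Submodule.sum_mem _ fun j _ => Submodule.smul_mem _ _ (Submodule.subset_span
    ⟨castHom_mem d m _, mem_ker_quotientMap.2 ⟨fun l => ((Pi.single j 1 : Fin d → ℤ) l : ℝ), rfl⟩⟩)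

/-! ### Normal fans -/

section NormalFan

variable {d : ℕ} (A : Finset (Fin d → ℤ))

/-- The real points underlying `A`. -/
def realPoints : Set (Fin d → ℝ) := (fun a : Fin d → ℤ => fun j => (a j : ℝ)) '' (A : Set _)

/-- The linear form `⟨·, p⟩` of a point `p` of `A`. -/
def vertexForm (p : A) : Module.Dual ℝ (Fin d → ℝ) :=
  (dotProductBilin ℝ ℝ).flip fun j => (p.1 j : ℝ)

lemma vertexForm_apply (p : A) (v : Fin d → ℝ) : vertexForm A p v = v ⬝ᵥ fun j => (p.1 j : ℝ) :=
  rfl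

variable {A}

lemma le_dotProduct_of_mem_convexHull {c : ℝ} {v : Fin d → ℝ} (h : ∀ p, c ≤ vertexForm A p v)
    {x : Fin d → ℝ} (hx : x ∈ convexHull ℝ (realPoints A)) : c ≤ v ⬝ᵥ x := by
  have hconv : Convex ℝ {x | c ≤ v ⬝ᵥ x} :=
    convex_halfSpace_ge (dotProductBilin ℝ ℝ v : (Fin d → ℝ) →ₗ[ℝ] ℝ).isLinear c
  refine convexHull_min ?_ hconv hx
  rintro _ ⟨p, hp, rfl⟩
  exact h ⟨p, hp⟩

lemma mem_convexHull_realPoints (p : A) :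
    (fun j => (p.1 j : ℝ)) ∈ convexHull ℝ (realPoints A) :=
  subset_convexHull _ _ ⟨p.1, p.2, rfl⟩

/-- The face of `v` may contain points `x` outside `A`. If `p ∈ A` minimizes `v`, then it also
minimizes `v - ε • w`. Comparing the values at `p` and `x` gives `w ⬝ᵥ x ≤ w ⬝ᵥ p`, and `w` is
minimal at `p`. -/
lemma normalCone_eq_normalCell [Nonempty A] (v : Fin d → ℝ) :
    normalCone (convexHull ℝ (realPoints A))
      {x | x ∈ convexHull ℝ (realPoints A) ∧ ∀ y ∈ convexHull ℝ (realPoints A), v ⬝ᵥ x ≤ v ⬝ᵥ y} =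
    normalCell (vertexForm A) v := by
  ext w
  constructor
  · intro hw p hp p'
    exact hw _ ⟨mem_convexHull_realPoints p, fun y hy => le_dotProduct_of_mem_convexHull hp hy⟩ _
      (mem_convexHull_realPoints p')
  · rintro hw x ⟨hx, hxmin⟩ y hy
    obtain ⟨p, hp⟩ := Finite.exists_min fun p => vertexForm A p v
    obtain ⟨ε, hε, hεv⟩ := (isCellSystem_normalCell (vertexForm A)).interior hw
    have h1 := le_dotProduct_of_mem_convexHull (hεv p hp) hx
    have h2 := hxmin _ (mem_convexHull_realPoints p)
    have h3 := le_dotProduct_of_mem_convexHull (hw p hp) hy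
    rw [vertexForm_apply] at h1 h3
    rw [sub_dotProduct, sub_dotProduct, smul_dotProduct, smul_dotProduct, smul_eq_mul,
      smul_eq_mul] at h1
    nlinarith

lemma normalFan_eq_range [Nonempty A] :
    normalFan (convexHull ℝ (realPoints A)) = Set.range (normalCell (vertexForm A)) := by
  ext σ
  constructor
  · rintro ⟨F, hF, hexp, rfl⟩
    obtain ⟨l, rfl⟩ := hexp hF
    -- `IsExposed` describes faces as sets of maximizers, while the normal fan is the inner one;
    -- hence the sign.
    have hl : ∀ x, (fun j => -l (Pi.single j 1)) ⬝ᵥ x = -l x := by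
      intro x
      have h1 : l x = ∑ j, x j * l (Pi.single j 1) := by
        conv_lhs => rw [pi_eq_sum_univ' x]
        simp only [map_sum, map_smul, smul_eq_mul]
      rw [h1, dotProduct, ← Finset.sum_neg_distrib]
      exact Finset.sum_congr rfl fun j _ => by ring
    refine ⟨fun j => -l (Pi.single j 1), ?_⟩
    rw [← normalCone_eq_normalCell]
    simp only [hl, neg_le_neg_iff]
  · rintro ⟨v, rfl⟩
    obtain ⟨p, hp⟩ := Finite.exists_min fun p => vertexForm A p v
    refine ⟨{x | x ∈ convexHull ℝ (realPoints A) ∧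
        ∀ y ∈ convexHull ℝ (realPoints A), v ⬝ᵥ x ≤ v ⬝ᵥ y},
      ⟨_, mem_convexHull_realPoints p, fun y hy => le_dotProduct_of_mem_convexHull hp hy⟩,
      fun _ => ⟨LinearMap.toContinuousLinearMap (-(dotProductBilin ℝ ℝ v : (Fin d → ℝ) →ₗ[ℝ] ℝ)),
        ?_⟩, (normalCone_eq_normalCell v).symm⟩
    ext x
    refine and_congr_right fun _ => forall₂_congr fun y _ => ?_
    exact neg_le_neg_iff.symm

variable {m : ℕ}

variable (A m) in
/-- The linear form `∑ i, ⟨·, α i⟩` on `(ℝ^d)^m`. -/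
def productForm (α : Fin m → A) : Module.Dual ℝ (Fin m → Fin d → ℝ) :=
  ∑ i, (vertexForm A (α i)).comp (LinearMap.proj i)

lemma productForm_apply (α : Fin m → A) (v : Fin m → Fin d → ℝ) :
    productForm A m α v = ∑ i, vertexForm A (α i) (v i) := by
  simp [productForm, LinearMap.sum_apply]

lemma productForm_update_sub (α : Fin m → A) (i : Fin m) (p : A) (v : Fin m → Fin d → ℝ) :
    productForm A m (Function.update α i p) v - productForm A m α v =
      vertexForm A p (v i) - vertexForm A (α i) (v i) := by
  rw [productForm_apply, productForm_apply, ← Finset.sum_sub_distrib, Finset.sum_eq_single i]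
  · rw [Function.update_self]
  · intro j _ hj
    rw [Function.update_of_ne hj, sub_self]
  · simp

lemma forall_productForm_le_iff (α : Fin m → A) (v : Fin m → Fin d → ℝ) :
    (∀ β, productForm A m α v ≤ productForm A m β v) ↔
      ∀ i p, vertexForm A (α i) (v i) ≤ vertexForm A p (v i) := by
  constructor
  · intro h i p
    have h1 := h (Function.update α i p)
    have h2 := productForm_update_sub α i p v
    linarith
  · intro h β
    rw [productForm_apply, productForm_apply]
    exact Finset.sum_le_sum fun i _ => h i (β i)

/-- Minimizing a sum over independent choices decouples into the coordinates, so the product of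
normal fans comes from a single family of forms, that of $A^m$. -/
lemma normalCell_productForm [Nonempty A] (v : Fin m → Fin d → ℝ) :
    normalCell (productForm A m) v =
      Submodule.pi Set.univ fun i => normalCell (vertexForm A) (v i) := by
  ext x
  rw [mem_normalCell, Submodule.mem_pi]
  simp only [forall_productForm_le_iff]
  constructor
  · intro h i _ p hp
    -- To test one coordinate, the others are filled with minimizers.
    choose β hβ using fun i => Finite.exists_min fun p => vertexForm A p (v i)
    have h1 := h (Function.update β i p) (fun j => ?_) i
    · rwa [Function.update_self] at h1
    · rcases eq_or_ne j i with rfl | hj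
      · rwa [Function.update_self]
      · rw [Function.update_of_ne hj]
        exact hβ j
  · intro h α hα i
    exact h i trivial (α i) (hα i)

lemma productFan_eq_range [Nonempty A] (m : ℕ) :
    productFan (convexHull ℝ (realPoints A)) m = Set.range (normalCell (productForm A m)) := by
  ext τ
  rw [productFan, normalFan_eq_range]
  constructor
  · rintro ⟨σ, hσ, rfl⟩
    choose v hv using hσ
    exact ⟨v, by rw [normalCell_productForm, funext hv]⟩
  · rintro ⟨v, rfl⟩
    exact ⟨fun i => normalCell (vertexForm A) (v i), fun i => ⟨v i, rfl⟩,
      normalCell_productForm v⟩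

lemma productForm_mem_dualLattice (α : Fin m → A) :
    productForm A m α ∈ dualLattice (lattice d m) := by
  rintro _ ⟨z, rfl⟩
  refine ⟨∑ i, ∑ j, z i j * (α i).1 j, ?_⟩
  rw [productForm_apply]
  push_cast
  rfl

/-- Here full-dimensionality of the polytope enters: each `x i` is constant on `A`, hence on its
affine span, which is everything. Comparing a point of `A` with its translate by `x i` gives `x i ⬝ᵥ
x i = 0`. -/
lemma eq_zero_of_productForm_eq [Nonempty A]
    (hA : affineSpan ℝ (convexHull ℝ (realPoints A)) = ⊤) (x : Fin m → Fin d → ℝ)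
    (hx : ∀ α β, productForm A m α x = productForm A m β x) : x = 0 := by
  funext i
  obtain ⟨p₀⟩ := ‹Nonempty A›
  have h1 : ∀ p, vertexForm A p (x i) = vertexForm A p₀ (x i) := by
    intro p
    have h2 := productForm_update_sub (fun _ => p₀) i p x
    rw [hx _ (fun _ => p₀)] at h2
    linarith
  let f : (Fin d → ℝ) →ₗ[ℝ] ℝ := dotProductBilin ℝ ℝ (x i)
  let y₀ : Fin d → ℝ := fun j => (p₀.1 j : ℝ)
  have h2 : affineSpan ℝ (realPoints A) ≤ AffineSubspace.mk' y₀ (LinearMap.ker f) := by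
    rw [affineSpan_le]
    rintro _ ⟨p, hp, rfl⟩
    change _ ∈ AffineSubspace.mk' y₀ (LinearMap.ker f)
    rw [AffineSubspace.mem_mk', LinearMap.mem_ker, vsub_eq_sub, map_sub, sub_eq_zero]
    exact h1 ⟨p, hp⟩
  rw [affineSpan_convexHull] at hA
  rw [hA] at h2
  have h3 := h2 (AffineSubspace.mem_top ℝ _ (x i + y₀))
  rw [AffineSubspace.mem_mk', LinearMap.mem_ker, vsub_eq_sub, add_sub_cancel_right] at h3
  exact dotProduct_self_eq_zero.1 h3

end NormalFan

/-! ### Cell maps and toric morphisms -/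

section CellMap

variable {V V' : Type} [AddCommGroup V] [Module ℝ V] [AddCommGroup V'] [Module ℝ V']
  {N : AddSubgroup V} {N' : AddSubgroup V'} {q : V →ₗ[ℝ] V'} {c : V → PointedCone ℝ V}
  {c' : V' → PointedCone ℝ V'}

/-- The toric criterion in terms of lattice points. Lifts give free algebras with reduced fibers on
the charts `U_(c v) ⟶ U_(c' (q v))`. For the other direction the fiber is tested at the
distinguished point of the chart, where exactly the units of the dual monoid do not vanish. -/
theorem IsCellMap.flat_and_isReduced_fiber_iff (H : IsCellMap N N' q c c') (k : Type u) [Field k]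
    {Sig : Set (PointedCone ℝ V)} {Sig' : Set (PointedCone ℝ V')} (hSig : Sig = Set.range c)
    (hSig' : Sig' = Set.range c') (h : IsFan N Sig) (h' : IsFan N' Sig')
    (hq : IsFanMap N Sig N' Sig' q) :
    (Flat (toricMorphism k h h' hq) ∧
      ∀ y, IsReduced (Scheme.Hom.fiber (toricMorphism k h h' hq) y)) ↔
    ∀ v, ∀ y ∈ c' (q v), y ∈ N' → ∃ x ∈ c v, x ∈ N ∧ q x = y := by
  subst hSig hSig'
  constructor
  · rintro ⟨-, hred⟩
    refine H.exists_lattice_lift h.finite (fun v => h.stronglyConvex _ ⟨v, rfl⟩) ?_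
    intro v hle p p' w n hw hp
    algebraize [AddMonoidAlgebra.mapDomainRingHom k (dualMap q H.map_lattice hle)]
    obtain ⟨K, _, _, θ, hθ, hK⟩ := exists_isReduced_tensorProduct_of_fiber k h h' hq hred ⟨v, rfl⟩
      ⟨q v, rfl⟩ hle rfl
      (faceEval k (perpMonoid N' (c' (q v))) mem_perpMonoid_of_add_mem : _ →+* k)
    exact exists_eq_add_of_isReduced_tensorProduct rfl _ mem_perpMonoid_of_add_mem
      exists_add_eq_zero_of_mem_perpMonoid K θ hθ hK hw hp
  · intro hlift
    have hle : ∀ v, ∀ x ∈ c v, q x ∈ c' (q v) := fun v x hx => H.map_mem hx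
    constructor
    · refine flat_toricMorphism k h h' hq ?_
      rintro _ ⟨v, rfl⟩
      exact ⟨_, ⟨q v, rfl⟩, hle v, H.flat_mapDomainRingHom hlift k v (hle v)⟩
    · refine isReduced_fiber_toricMorphism k h h' hq ?_
      rintro _ ⟨v, rfl⟩
      refine ⟨_, ⟨q v, rfl⟩, hle v, ?_⟩
      intro _ halg K _ _
      exact H.isReduced_tensorProduct hlift k v (hle v) halg K

/-- Lifting lattice points along the refined cells is the same as lifting them along the original
cells. -/
lemma lattice_lift_pulledCell_iff (hc : IsCellSystem c) :
    (∀ v, ∀ y ∈ refinedCell q (Set.range c) (q v), y ∈ N' →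
      ∃ x ∈ pulledCell q c (refinedCell q (Set.range c)) v, x ∈ N ∧ q x = y) ↔
    ∀ v, ∀ b ∈ c v, q b ∈ N' → ∃ x ∈ c v, x ∈ N ∧ q x = q b := by
  constructor
  · intro h v b hb hbN
    -- Taking `b` itself as base point puts `q b` in the refined cell, and the cell of `b` is
    -- contained in that of `v`.
    obtain ⟨x, hx, hxN, hxb⟩ := h b (q b) (mem_refinedCell.2 fun _ h => h) hbN
    exact ⟨x, hc.le_of_mem hb hx.2, hxN, hxb⟩
  · intro h v y hy hyN
    obtain ⟨b, hb, rfl⟩ := mem_refinedCell.1 hy v ⟨v, hc.self_mem v, rfl⟩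
    obtain ⟨x, hx, hxN, hxb⟩ := h v b hb hyN
    refine ⟨x, ⟨?_, hx⟩, hxN, hxb⟩
    change q x ∈ refinedCell q (Set.range c) (q v)
    rwa [hxb]

end CellMap

/-! ### The fans of the polytope and the cells of the subdivision -/

section Polytope

variable {d m : ℕ} {A : Finset (Fin d → ℤ)}

theorem isCellMap_productForm [Nonempty A] :
    IsCellMap (lattice d m) (quotientLattice d m) (quotientMap d m)
      (pulledCell (quotientMap d m) (normalCell (productForm A m))
        (refinedCell (quotientMap d m) (Set.range (normalCell (productForm A m)))))
      (refinedCell (quotientMap d m) (Set.range (normalCell (productForm A m)))) := by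
  have hN := isFullLattice_lattice d m
  have hN' := isFullLattice_quotientLattice d m
  have hq : ∀ x ∈ lattice d m, quotientMap d m x ∈ quotientLattice d m :=
    fun x hx => ⟨x, hx, rfl⟩
  have hc := isCellSystem_normalCell (productForm A m)
  have hfin := finite_range_normalCell (productForm A m)
  have hrat := isRational_normalCell (productForm A m) hN productForm_mem_dualLattice
  have hc' := hc.refinedCell hfin
    (mem_refinedCell_add (productForm A m) (quotientMap_surjective d m))
  have hrat' := isRational_refinedCell hN' hq hfin (by
    rintro _ ⟨v, rfl⟩
    exact hrat v)
  exact
    { isFullLattice := hN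
      isFullLattice' := hN'
      surjective := quotientMap_surjective d m
      map_lattice := hq
      exists_lift := fun _ ⟨x, hx, h⟩ => ⟨x, hx, h⟩
      cells := hc.pulledCell hc' _
      cells' := hc'
      rational := fun v => ((hrat' _).comap hN hN' hq).inf hN (hrat v)
      rational' := hrat'
      map_cell := map_pulledCell hc _ }

lemma fanQ_eq_range [Nonempty A] :
    fanQ (convexHull ℝ (realPoints A)) m =
      Set.range (refinedCell (quotientMap d m) (Set.range (normalCell (productForm A m)))) := by
  rw [fanQ, productFan_eq_range]
  ext ξ
  exact exists_congr fun x => eq_comm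

lemma fanR_eq_range [Nonempty A] :
    fanR (convexHull ℝ (realPoints A)) m =
      Set.range (pulledCell (quotientMap d m) (normalCell (productForm A m))
        (refinedCell (quotientMap d m) (Set.range (normalCell (productForm A m))))) := by
  have H := isCellMap_productForm (d := d) (m := m) (A := A)
  rw [fanR, fanQ_eq_range, productFan_eq_range, range_pulledCell
    (isCellSystem_normalCell (productForm A m)) H.cells' H.isFullLattice H.isFullLattice'
    H.map_lattice
    (isRational_normalCell (productForm A m) H.isFullLattice productForm_mem_dualLattice)
    H.rational']

theorem isFan_fanQ [Nonempty A] (hA : affineSpan ℝ (convexHull ℝ (realPoints A)) = ⊤) :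
    IsFan (quotientLattice d m) (fanQ (convexHull ℝ (realPoints A)) m) := by
  have H := isCellMap_productForm (d := d) (m := m) (A := A)
  have hfin := finite_range_normalCell (productForm A m)
  rw [fanQ_eq_range]
  exact H.cells'.isFan H.isFullLattice' (finite_range_refinedCell _ hfin) H.rational'
    ((isCellSystem_normalCell (productForm A m)).stronglyConvex_refinedCell hfin H.isFullLattice
      (isRational_normalCell (productForm A m) H.isFullLattice productForm_mem_dualLattice)
      (stronglyConvex_normalCell (productForm A m) (eq_zero_of_productForm_eq hA)) H.surjective)

theorem isFan_fanR [Nonempty A] (hA : affineSpan ℝ (convexHull ℝ (realPoints A)) = ⊤) :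
    IsFan (lattice d m) (fanR (convexHull ℝ (realPoints A)) m) := by
  have H := isCellMap_productForm (d := d) (m := m) (A := A)
  have hfin := finite_range_normalCell (productForm A m)
  rw [fanR_eq_range]
  exact H.cells.isFan H.isFullLattice
    (finite_range_pulledCell _ hfin (finite_range_refinedCell _ hfin)) H.rational
    fun v x hx hx' => stronglyConvex_normalCell (productForm A m) (eq_zero_of_productForm_eq hA)
      v x hx.2 hx'.2

/-- A cell of the subdivision is the slice of the product cone by `v` plus the diagonal, that is, by
the fiber of `q` through `v`. -/
lemma mem_iInter_translate {σ : Fin m → PointedCone ℝ (Fin d → ℝ)} {v : Fin m → Fin d → ℝ}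
    {u : Fin d → ℝ} : u ∈ ⋂ i, (fun x => -v i + x) '' (σ i : Set (Fin d → ℝ)) ↔
      (v + fun _ => u) ∈ Submodule.pi Set.univ σ := by
  rw [Set.mem_iInter, Submodule.mem_pi]
  refine forall_congr' fun i => ⟨?_, fun h => ⟨v i + u, h trivial, by simp⟩⟩
  rintro ⟨x, hx, rfl⟩ -
  simpa using hx

/-- A non-empty cell at an integral `v` means that the class of `v` has a lift in the cone. For `m >
0` the lattice points in the fiber through `v` are the translates of `v` by integral diagonal
vectors, so lattice lifts correspond to integral points of the cell. -/
theorem lattice_lift_iff_subdivision [Nonempty A] :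
    (∀ v, ∀ b ∈ normalCell (productForm A m) v, quotientMap d m b ∈ quotientLattice d m →
      ∃ x ∈ normalCell (productForm A m) v, x ∈ lattice d m ∧
        quotientMap d m x = quotientMap d m b) ↔
    ∀ v : Fin m → Fin d → ℤ,
      ∀ C ∈ subdivision (convexHull ℝ (realPoints A)) (fun i j => (v i j : ℝ)), C.Nonempty →
        ∃ z : Fin d → ℤ, (fun j => (z j : ℝ)) ∈ C := by
  have hrange : ∀ τ, τ ∈ productFan (convexHull ℝ (realPoints A)) m ↔
      τ ∈ Set.range (normalCell (productForm A m)) := fun τ => by rw [productFan_eq_range]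
  constructor
  · rintro h v _ ⟨σ, hσ, rfl⟩ ⟨u, hu⟩
    obtain ⟨w, hw⟩ := (hrange _).1 ⟨σ, hσ, rfl⟩
    rw [mem_iInter_translate, ← hw] at hu
    have hquot : ∀ u : Fin d → ℝ, quotientMap d m ((fun i j => (v i j : ℝ)) + fun _ => u) =
        quotientMap d m (fun i j => (v i j : ℝ)) := fun u => by
      rw [map_add, LinearMap.mem_ker.1 (mem_ker_quotientMap.2 ⟨u, rfl⟩), add_zero]
    obtain ⟨x, hx, ⟨z, rfl⟩, hxu⟩ := h w _ hu (by
      rw [hquot]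
      exact ⟨_, ⟨v, rfl⟩, rfl⟩)
    rw [hquot, ← sub_eq_zero, ← map_sub, ← LinearMap.mem_ker, mem_ker_quotientMap] at hxu
    obtain ⟨u', hu'⟩ := hxu
    have hz : (fun i j => (z i j : ℝ)) = (fun i j => (v i j : ℝ)) + fun _ => u' := by
      rw [← hu', add_sub_cancel]
    -- For `m = 0` the translation `u'` is not determined by `z`, but the empty intersection is all
    -- of $\mathbb{R}^d$. Otherwise any one coordinate shows that `u'` is integral.
    rcases isEmpty_or_nonempty (Fin m) with hm | ⟨⟨i⟩⟩
    · exact ⟨0, Set.mem_iInter.2 fun i => hm.elim i⟩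
    · refine ⟨z i - v i, ?_⟩
      rw [mem_iInter_translate, ← hw]
      have hu'' : (fun j => ((z i - v i) j : ℝ)) = u' := by
        have := congrFun hz i
        funext j
        have := congrFun this j
        simp only [Pi.add_apply] at this
        push_cast [Pi.sub_apply]
        linarith
      rw [hu'', ← hz]
      exact hx
  · rintro h w b hb ⟨_, ⟨v, rfl⟩, hv⟩
    obtain ⟨σ, hσ, hw⟩ := (hrange _).2 ⟨w, rfl⟩
    have hbv : b - (fun i j => (v i j : ℝ)) ∈ LinearMap.ker (quotientMap d m) := by
      rw [LinearMap.mem_ker, map_sub, sub_eq_zero]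
      exact hv.symm
    obtain ⟨u, hu⟩ := mem_ker_quotientMap.1 hbv
    have hbu : b = (fun i j => (v i j : ℝ)) + fun _ => u := by rw [← hu, add_sub_cancel]
    obtain ⟨z, hz⟩ := h v _ ⟨σ, hσ, rfl⟩ ⟨u, by
      rw [mem_iInter_translate, ← hbu, ← hw]
      exact hb⟩
    rw [mem_iInter_translate, ← hw] at hz
    refine ⟨_, hz, ⟨fun i j => v i j + z j, by ext; simp⟩, ?_⟩
    rw [map_add, LinearMap.mem_ker.1 (mem_ker_quotientMap.2 ⟨_, rfl⟩), add_zero]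
    exact hv

theorem flat_and_isReduced_fiber_toricFamily_iff [Nonempty A] (k : Type u) [Field k]
    (hR : IsFan (lattice d m) (fanR (convexHull ℝ (realPoints A)) m))
    (hQ : IsFan (quotientLattice d m) (fanQ (convexHull ℝ (realPoints A)) m)) :
    (Flat (toricFamily k (convexHull ℝ (realPoints A)) m hR hQ) ∧ ∀ y,
      IsReduced (Scheme.Hom.fiber (toricFamily k (convexHull ℝ (realPoints A)) m hR hQ) y)) ↔
    ∀ v : Fin m → Fin d → ℤ,
      ∀ C ∈ subdivision (convexHull ℝ (realPoints A)) (fun i j => (v i j : ℝ)), C.Nonempty →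
        ∃ z : Fin d → ℤ, (fun j => (z j : ℝ)) ∈ C := by
  have H := isCellMap_productForm (d := d) (m := m) (A := A)
  rw [← lattice_lift_iff_subdivision, ← lattice_lift_pulledCell_iff
    (isCellSystem_normalCell (productForm A m))]
  exact H.flat_and_isReduced_fiber_iff k fanR_eq_range fanQ_eq_range hR hQ _

end Polytope

end Toric

end

theorem mainTheorem1 {k : Type u} [Field k] {d m : ℕ} (P : Set (Fin d → ℝ))
    (hP : Toric.IsFullLatticePolytope P) :
    ∃ (hR : Toric.IsFan (Toric.lattice d m) (Toric.fanR P m))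
      (hQ : Toric.IsFan (Toric.quotientLattice d m) (Toric.fanQ P m)),
      (Flat (Toric.toricFamily k P m hR hQ) ∧
        ∀ y : Toric.toricVariety k hQ,
          IsReduced (Scheme.Hom.fiber (Toric.toricFamily k P m hR hQ) y)) ↔
      ∀ v : Fin m → Fin d → ℤ,
        ∀ C ∈ Toric.subdivision P (fun i j => (v i j : ℝ)), C.Nonempty →
          ∃ z : Fin d → ℤ, (fun j => (z j : ℝ)) ∈ C := by
  obtain ⟨⟨A, rfl⟩, hspan⟩ := hP
  have hne : Nonempty A := by
    by_contra h
    rw [not_nonempty_iff, Finset.isEmpty_coe_sort] at h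
    subst h
    rw [Finset.coe_empty, Set.image_empty, convexHull_empty, AffineSubspace.span_empty] at hspan
    exact AffineSubspace.bot_ne_top ℝ _ _ hspan
  exact ⟨Toric.isFan_fanR hspan, Toric.isFan_fanQ hspan,
    Toric.flat_and_isReduced_fiber_toricFamily_iff k _ _⟩
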